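/- Let $N=\mathbb{Z}^n$ be a lattice of rank $n\ge 0$ (every lattice of rank $n$ has this form after choosing a basis), $N_{\mathbb{R}}=N\otimes\mathbb{R}=\mathbb{R}^n$, and $M=\operatorname{Hom}(N,\mathbb{Z})$. Let $\operatorname{Sym}^*(M)$ be the ring of polynomials on $N_{\mathbb{R}}$ with integer coefficients in the dual basis $e_1^*,\dots,e_n^*$ of $M$. Let $\Delta$ be a complete fan in $N_{\mathbb{R}}$: a finite set of strongly convex rational polyhedral cones with union $N_{\mathbb{R}}$, closed under taking faces, and such that any two of its cones meet in a common face. Let $PP^k(\Delta)$ be the set of continuous functions $f:N_{\mathbb{R}}\to\mathbb{R}$ whose restriction $f_\sigma$ to each maximal cone $\sigma\in\Delta$ is a homogeneous polynomial of degree $k$ in $\operatorname{Sym}^*(M)$. For a maximal cone $\sigma$, let $\sigma^*=\{u : \langle u,v\rangle\ge 0 \text{ for all } v\in\sigma\}$, and let $\operatorname{Hilb}(\sigma)=\sum_{u\in\sigma^*\cap M}x^u$, expressed as a rational function, that is, as $g/h$ with Laurent polynomials $g,h\in\mathbb{Z}[M]$, $h\neq 0$, such that $h\cdot\sum_{u\in\sigma^*\cap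 M}x^u=g$. Let $\operatorname{Hilb}(\sigma)_\circ$ be its principal part at the identity of the torus: expand $g$ and $h$ as power series in the local parameters $y_i=x^{e_i^*}-1$, and take the quotient $g_\circ/h_\circ$ of their lowest-degree homogeneous parts, with $y_i$ replaced by $e_i^*$. This is an element of the field of fractions of $\operatorname{Sym}^*(M)$ that does not depend on the choice of $g$ and $h$. Put $e_\sigma=(-1)^n\operatorname{Hilb}(\sigma)_\circ$. **Proposition.** For every $k \ge 0$ and every $f\in PP^k(\Delta)$, the sum over the maximal cones $\sigma$ of $\Delta$ $$\sum_{\sigma} e_\sigma f_\sigma$$ is a homogeneous polynomial in $\operatorname{Sym}^*(M)$ of degree $k-n$. In particular, it is $0$ if $k<n$, and an integer if $k=n$. -/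

import Mathlib

open scoped Classical

noncomputable section

namespace ToricFan

/-! The lattice is `N = ℤⁿ` (`Fin n → ℤ`), with `N_ℝ = ℝⁿ` (`Fin n → ℝ`).  The dual lattice
`M = Hom(N, ℤ)` is `Fin n → ℤ` in the dual basis `e_1^*, …, e_n^*`, with the pairing
`⟨u, v⟩ = ∑ i, u i * v i`, and `Sym^*(M)` is `MvPolynomial (Fin n) ℤ`, the variable `X i`
being the linear function `e_i^*`. -/

/-- The pairing of `u ∈ M` with `v ∈ N_ℝ`. -/
def pairing {n : ℕ} (u : Fin n → ℤ) (v : Fin n → ℝ) : ℝ := ∑ i, (u i : ℝ) * v i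

/-- A rational polyhedral cone: the set of nonnegative real combinations of finitely many
lattice points. -/
def IsRationalPolyhedral {n : ℕ} (σ : PointedCone ℝ (Fin n → ℝ)) : Prop :=
  ∃ S : Finset (Fin n → ℤ),
    σ = PointedCone.hull ℝ ((fun (w : Fin n → ℤ) (i : Fin n) => (w i : ℝ)) '' (S : Set (Fin n → ℤ)))

/-! ### Fans -/

/-- A fan in `ℝⁿ`: a finite set of strongly convex rational polyhedral cones, closed under taking
faces, such that any two of them meet in a common face. -/
structure Fan (n : ℕ) where
  /-- the cones of the fan -/
  cones : Finset (PointedCone ℝ (Fin n → ℝ))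
  rational : ∀ σ ∈ cones, IsRationalPolyhedral σ
  salient : ∀ σ ∈ cones, (σ : ConvexCone ℝ (Fin n → ℝ)).Salient
  face_mem : ∀ σ ∈ cones, ∀ τ : PointedCone ℝ (Fin n → ℝ), τ.IsFaceOf σ → τ ∈ cones
  inf_isFaceOf : ∀ σ ∈ cones, ∀ τ ∈ cones, (σ ⊓ τ).IsFaceOf σ ∧ (σ ⊓ τ).IsFaceOf τ

namespace Fan

variable {n : ℕ}

/-- The support `|Δ|`, the union of the cones. -/
def support (Δ : Fan n) : Set (Fin n → ℝ) := {v | ∃ σ ∈ Δ.cones, v ∈ σ}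

/-- A fan is complete if its support is all of `N_ℝ`. -/
def IsComplete (Δ : Fan n) : Prop := Δ.support = Set.univ

/-- The maximal cones of `Δ`, with respect to inclusion. -/
def maxCones (Δ : Fan n) : Finset (PointedCone ℝ (Fin n → ℝ)) :=
  Δ.cones.filter fun σ => ∀ τ ∈ Δ.cones, σ ≤ τ → τ = σ

end Fan

/-- An element `f` of `PP^k(Δ)`: a continuous function on `|Δ|` whose restriction to each maximal
cone `σ` is a homogeneous polynomial `f_σ ∈ Sym^*(M)` of degree `k`.  If the maximal cones of `Δ`
have dimension `n` (for instance, if `Δ` is complete), then the polynomials `f_σ`, here `restr σ`,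
are determined by the function. -/
structure PiecewisePolynomial {n : ℕ} (Δ : Fan n) (k : ℕ) where
  /-- the function on the support -/
  toFun : Δ.support → ℝ
  continuous_toFun : Continuous toFun
  /-- the polynomial `f_σ` for each maximal cone `σ` -/
  restr : Δ.maxCones → MvPolynomial (Fin n) ℤ
  restr_homogeneous : ∀ σ, (restr σ).IsHomogeneous k
  toFun_eq : ∀ (σ : Δ.maxCones) (v : Δ.support), (v : Fin n → ℝ) ∈ (σ : PointedCone ℝ (Fin n → ℝ)) →
    toFun v = MvPolynomial.aeval (v : Fin n → ℝ) (restr σ)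

/-! ### Generating functions of lattice points -/

/-- The Laurent polynomial ring `ℤ[M]`, with basis the characters `x^u`, `u ∈ M`. -/
abbrev Laurent (n : ℕ) : Type := AddMonoidAlgebra ℤ (Fin n → ℤ)

/-- `h · ∑_{u ∈ S} x^u = g`, as formal (two-sided infinite) series with exponents in `M`:
for each `w`, the coefficient of `x^w` on the left is the sum of the coefficients of `h` at those
`u` with `w - u ∈ S`. -/
def MulSeriesEq {n : ℕ} (S : Set (Fin n → ℤ)) (h g : Laurent n) : Prop :=
  ∀ w : Fin n → ℤ, (∑ u ∈ h.coeff.support, if w - u ∈ S then h.coeff u else 0) = g.coeff w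

/-- The rational function `F` is the generating function `∑_{u ∈ S} x^u`: it is `g / h` for some
Laurent polynomials with `h · ∑_{u ∈ S} x^u = g`.  There is at most one such `F`. -/
def IsGeneratingFunction {n : ℕ} (S : Set (Fin n → ℤ)) (F : FractionRing (Laurent n)) : Prop :=
  ∃ (g : Laurent n) (h : nonZeroDivisors (Laurent n)),
    MulSeriesEq S h g ∧ F = IsLocalization.mk' (FractionRing (Laurent n)) g h

/-- The lattice points of the dual cone, `σ^* ∩ M`. -/
def dualLatticePoints {n : ℕ} (σ : PointedCone ℝ (Fin n → ℝ)) : Set (Fin n → ℤ) :=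
  {u | ∀ v ∈ σ, 0 ≤ pairing u v}

/-- `Hilb(σ) = ∑_{u ∈ σ^* ∩ M} x^u`, expressed as a rational function.  (Such a rational function
exists for every rational polyhedral cone; the value `0` elsewhere is a convention.) -/
def hilb {n : ℕ} (σ : PointedCone ℝ (Fin n → ℝ)) : FractionRing (Laurent n) :=
  if H : ∃ F, IsGeneratingFunction (dualLatticePoints σ) F then H.choose else 0

/-! ### Principal parts at the identity of the torus -/

/-- `1 + y_i`, a unit in the power series ring, with inverse `(1 + y_i)⁻¹`. -/
def onePlusX {n : ℕ} (i : Fin n) : (MvPowerSeries (Fin n) ℤ)ˣ where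
  val := 1 + MvPowerSeries.X i
  inv := MvPowerSeries.invOfUnit (1 + MvPowerSeries.X i) 1
  val_inv := MvPowerSeries.mul_invOfUnit _ _ (by simp)
  inv_val := by rw [mul_comm]; exact MvPowerSeries.mul_invOfUnit _ _ (by simp)

/-- The expansion of Laurent polynomials as power series in the local parameters
`y_i = x^{e_i^*} - 1` at the identity of the torus, so `x^u ↦ ∏ i, (1 + y_i)^{u_i}`. -/
def expand (n : ℕ) : Laurent n →ₐ[ℤ] MvPowerSeries (Fin n) ℤ :=
  AddMonoidAlgebra.lift ℤ (MvPowerSeries (Fin n) ℤ) (Fin n → ℤ)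
    { toFun := fun u =>
        ((∏ i, onePlusX i ^ (Multiplicative.toAdd u i) : (MvPowerSeries (Fin n) ℤ)ˣ) :
          MvPowerSeries (Fin n) ℤ)
      map_one' := by simp
      map_mul' := fun u v => by simp [zpow_add, Finset.prod_mul_distrib] }

/-- The leading form of a power series: the sum of its terms of lowest total degree (`0` for the
zero series). -/
def leadingForm {n : ℕ} (φ : MvPowerSeries (Fin n) ℤ) : MvPolynomial (Fin n) ℤ :=
  ∑ d ∈ (Finset.univ : Finset (Fin n)).finsuppAntidiag φ.order.toNat,
    MvPolynomial.monomial d (MvPowerSeries.coeff d φ)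

/-- The field of fractions of `Sym^*(M)`, which contains `Sym^±(M)`. -/
abbrev RatFun (n : ℕ) : Type := FractionRing (MvPolynomial (Fin n) ℤ)

/-- The principal part at the identity of a rational function `F = g / h` on the torus: the
quotient of the leading forms of `g` and `h`, where the class of `y_i` in the cotangent space is
`e_i^*`.  (It does not depend on the choice of the fraction, as leading forms are
multiplicative.) -/
def principalPart {n : ℕ} (F : FractionRing (Laurent n)) : RatFun n :=
  algebraMap (MvPolynomial (Fin n) ℤ) (RatFun n)
      (leadingForm (expand n (IsLocalization.sec (nonZeroDivisors (Laurent n)) F).1)) /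
    algebraMap (MvPolynomial (Fin n) ℤ) (RatFun n)
      (leadingForm (expand n (IsLocalization.sec (nonZeroDivisors (Laurent n)) F).2))

/-- The equivariant multiplicity `e_σ = (-1)^n Hilb(σ)_∘`. -/
def equivMult {n : ℕ} (σ : PointedCone ℝ (Fin n → ℝ)) : RatFun n :=
  (-1) ^ n * principalPart (hilb σ)

/-- The sum `∑_σ e_σ f_σ` over the maximal cones `σ` of `Δ`. -/
def pushforward {n : ℕ} (Δ : Fan n) {k : ℕ} (f : PiecewisePolynomial Δ k) : RatFun n :=
  ∑ σ : Δ.maxCones,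
    equivMult (σ : PointedCone ℝ (Fin n → ℝ)) *
      algebraMap (MvPolynomial (Fin n) ℤ) (RatFun n) (f.restr σ)

end ToricFan

end

/-! Clearing denominators in the series of `σ^* ∩ M` with `∏ (1 - x^w)`, where `w` runs over
primitive generators of this monoid, leaves a Laurent polynomial
(`finite_support_seriesAction_prod`). The leading form of `1 - x^w` at the identity is the linear
form `-w`, so every `e_σ`, and hence the sum, is a fraction whose denominator is a product of
primitive linear forms. These are prime in the factorial ring `Sym^*(M)`. It is therefore enough
that the sum has no pole along any hyperplane `u = 0` with `u` primitive.

Along `u = 0`, the term `e_σ` has at most a simple pole, and it has none unless `σ` lies on one side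
of the hyperplane and meets it in a cone spanning it, a wall. In that case exactly one maximal cone
`σ'` lies across the wall. Let `φ`, `φ'` and `τ` be the indicator functions of the lattice points of
the duals of `σ`, of `σ'` and of the wall. Far out in the direction `u`, `φ` agrees with `τ` and
`φ'` vanishes; in the direction `-u` the roles are exchanged. So `φ + φ' - τ` has finite support on
each line parallel to `u`, while `1 - x^u` annihilates `τ`. It follows that `1 - x^u` cancels from
the denominator of `Hilb(σ) + Hilb(σ')` (`exists_dvd_of_adjacent`), and `e_σ + e_σ'` is regular
along `u = 0` (`IsFullCone.equivMult_add_mem`). Since `f_σ - f_σ'` vanishes on the wall, it is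
divisible by `u`, and `e_σ f_σ + e_σ' f_σ' = (e_σ + e_σ') f_σ' + e_σ (f_σ - f_σ')` is regular too.
The poles of the sum thus cancel in pairs.

Both the degree of the sum and the passage from `Hilb` to leading forms need `e_σ` to have degree
exactly `-n`. This comes from growth: at the point `exp(-s v)` of the torus, with `v` interior to
`σ`, the series lies between two positive multiples of `s^(-n)` as `s → 0+`, while `g / h` behaves
like a power of `s` whose exponent is the difference of the orders of `g` and `h`
(`order_add_eq_order`). -/

namespace ToricFan

variable {n : ℕ}

/-! ### Laurent polynomials acting on formal series -/

/-- Laurent polynomials act on formal two-sided infinite series with exponents in `M`, that is, on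
functions `M → ℤ`; the character `x^u` acts by translation by `u`. -/
noncomputable def seriesAction (n : ℕ) : Laurent n →ₐ[ℤ] Module.End ℤ ((Fin n → ℤ) → ℤ) :=
  AddMonoidAlgebra.lift ℤ (Module.End ℤ ((Fin n → ℤ) → ℤ)) (Fin n → ℤ)
    { toFun := fun u =>
        { toFun := fun φ w => φ (w - Multiplicative.toAdd u)
          map_add' := fun _ _ => rfl
          map_smul' := fun _ _ => rfl }
      map_one' := by ext; simp
      map_mul' := fun u v => by
        ext φ w
        simp [sub_sub] }

/-- The character `x^u` as a Laurent polynomial. -/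
noncomputable def character (u : Fin n → ℤ) : Laurent n := AddMonoidAlgebra.single u 1

theorem character_add (u v : Fin n → ℤ) : character (u + v) = character u * character v := by
  simp [character, AddMonoidAlgebra.single_mul_single]

theorem character_zero : character (0 : Fin n → ℤ) = 1 := rfl

theorem seriesAction_apply (h : Laurent n) (φ : (Fin n → ℤ) → ℤ) (w : Fin n → ℤ) :
    seriesAction n h φ w = ∑ u ∈ h.coeff.support, h.coeff u * φ (w - u) := by
  rw [seriesAction, AddMonoidAlgebra.lift_apply, Finsupp.sum]
  simp [LinearMap.sum_apply, Finset.sum_apply]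

@[simp] theorem seriesAction_character (u : Fin n → ℤ) (φ : (Fin n → ℤ) → ℤ) (w : Fin n → ℤ) :
    seriesAction n (character u) φ w = φ (w - u) := by
  simp [seriesAction, character]

theorem seriesAction_mul (g h : Laurent n) (φ : (Fin n → ℤ) → ℤ) :
    seriesAction n (g * h) φ = seriesAction n g (seriesAction n h φ) := by
  rw [map_mul]; rfl

theorem seriesAction_one_sub_character (u : Fin n → ℤ) (φ : (Fin n → ℤ) → ℤ) (w : Fin n → ℤ) :
    seriesAction n (1 - character u) φ w = φ w - φ (w - u) := by
  rw [map_sub, map_one, LinearMap.sub_apply, Pi.sub_apply, seriesAction_character]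
  rfl

theorem coeff_mul_eq_seriesAction (g h : Laurent n) :
    ((g * h).coeff : (Fin n → ℤ) → ℤ) = seriesAction n g h.coeff := by
  ext w
  rw [seriesAction_apply, AddMonoidAlgebra.coeff_mul]
  refine Finset.sum_congr rfl fun u _ => ?_
  change ∑ m ∈ _, _ = _
  rw [Finset.sum_eq_single (w - u)]
  · simp
  · intro b _ hb
    refine if_neg ?_
    rintro rfl
    simp at hb
  · intro hb
    simp [Finsupp.notMem_support_iff.mp hb]

theorem mulSeriesEq_iff (S : Set (Fin n → ℤ)) (h g : Laurent n) :
    MulSeriesEq S h g ↔ seriesAction n h (S.indicator 1) = g.coeff := by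
  rw [funext_iff]
  refine forall_congr' fun w => ?_
  rw [seriesAction_apply]
  simp [Set.indicator_apply]

/-- Both products are the result of applying `h₁ h₂` to the indicator function of `S`. This is the
uniqueness of the rational function attached to `S`. -/
theorem MulSeriesEq.mul_comm {S : Set (Fin n → ℤ)} {h₁ g₁ h₂ g₂ : Laurent n}
    (H₁ : MulSeriesEq S h₁ g₁) (H₂ : MulSeriesEq S h₂ g₂) : h₂ * g₁ = h₁ * g₂ := by
  rw [mulSeriesEq_iff] at H₁ H₂
  have : ((h₂ * g₁).coeff : (Fin n → ℤ) → ℤ) = (h₁ * g₂).coeff := by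
    rw [coeff_mul_eq_seriesAction, coeff_mul_eq_seriesAction, ← H₁, ← H₂, ← seriesAction_mul,
      ← seriesAction_mul, _root_.mul_comm]
  exact congrArg AddMonoidAlgebra.ofCoeff (DFunLike.coe_injective this)

theorem MulSeriesEq.mul_left {S : Set (Fin n → ℤ)} {h g : Laurent n} (H : MulSeriesEq S h g)
    (k : Laurent n) : MulSeriesEq S (k * h) (k * g) := by
  rw [mulSeriesEq_iff] at H ⊢
  rw [seriesAction_mul, H, coeff_mul_eq_seriesAction]

theorem exists_laurent_of_finite_support {φ : (Fin n → ℤ) → ℤ}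
    (hφ : (Function.support φ).Finite) : ∃ g : Laurent n, (g.coeff : (Fin n → ℤ) → ℤ) = φ :=
  ⟨.ofCoeff (Finsupp.ofSupportFinite φ hφ), rfl⟩

/-! ### Primitive generators of the dual monoid -/

/-- The lattice points `u` with `⟨u, v⟩ ≥ 0` for all `v ∈ G`. -/
def latticeDual (G : Finset (Fin n → ℤ)) : AddSubmonoid (Fin n → ℤ) where
  carrier := {u | ∀ v ∈ G, 0 ≤ u ⬝ᵥ v}
  zero_mem' := by simp
  add_mem' := fun {a b} ha hb v hv => by
    rw [add_dotProduct]
    exact add_nonneg (ha v hv) (hb v hv)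

/-- A lattice vector is primitive if it is not divisible by a non-unit integer. -/
def IsPrimitiveVector (u : Fin n → ℤ) : Prop := ∀ c : ℤ, (∀ i, c ∣ u i) → IsUnit c

theorem IsPrimitiveVector.neg {u : Fin n → ℤ} (hu : IsPrimitiveVector u) :
    IsPrimitiveVector (-u) := fun c hc => hu c fun i => by simpa using hc i

theorem IsPrimitiveVector.ne_zero {u : Fin n → ℤ} (hu : IsPrimitiveVector u) : u ≠ 0 := by
  rintro rfl
  have := hu 0 (fun i => dvd_refl _)
  simp at this

/-- Gordan's lemma. Evaluation on `G` embeds `M` in `ℤ^G`, and the dual monoid becomes the set of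
nonnegative vectors of a subgroup. Such a submonoid of `ℕ^G` is closed under those differences that
stay in `ℕ^G`, hence finitely generated. -/
theorem latticeDual_fg (G : Finset (Fin n → ℤ))
    (hG : ∀ u : Fin n → ℤ, (∀ v ∈ G, u ⬝ᵥ v = 0) → u = 0) : (latticeDual G).FG := by
  let ev : (Fin n → ℤ) →+ (G → ℤ) :=
    { toFun := fun u v => u ⬝ᵥ v.1
      map_zero' := by ext; simp
      map_add' := fun a b => by ext; simp [add_dotProduct] }
  have hev : Function.Injective ev := by
    rw [injective_iff_map_eq_zero]
    exact fun u hu => hG u fun v hv => congrFun hu ⟨v, hv⟩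
  let cast : (G → ℕ) →+ (G → ℤ) :=
    { toFun := fun a v => (a v : ℤ)
      map_zero' := by ext; simp
      map_add' := fun a b => by ext; simp }
  let P : AddSubmonoid (G → ℕ) := (AddMonoidHom.mrange ev).comap cast
  have hP : P.FG := by
    refine AddSubmonoid.fg_of_subtractive ?_
    rintro x ⟨a, ha⟩ y ⟨b, hb⟩
    refine ⟨b - a, ?_⟩
    rw [map_sub, hb, ha, map_add]
    simp
  refine AddSubmonoid.FG.map_injective ev hev ?_
  have : (latticeDual G).map ev = P.map cast := by
    ext z
    simp only [AddSubmonoid.mem_map]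
    constructor
    · rintro ⟨u, hu, rfl⟩
      have : cast (fun v => (u ⬝ᵥ v.1).toNat) = ev u := by
        ext v
        exact Int.toNat_of_nonneg (hu v.1 v.2)
      exact ⟨_, ⟨u, this.symm⟩, this⟩
    · rintro ⟨a, ⟨u, hu⟩, rfl⟩
      refine ⟨u, fun v hv => ?_, hu⟩
      have := congrFun hu ⟨v, hv⟩
      change u ⬝ᵥ v = (a ⟨v, hv⟩ : ℤ) at this
      simp [this]
  rw [this]
  exact hP.map cast

/-- The dual monoid has no units except `0`, so its finitely many irreducible elements generate it.
An irreducible element is primitive: `w = c z` with `c ≥ 2` would split as `z + (c - 1) z` inside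
the monoid. -/
theorem exists_primitive_generators (G : Finset (Fin n → ℤ))
    (hG : ∀ u : Fin n → ℤ, (∀ v ∈ G, u ⬝ᵥ v = 0) → u = 0) :
    ∃ W : Finset (Fin n → ℤ), AddSubmonoid.closure (W : Set (Fin n → ℤ)) = latticeDual G ∧
      ∀ w ∈ W, IsPrimitiveVector w := by
  have hfg : AddMonoid.FG (latticeDual G) :=
    (AddMonoid.fg_iff_addSubmonoid_fg _).mpr (latticeDual_fg G hG)
  have hneg : ∀ a b : Fin n → ℤ, a ∈ latticeDual G → b ∈ latticeDual G → a + b = 0 → a = 0 := by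
    intro a b ha hb hab
    refine hG a fun v hv => le_antisymm ?_ (ha v hv)
    have h1 := hb v hv
    have h2 : a ⬝ᵥ v + b ⬝ᵥ v = 0 := by rw [← add_dotProduct, hab, zero_dotProduct]
    linarith
  have hsub : Subsingleton (AddUnits (latticeDual G)) := by
    refine ⟨fun a b => ?_⟩
    have key : ∀ c : AddUnits (latticeDual G), (c : latticeDual G) = 0 := fun c =>
      Subtype.ext (hneg _ _ c.val.2 c.neg.2 (congrArg Subtype.val c.val_neg))
    exact AddUnits.ext ((key a).trans (key b).symm)
  let _ : AddCancelCommMonoid (latticeDual G) :=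
    { (inferInstance : AddCommMonoid (latticeDual G)) with
      add_left_cancel := fun a _ _ h => add_left_cancel (a := a) h }
  have hfin := finite_addIrreducible (M := latticeDual G)
  refine ⟨hfin.toFinset.image Subtype.val, ?_, ?_⟩
  · have := congrArg (AddSubmonoid.map (latticeDual G).subtype)
      (AddSubmonoid.closure_addIrreducible (M := latticeDual G))
    rw [AddMonoidHom.map_mclosure] at this
    rw [← AddMonoidHom.mrange_eq_map, AddSubmonoid.mrange_subtype] at this
    simpa using this
  · intro w hw
    simp only [Finset.mem_image, Set.Finite.mem_toFinset] at hw
    obtain ⟨⟨w, hwS⟩, hirr, rfl⟩ := hw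
    change AddIrreducible _ at hirr
    intro c hc
    have key : ∀ c : ℤ, 0 ≤ c → (∀ i, c ∣ w i) → IsUnit c := by
      intro c hc0 hc
      choose z hz using hc
      have hwz : w = c • z := by ext i; simp [hz i]
      have hw0 : w ≠ 0 := by
        rintro rfl
        exact hirr.1 (by convert! isAddUnit_zero)
      have hcpos : 0 < c := lt_of_le_of_ne hc0 (by rintro rfl; simp at hwz; exact hw0 hwz)
      have hzS : z ∈ latticeDual G := fun v hv => by
        have := hwS v hv
        rw [hwz, smul_dotProduct, smul_eq_mul] at this
        exact nonneg_of_mul_nonneg_right this hcpos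
      have hz0 : z ≠ 0 := by rintro rfl; simp at hwz; exact hw0 hwz
      have hzS' : (c - 1) • z ∈ latticeDual G := fun v hv => by
        rw [smul_dotProduct, smul_eq_mul]
        exact mul_nonneg (by omega) (hzS v hv)
      have := hirr.2 (a := ⟨z, hzS⟩) (b := ⟨(c - 1) • z, hzS'⟩)
        (Subtype.ext (by change w = z + (c - 1) • z; rw [hwz, sub_smul, one_smul]; abel))
      have hunit : ∀ (a : Fin n → ℤ) (ha : a ∈ latticeDual G),
          IsAddUnit (⟨a, ha⟩ : latticeDual G) → a = 0 := fun a ha h => by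
        obtain ⟨x, hx⟩ := h
        have : x = 0 := Subsingleton.elim _ _
        rw [this] at hx
        exact (congrArg Subtype.val hx).symm
      rcases this with h | h
      · exact absurd (hunit _ _ h) hz0
      · have := hunit _ _ h
        rcases smul_eq_zero.mp this with h | h
        · rw [show c = 1 by omega]; exact isUnit_one
        · exact absurd h hz0
    rcases le_total 0 c with h | h
    · exact key c h hc
    · have := key (-c) (by omega) (fun i => by simpa using hc i)
      simpa using this

/-! ### Rationality of the generating function -/

/-- At a point `m` of the support, no factor `1 - x^w` may annihilate the series near `m`. This
forces `m` to be close to some facet inequality on which `w` is nonzero, and so bounds the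
multiplicity of `w` in an expression of `m` by the generators. -/
theorem finite_support_seriesAction_prod (G W : Finset (Fin n → ℤ))
    (hW : AddSubmonoid.closure (W : Set (Fin n → ℤ)) = latticeDual G) :
    (Function.support (seriesAction n (∏ w ∈ W, (1 - character w))
      ((latticeDual G : Set (Fin n → ℤ)).indicator 1))).Finite := by
  set φ : (Fin n → ℤ) → ℤ := (latticeDual G : Set (Fin n → ℤ)).indicator 1 with hφ
  set h : Laurent n := ∏ w ∈ W, (1 - character w) with hh
  let h' : (Fin n → ℤ) → Laurent n := fun w₀ => ∏ w ∈ W.erase w₀, (1 - character w)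
  have hWS : ∀ w ∈ W, w ∈ latticeDual G := fun w hw =>
    hW ▸ AddSubmonoid.subset_closure (Finset.mem_coe.mpr hw)
  -- If `m ⬝ᵥ v ≥ B`, the inequality for `v` holds at both `m - u` and `m - u - w₀`, for every
  -- exponent `u` of the product without `w₀`.
  obtain ⟨B, hB⟩ := Finset.exists_le (W.biUnion fun w₀ =>
    (((h' w₀).coeff.support ×ˢ G).image fun p => |p.1 ⬝ᵥ p.2| + |w₀ ⬝ᵥ p.2|))
  obtain ⟨B', hB'⟩ := Finset.exists_le
    ((h.coeff.support ×ˢ G).image fun p : (Fin n → ℤ) × (Fin n → ℤ) => |p.1 ⬝ᵥ p.2|)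
  have hmem : ∀ m, φ m = if m ∈ latticeDual G then 1 else 0 := fun m => by
    simp [hφ, Set.indicator_apply]
  have key : ∀ m, seriesAction n h φ m ≠ 0 → ∀ w₀ ∈ W, ∃ v ∈ G, m ⬝ᵥ v < B ∧ w₀ ⬝ᵥ v ≠ 0 := by
    intro m hm w₀ hw₀
    by_contra! hcon
    apply hm
    rw [hh, ← Finset.prod_erase_mul _ _ hw₀, seriesAction_mul, seriesAction_apply]
    refine Finset.sum_eq_zero fun u hu => ?_
    rw [seriesAction_one_sub_character, hmem, hmem]
    have : (m - u ∈ latticeDual G) ↔ (m - u - w₀ ∈ latticeDual G) := by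
      refine forall₂_congr fun v hv => ?_
      rw [sub_dotProduct, sub_dotProduct, sub_dotProduct]
      by_cases hmv : m ⬝ᵥ v < B
      · rw [hcon v hv hmv, sub_zero]
      · have := hB (|u ⬝ᵥ v| + |w₀ ⬝ᵥ v|) (Finset.mem_biUnion.mpr ⟨w₀, hw₀, Finset.mem_image.mpr
          ⟨(u, v), Finset.mem_product.mpr ⟨hu, hv⟩, rfl⟩⟩)
        have h1 := le_abs_self (u ⬝ᵥ v)
        have h2 := le_abs_self (w₀ ⬝ᵥ v)
        have h3 := abs_nonneg (w₀ ⬝ᵥ v)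
        constructor <;> intro <;> linarith
    simp only [this, sub_self, mul_zero]
  -- Each `m` in the support is an exponent `u` of `h` plus a combination of the generators. The
  -- vector `v` from `key` satisfies `w ⬝ᵥ v ≥ 1`, so the coefficient of `w` is at most `(m - u) ⬝ᵥ
  -- v ≤ B + B'`.
  refine (Set.finite_range (fun p : h.coeff.support × (W → Fin ((B + B').toNat + 1)) =>
    (p.1 : Fin n → ℤ) + ∑ w : W, (p.2 w : ℕ) • (w : Fin n → ℤ))).subset ?_
  intro m hm
  rw [Function.mem_support] at hm
  have hm' := hm
  rw [seriesAction_apply] at hm'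
  obtain ⟨u, hu, hu'⟩ := Finset.exists_ne_zero_of_sum_ne_zero hm'
  have hmu : m - u ∈ latticeDual G := by
    by_contra hcon
    rw [hmem, if_neg hcon, mul_zero] at hu'
    exact hu' rfl
  have hmu' := hmu
  rw [← hW, AddSubmonoid.mem_closure_finset] at hmu'
  obtain ⟨f, -, hf⟩ := hmu'
  have hfB : ∀ w ∈ W, f w < (B + B').toNat + 1 := by
    intro w hw
    obtain ⟨v, hv, hmv, hwv⟩ := key m hm w hw
    have h1 : (f w : ℤ) * (w ⬝ᵥ v) ≤ (m - u) ⬝ᵥ v := by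
      rw [← hf, sum_dotProduct]
      have := Finset.single_le_sum (f := fun a => (f a • a) ⬝ᵥ v)
        (fun a ha => by
          rw [smul_dotProduct]
          exact nsmul_nonneg (hWS a ha v hv) _) hw
      refine le_trans (le_of_eq ?_) this
      rw [smul_dotProduct, nsmul_eq_mul]
    have h2 : 1 ≤ w ⬝ᵥ v := by
      have := hWS w hw v hv
      omega
    have h3 := hB' |u ⬝ᵥ v| (Finset.mem_image.mpr ⟨(u, v), Finset.mem_product.mpr ⟨hu, hv⟩, rfl⟩)
    have h4 := neg_abs_le (u ⬝ᵥ v)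
    rw [sub_dotProduct] at h1
    have h5 : (f w : ℤ) ≤ B + B' := by nlinarith [Int.natCast_nonneg (f w)]
    omega
  refine ⟨(⟨u, hu⟩, fun w => ⟨f w, hfB w w.2⟩), ?_⟩
  have : ∑ w : W, f w • (w : Fin n → ℤ) = m - u := by
    rw [← hf]
    exact Finset.sum_coe_sort W fun w => f w • w
  change u + ∑ w : W, f w • (w : Fin n → ℤ) = m
  rw [this, add_sub_cancel]

/-! ### Cancelling a factor `1 - x^u` from the denominator -/

/-- Along every line in the direction `u`, the function `φ` has finite support. -/
def FiniteAlong (u : Fin n → ℤ) (φ : (Fin n → ℤ) → ℤ) : Prop :=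
  ∀ m, ∀ᶠ k : ℕ in Filter.atTop, φ (m + k • u) = 0 ∧ φ (m - k • u) = 0

theorem FiniteAlong.seriesAction {u : Fin n → ℤ} {φ : (Fin n → ℤ) → ℤ} (hφ : FiniteAlong u φ)
    (h : Laurent n) : FiniteAlong u (seriesAction n h φ) := by
  intro m
  have := (Filter.eventually_all_finset h.coeff.support).mpr fun w _ => hφ (m - w)
  filter_upwards [this] with k hk
  rw [seriesAction_apply, seriesAction_apply]
  constructor
  · refine Finset.sum_eq_zero fun w hw => ?_
    rw [show m + k • u - w = m - w + k • u by abel, (hk w hw).1, mul_zero]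
  · refine Finset.sum_eq_zero fun w hw => ?_
    rw [show m - k • u - w = m - w - k • u by abel, (hk w hw).2, mul_zero]

/-- Starting from a point where `φ ≠ 0`, the function must change its value in both directions `u`
and `-u`, and the changes occur in the finite support `F` of `(1 - x^u) φ`. So every point of the
support lies on a segment between two points of `F`. -/
theorem FiniteAlong.finite_support {u : Fin n → ℤ} {φ : (Fin n → ℤ) → ℤ} (hu : u ≠ 0)
    (hφ : FiniteAlong u φ)
    (hf : (Function.support (ToricFan.seriesAction n (1 - character u) φ)).Finite) :
    (Function.support φ).Finite := by
  set F := hf.toFinset with hF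
  have hmemF : ∀ m, m ∈ F ↔ φ m ≠ φ (m - u) := fun m => by
    rw [hF, Set.Finite.mem_toFinset, Function.mem_support, seriesAction_one_sub_character,
      sub_ne_zero]
  obtain ⟨i, hi⟩ := Function.ne_iff.mp hu
  -- A coordinate with `u i ≠ 0` turns the number of steps between two points of `F` into a
  -- difference of coordinates, bounded by `N`.
  obtain ⟨N, hN⟩ := Finset.exists_le ((F ×ˢ F).image fun p => (|p.1 i - p.2 i|).toNat)
  have up : ∀ m, φ m ≠ 0 → ∃ k : ℕ, m + k • u ∈ F := by
    intro m hm
    by_contra! hcon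
    have : ∀ k : ℕ, φ (m + k • u) = φ m := by
      intro k
      induction k with
      | zero => simp
      | succ k ih =>
        have := hcon (k + 1)
        rw [hmemF, not_not] at this
        rw [this, ← ih]
        congr 1
        rw [succ_nsmul]
        abel
    obtain ⟨k, hk⟩ := (hφ m).exists
    exact hm (by rw [← this k, hk.1])
  have down : ∀ m, φ m ≠ 0 → ∃ k : ℕ, m - k • u ∈ F := by
    intro m hm
    by_contra! hcon
    have : ∀ k : ℕ, φ (m - k • u) = φ m := by
      intro k
      induction k with
      | zero => simp
      | succ k ih =>
        have := hcon k
        rw [hmemF, not_not] at this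
        rw [← ih, this]
        congr 1
        rw [succ_nsmul]
        abel
    obtain ⟨k, hk⟩ := (hφ m).exists
    exact hm (by rw [← this k, hk.2])
  refine (((F ×ˢ Finset.range (N + 1)).image fun p => p.1 - p.2 • u).finite_toSet).subset ?_
  intro m hm
  obtain ⟨k, hk⟩ := up m hm
  obtain ⟨l, hl⟩ := down m hm
  have h1 := hN _ (Finset.mem_image.mpr ⟨(_, _), Finset.mem_product.mpr ⟨hk, hl⟩, rfl⟩)
  have h2 : (m + k • u) i - (m - l • u) i = (k + l : ℤ) * u i := by
    simp
    ring
  have h3 : (k : ℤ) ≤ |(m + k • u) i - (m - l • u) i| := by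
    rw [h2, abs_mul]
    have : 1 ≤ |u i| := Int.one_le_abs hi
    have h5 : |(k + l : ℤ)| = k + l := abs_of_nonneg (by positivity)
    rw [h5]
    nlinarith
  refine Finset.mem_coe.mpr (Finset.mem_image.mpr ⟨(m + k • u, k), Finset.mem_product.mpr
    ⟨hk, Finset.mem_range.mpr ?_⟩, by simp⟩)
  dsimp only at h1
  omega

/-- The inequalities with `u ⬝ᵥ v > 0` hold far out in the direction `u`; those with `u ⬝ᵥ v = 0` do
not change along the line. -/
theorem eventually_add_nsmul_mem_latticeDual (G : Finset (Fin n → ℤ)) {u : Fin n → ℤ}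
    (hu : u ∈ latticeDual G) (m : Fin n → ℤ) :
    ∀ᶠ k : ℕ in Filter.atTop, (m + k • u ∈ latticeDual G ↔
      m ∈ latticeDual (G.filter fun v => u ⬝ᵥ v = 0)) := by
  by_cases hm : m ∈ latticeDual (G.filter fun v => u ⬝ᵥ v = 0)
  · have : ∀ᶠ k : ℕ in Filter.atTop, ∀ v ∈ G, 0 ≤ (m + k • u) ⬝ᵥ v := by
      refine (Filter.eventually_all_finset G).mpr fun v hv => ?_
      filter_upwards [Filter.eventually_ge_atTop (|m ⬝ᵥ v|).toNat] with k hk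
      rw [add_dotProduct, smul_dotProduct, nsmul_eq_mul]
      rcases eq_or_lt_of_le (hu v hv) with h0 | h0
      · rw [← h0, mul_zero, add_zero]
        exact hm v (Finset.mem_filter.mpr ⟨hv, h0.symm⟩)
      · have := neg_abs_le (m ⬝ᵥ v)
        have h1 : |m ⬝ᵥ v| ≤ k := by omega
        nlinarith
    filter_upwards [this] with k hk
    exact ⟨fun _ => hm, fun _ => hk⟩
  · refine Filter.Eventually.of_forall fun k => ⟨fun h => ?_, fun h => absurd h hm⟩
    intro v hv
    obtain ⟨hv, h0⟩ := Finset.mem_filter.mp hv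
    have := h v hv
    rwa [add_dotProduct, smul_dotProduct, h0, smul_zero, add_zero] at this

theorem eventually_sub_nsmul_notMem_latticeDual (G : Finset (Fin n → ℤ)) {u : Fin n → ℤ}
    (hu : ∃ v ∈ G, 0 < u ⬝ᵥ v) (m : Fin n → ℤ) :
    ∀ᶠ k : ℕ in Filter.atTop, m - k • u ∉ latticeDual G := by
  obtain ⟨v, hv, huv⟩ := hu
  filter_upwards [Filter.eventually_gt_atTop (m ⬝ᵥ v).toNat] with k hk h
  have := h v hv
  rw [sub_dotProduct, smul_dotProduct, nsmul_eq_mul] at this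
  have h1 : m ⬝ᵥ v < k := by omega
  nlinarith

theorem add_zsmul_mem_latticeDual_iff (G : Finset (Fin n → ℤ)) {u : Fin n → ℤ}
    (hu : ∀ v ∈ G, u ⬝ᵥ v = 0) (m : Fin n → ℤ) (k : ℤ) :
    m + k • u ∈ latticeDual G ↔ m ∈ latticeDual G := by
  refine forall₂_congr fun v hv => ?_
  rw [add_dotProduct, smul_dotProduct, hu v hv, smul_zero, add_zero]

theorem one_sub_character_eq_neg (u : Fin n → ℤ) :
    1 - character u = -character u * (1 - character (-u)) := by
  rw [mul_sub, mul_one, neg_mul, ← character_add, add_neg_cancel, character_zero]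
  ring

theorem seriesAction_one_sub_character_indicator (G : Finset (Fin n → ℤ)) {u : Fin n → ℤ}
    (hu : ∀ v ∈ G, u ⬝ᵥ v = 0) :
    seriesAction n (1 - character u) ((latticeDual G : Set (Fin n → ℤ)).indicator 1) = 0 := by
  ext m
  have := add_zsmul_mem_latticeDual_iff G hu m (-1)
  rw [neg_one_smul, ← sub_eq_add_neg] at this
  rw [seriesAction_one_sub_character]
  simp [Set.indicator_apply, this]

/-- In the direction `u` the series stabilizes to that of the dual of the face `u = 0`, which `1 -
x^w` annihilates when `w` vanishes on this face. Hence `(1 - x^w) φ` has finite support along `u`,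
and `1 - x^w` can replace `1 - x^u` in the denominator. When the face is not a wall, `w` can be
chosen outside `ℤ u`, and there is no pole along `u = 0`. -/
theorem exists_mulSeriesEq_of_two_directions (G : Finset (Fin n → ℤ)) {u w : Fin n → ℤ}
    (hu : u ∈ latticeDual G) (hpos : ∃ v ∈ G, 0 < u ⬝ᵥ v)
    (hw : ∀ v ∈ G, u ⬝ᵥ v = 0 → w ⬝ᵥ v = 0) {h g : Laurent n}
    (H : MulSeriesEq (latticeDual G) ((1 - character u) * h) g) :
    ∃ q, MulSeriesEq (latticeDual G) ((1 - character w) * h) q := by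
  have hu0 : u ≠ 0 := by rintro rfl; simp at hpos
  set φ : (Fin n → ℤ) → ℤ := (latticeDual G : Set (Fin n → ℤ)).indicator 1 with hφ
  set G₀ := G.filter fun v => u ⬝ᵥ v = 0
  set τ : (Fin n → ℤ) → ℤ := (latticeDual G₀ : Set (Fin n → ℤ)).indicator 1 with hτ
  have hG₀ : ∀ v ∈ G₀, u ⬝ᵥ v = 0 := fun v hv => (Finset.mem_filter.mp hv).2
  have hG₀' : ∀ v ∈ G₀, w ⬝ᵥ v = 0 := fun v hv =>
    hw v (Finset.mem_filter.mp hv).1 (Finset.mem_filter.mp hv).2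
  have hwτ := seriesAction_one_sub_character_indicator G₀ hG₀'
  have hfin : FiniteAlong u (seriesAction n (1 - character w) φ) := by
    intro m
    filter_upwards [eventually_add_nsmul_mem_latticeDual G hu m,
      eventually_add_nsmul_mem_latticeDual G hu (m - w),
      eventually_sub_nsmul_notMem_latticeDual G hpos m,
      eventually_sub_nsmul_notMem_latticeDual G hpos (m - w)] with k h1 h2 h3 h4
    have h5 := congrFun hwτ m
    rw [seriesAction_one_sub_character] at h5 ⊢
    rw [seriesAction_one_sub_character, show m + k • u - w = m - w + k • u by abel,
      show m - k • u - w = m - w - k • u by abel]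
    simp only [hφ, Set.indicator_apply, SetLike.mem_coe, h1, h2, h3, h4] at h5 ⊢
    exact ⟨h5, by simp⟩
  have := (hfin.seriesAction h).finite_support hu0 (by
    rw [← seriesAction_mul, ← seriesAction_mul,
      mul_comm _ (1 - character w), seriesAction_mul, (mulSeriesEq_iff _ _ _).mp H, ← coeff_mul_eq_seriesAction]
    exact Finsupp.hasFiniteSupport _)
  rw [← seriesAction_mul, mul_comm] at this
  obtain ⟨q, hq⟩ := exists_laurent_of_finite_support this
  exact ⟨q, (mulSeriesEq_iff _ _ _).mpr hq.symm⟩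

/-- Let `τ` be the series of the dual of the common face. Then `φ + φ' - τ` is finite along `u`, and
applying `(1 - x^u) h h'` to it gives `g h' + g' h`, because `(1 - x^u) τ = 0`. So `h h'` already
turns `φ + φ' - τ` into a Laurent polynomial `q`. -/
theorem exists_dvd_of_adjacent (G G' : Finset (Fin n → ℤ)) {u : Fin n → ℤ}
    (hu : u ∈ latticeDual G) (hu' : -u ∈ latticeDual G')
    (hpos : ∃ v ∈ G, 0 < u ⬝ᵥ v) (hneg : ∃ v ∈ G', 0 < -u ⬝ᵥ v)
    (hGG' : latticeDual (G.filter fun v => u ⬝ᵥ v = 0) =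
      latticeDual (G'.filter fun v => -u ⬝ᵥ v = 0)) {h g h' g' : Laurent n}
    (H : MulSeriesEq (latticeDual G) ((1 - character u) * h) g)
    (H' : MulSeriesEq (latticeDual G') ((1 - character u) * h') g') :
    ∃ q, g * h' + g' * h = (1 - character u) * q := by
  have hu0 : u ≠ 0 := by rintro rfl; simp at hpos
  set φ : (Fin n → ℤ) → ℤ := (latticeDual G : Set (Fin n → ℤ)).indicator 1 with hφ
  set φ' : (Fin n → ℤ) → ℤ := (latticeDual G' : Set (Fin n → ℤ)).indicator 1 with hφ'
  set G₀ := G.filter fun v => u ⬝ᵥ v = 0 with hG₀def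
  set τ : (Fin n → ℤ) → ℤ := (latticeDual G₀ : Set (Fin n → ℤ)).indicator 1 with hτ
  have hG₀ : ∀ v ∈ G₀, u ⬝ᵥ v = 0 := fun v hv => (Finset.mem_filter.mp hv).2
  have huτ := seriesAction_one_sub_character_indicator G₀ hG₀
  have hfin : FiniteAlong u (φ + φ' - τ) := by
    intro m
    filter_upwards [eventually_add_nsmul_mem_latticeDual G hu m,
      eventually_add_nsmul_mem_latticeDual G' hu' m,
      eventually_sub_nsmul_notMem_latticeDual G hpos m,
      eventually_sub_nsmul_notMem_latticeDual G' hneg m] with k h1 h2 h3 h4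
    have h5 := add_zsmul_mem_latticeDual_iff G₀ hG₀ m k
    have h6 := add_zsmul_mem_latticeDual_iff G₀ hG₀ m (-k)
    rw [natCast_zsmul] at h5
    rw [neg_smul, natCast_zsmul, ← sub_eq_add_neg] at h6
    rw [smul_neg, ← sub_eq_add_neg, ← hGG'] at h2
    rw [smul_neg, sub_neg_eq_add] at h4
    simp only [Pi.add_apply, Pi.sub_apply, hφ, hφ', hτ, Set.indicator_apply, SetLike.mem_coe, h1, h2,
      h3, h4, h5, h6]
    simp [hG₀def]
  have heq : seriesAction n (1 - character u) (seriesAction n (h * h') (φ + φ' - τ)) =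
      ((g * h' + g' * h : Laurent n).coeff : (Fin n → ℤ) → ℤ) := by
    have e1 : seriesAction n ((1 - character u) * (h * h')) φ = (h' * g).coeff := by
      rw [coeff_mul_eq_seriesAction, ← (mulSeriesEq_iff _ _ _).mp H, ← seriesAction_mul]
      congr 2
      ring
    have e2 : seriesAction n ((1 - character u) * (h * h')) φ' = (h * g').coeff := by
      rw [coeff_mul_eq_seriesAction, ← (mulSeriesEq_iff _ _ _).mp H', ← seriesAction_mul]
      congr 2
      ring
    have e3 : seriesAction n ((1 - character u) * (h * h')) τ = 0 := by
      rw [mul_comm, seriesAction_mul, huτ, map_zero]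
    rw [← seriesAction_mul, map_sub, map_add, e1, e2, e3, sub_zero, mul_comm h', mul_comm h]
    rfl
  have := (hfin.seriesAction (h * h')).finite_support hu0 (by
    rw [heq]; exact Finsupp.hasFiniteSupport _)
  obtain ⟨q, hq⟩ := exists_laurent_of_finite_support this
  refine ⟨q, ?_⟩
  rw [← hq, ← coeff_mul_eq_seriesAction] at heq
  exact (congrArg AddMonoidAlgebra.ofCoeff (DFunLike.coe_injective heq)).symm

/-! ### Homogeneous parts and leading forms of power series -/

/-- The sum of the terms of total degree `D` of a power series. -/
noncomputable def homogeneousPart (D : ℕ) (φ : MvPowerSeries (Fin n) ℤ) : MvPolynomial (Fin n) ℤ :=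
  ∑ d ∈ (Finset.univ : Finset (Fin n)).finsuppAntidiag D,
    MvPolynomial.monomial d (MvPowerSeries.coeff d φ)

theorem leadingForm_eq_homogeneousPart (φ : MvPowerSeries (Fin n) ℤ) :
    leadingForm φ = homogeneousPart φ.order.toNat φ := rfl

theorem coeff_homogeneousPart (D : ℕ) (φ : MvPowerSeries (Fin n) ℤ) (e : Fin n →₀ ℕ) :
    MvPolynomial.coeff e (homogeneousPart D φ) =
      if e.degree = D then MvPowerSeries.coeff e φ else 0 := by
  rw [homogeneousPart, MvPolynomial.coeff_sum]
  simp only [MvPolynomial.coeff_monomial]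
  rw [Finset.sum_ite_eq']
  simp [Finset.mem_finsuppAntidiag, Finsupp.degree_eq_sum]

theorem coe_homogeneousPart (D : ℕ) (φ : MvPowerSeries (Fin n) ℤ) :
    (homogeneousPart D φ : MvPowerSeries (Fin n) ℤ) = φ.homogeneousComponent D := by
  ext e
  rw [MvPolynomial.coeff_coe, coeff_homogeneousPart, MvPowerSeries.coeff_homogeneousComponent]

theorem homogeneousPart_isHomogeneous (D : ℕ) (φ : MvPowerSeries (Fin n) ℤ) :
    (homogeneousPart D φ).IsHomogeneous D := by
  intro e he
  rw [coeff_homogeneousPart] at he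
  change Finsupp.weight (fun _ => 1) e = D
  rw [← Finsupp.degree_eq_weight_one]
  by_contra h
  exact he (if_neg h)

theorem homogeneousPart_add (D : ℕ) (φ ψ : MvPowerSeries (Fin n) ℤ) :
    homogeneousPart D (φ + ψ) = homogeneousPart D φ + homogeneousPart D ψ := by
  apply MvPolynomial.coe_injective
  simp [coe_homogeneousPart]

theorem homogeneousPart_mul {D E : ℕ} {φ ψ : MvPowerSeries (Fin n) ℤ} (hφ : D ≤ φ.order)
    (hψ : E ≤ ψ.order) :
    homogeneousPart (D + E) (φ * ψ) = homogeneousPart D φ * homogeneousPart E ψ := by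
  apply MvPolynomial.coe_injective
  simp [coe_homogeneousPart, MvPowerSeries.homogeneousComponent_mul_of_le_order hφ hψ]

theorem homogeneousPart_eq_zero {D : ℕ} {φ : MvPowerSeries (Fin n) ℤ} (hφ : D < φ.order) :
    homogeneousPart D φ = 0 := by
  apply MvPolynomial.coe_injective
  simp [coe_homogeneousPart, MvPowerSeries.homogeneousComponent_of_lt_order_eq_zero hφ]

theorem coe_toNat_order {φ : MvPowerSeries (Fin n) ℤ} (hφ : φ ≠ 0) :
    (φ.order.toNat : ℕ∞) = φ.order := MvPowerSeries.ne_zero_iff_order_finite.mp hφ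

theorem leadingForm_ne_zero {φ : MvPowerSeries (Fin n) ℤ} (hφ : φ ≠ 0) : leadingForm φ ≠ 0 := by
  intro h
  apply MvPowerSeries.homogeneousComponent_of_order (coe_toNat_order hφ)
  rw [← coe_homogeneousPart, ← leadingForm_eq_homogeneousPart, h, MvPolynomial.coe_zero]

theorem leadingForm_zero : leadingForm (0 : MvPowerSeries (Fin n) ℤ) = 0 := by
  simp [leadingForm]

theorem leadingForm_isHomogeneous (φ : MvPowerSeries (Fin n) ℤ) :
    (leadingForm φ).IsHomogeneous φ.order.toNat :=
  homogeneousPart_isHomogeneous _ _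

theorem toNat_order_mul {φ ψ : MvPowerSeries (Fin n) ℤ} (hφ : φ ≠ 0) (hψ : ψ ≠ 0) :
    (φ * ψ).order.toNat = φ.order.toNat + ψ.order.toNat := by
  rw [MvPowerSeries.order_mul, ENat.toNat_add]
  · rwa [Ne, MvPowerSeries.order_eq_top_iff]
  · rwa [Ne, MvPowerSeries.order_eq_top_iff]

theorem leadingForm_mul (φ ψ : MvPowerSeries (Fin n) ℤ) :
    leadingForm (φ * ψ) = leadingForm φ * leadingForm ψ := by
  by_cases hφ : φ = 0
  · simp [hφ, leadingForm_zero]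
  by_cases hψ : ψ = 0
  · simp [hψ, leadingForm_zero]
  rw [leadingForm_eq_homogeneousPart, toNat_order_mul hφ hψ,
    homogeneousPart_mul (coe_toNat_order hφ).le (coe_toNat_order hψ).le]
  rfl

/-- If the product `φ ψ` has order at least `D`, then its part of degree `D` is divisible by the
leading form of `φ`. -/
theorem leadingForm_dvd_homogeneousPart_mul {D : ℕ} {φ ψ : MvPowerSeries (Fin n) ℤ}
    (h : D ≤ (φ * ψ).order) :
    leadingForm φ ∣ homogeneousPart D (φ * ψ) := by
  by_cases h0 : φ * ψ = 0
  · rw [h0, homogeneousPart]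
    simp
  rcases eq_or_lt_of_le h with h | h
  · have : D = (φ * ψ).order.toNat := by rw [← h]; rfl
    rw [this, ← leadingForm_eq_homogeneousPart, leadingForm_mul]
    exact dvd_mul_right _ _
  · rw [homogeneousPart_eq_zero h]
    exact dvd_zero _

/-! ### Linear forms and their primality -/

/-- The linear function on `N` given by `u ∈ M`, as an element of `Sym^*(M)`. -/
noncomputable def linearForm (u : Fin n → ℤ) : MvPolynomial (Fin n) ℤ :=
  ∑ i, MvPolynomial.C (u i) * MvPolynomial.X i

theorem coeff_linearForm_single (u : Fin n → ℤ) (i : Fin n) :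
    MvPolynomial.coeff (Finsupp.single i 1) (linearForm u) = u i := by
  rw [linearForm, MvPolynomial.coeff_sum]
  simp only [MvPolynomial.coeff_C_mul, MvPolynomial.coeff_X, Finsupp.single_left_inj one_ne_zero]
  simp

theorem linearForm_injective : Function.Injective (linearForm (n := n)) := fun u v h => by
  ext i
  rw [← coeff_linearForm_single u, h, coeff_linearForm_single]

theorem linearForm_zero : linearForm (0 : Fin n → ℤ) = 0 := by simp [linearForm]

theorem linearForm_ne_zero {u : Fin n → ℤ} (hu : u ≠ 0) : linearForm u ≠ 0 := fun h =>
  hu (linearForm_injective (h.trans linearForm_zero.symm))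

theorem linearForm_neg (u : Fin n → ℤ) : linearForm (-u) = -linearForm u := by
  simp [linearForm]

theorem linearForm_isHomogeneous (u : Fin n → ℤ) : (linearForm u).IsHomogeneous 1 :=
  MvPolynomial.IsHomogeneous.sum _ _ _ fun i _ => by
    simpa using (MvPolynomial.isHomogeneous_C (Fin n) (u i)).mul (MvPolynomial.isHomogeneous_X ℤ i)

theorem aeval_linearForm {A : Type*} [CommRing A] (u : Fin n → ℤ) (x : Fin n → A) :
    MvPolynomial.aeval x (linearForm u) = ∑ i, (u i : A) * x i := by
  simp [linearForm]

/-- A polynomial of total degree one whose coefficients have only units as common divisors is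
irreducible, and `Sym^*(M)` is factorial. -/
theorem linearForm_prime {u : Fin n → ℤ} (hu : IsPrimitiveVector u) : Prime (linearForm u) := by
  rw [← irreducible_iff_prime]
  apply MvPolynomial.irreducible_of_totalDegree_eq_one
  · exact (linearForm_isHomogeneous u).totalDegree (linearForm_ne_zero hu.ne_zero)
  · intro x hx
    refine hu x fun i => ?_
    rw [← coeff_linearForm_single u]
    exact hx _

theorem eq_smul_of_linearForm_dvd {u w : Fin n → ℤ} (hu : u ≠ 0)
    (h : linearForm u ∣ linearForm w) : ∃ c : ℤ, w = c • u := by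
  obtain ⟨q, hq⟩ := h
  by_cases hw : w = 0
  · exact ⟨0, by simp [hw]⟩
  have hq0 : q ≠ 0 := by
    rintro rfl
    exact linearForm_ne_zero hw (by simpa using hq)
  have hdeg := congrArg MvPolynomial.totalDegree hq
  rw [MvPolynomial.totalDegree_mul_of_isDomain (linearForm_ne_zero hu) hq0,
    (linearForm_isHomogeneous u).totalDegree (linearForm_ne_zero hu),
    (linearForm_isHomogeneous w).totalDegree (linearForm_ne_zero hw)] at hdeg
  have hq1 := (MvPolynomial.totalDegree_eq_zero_iff_eq_C (p := q)).mp (by omega)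
  refine ⟨MvPolynomial.coeff 0 q, ?_⟩
  ext i
  rw [← coeff_linearForm_single w, hq, hq1, mul_comm, MvPolynomial.coeff_C_mul,
    coeff_linearForm_single, MvPolynomial.coeff_zero_C]
  rfl

/-! ### Expansion of characters at the identity -/

theorem expand_character (u : Fin n → ℤ) :
    expand n (character u) =
      ((∏ i, onePlusX i ^ u i : (MvPowerSeries (Fin n) ℤ)ˣ) : MvPowerSeries (Fin n) ℤ) := by
  rw [expand, character, AddMonoidAlgebra.lift_single]
  exact one_smul ℤ _

theorem expand_character_single (i : Fin n) :
    expand n (character (Pi.single i 1)) = 1 + MvPowerSeries.X i := by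
  rw [expand_character, Finset.prod_eq_single i]
  · simp [onePlusX]
  · intro j _ hj
    simp [hj]
  · simp

theorem coeff_single_mul (i : Fin n) (φ ψ : MvPowerSeries (Fin n) ℤ) :
    MvPowerSeries.coeff (Finsupp.single i 1) (φ * ψ) =
      MvPowerSeries.constantCoeff φ * MvPowerSeries.coeff (Finsupp.single i 1) ψ +
        MvPowerSeries.coeff (Finsupp.single i 1) φ * MvPowerSeries.constantCoeff ψ := by
  rw [MvPowerSeries.coeff_mul, Finsupp.antidiagonal_single, Finset.sum_map]
  simp [Finset.Nat.antidiagonal_succ]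

/-- To first order, `x^u = 1 + ∑ u_i y_i`. The exponents with this property form a subgroup of `M`
that contains the standard basis. -/
theorem constantCoeff_expand_character_and_coeff_single (u : Fin n → ℤ) :
    MvPowerSeries.constantCoeff (expand n (character u)) = 1 ∧
      ∀ i, MvPowerSeries.coeff (Finsupp.single i 1) (expand n (character u)) = u i := by
  let H : AddSubgroup (Fin n → ℤ) :=
    { carrier := {u | MvPowerSeries.constantCoeff (expand n (character u)) = 1 ∧
        ∀ i, MvPowerSeries.coeff (Finsupp.single i 1) (expand n (character u)) = u i}
      zero_mem' := by simp [character_zero, MvPowerSeries.coeff_one]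
      add_mem' := fun {a b} ha hb => by
        refine ⟨by rw [character_add, map_mul, map_mul, ha.1, hb.1, mul_one], fun i => ?_⟩
        rw [character_add, map_mul, coeff_single_mul, ha.1, hb.1, ha.2, hb.2, Pi.add_apply]
        ring
      neg_mem' := fun {a} ha => by
        have h1 : expand n (character a) * expand n (character (-a)) = 1 := by
          rw [← map_mul, ← character_add, add_neg_cancel, character_zero, map_one]
        have h2 : MvPowerSeries.constantCoeff (expand n (character (-a))) = 1 := by
          have := congrArg MvPowerSeries.constantCoeff h1
          rwa [map_mul, ha.1, one_mul, map_one] at this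
        refine ⟨h2, fun i => ?_⟩
        have := congrArg (MvPowerSeries.coeff (Finsupp.single i 1)) h1
        rw [coeff_single_mul, ha.1, ha.2, h2] at this
        simp [MvPowerSeries.coeff_one] at this
        simp
        linarith }
  have hH : ∀ i, Pi.single i 1 ∈ H := fun i => by
    change _ ∧ _
    rw [expand_character_single]
    refine ⟨by simp, fun j => ?_⟩
    simp [MvPowerSeries.coeff_one, MvPowerSeries.coeff_X, Pi.single_apply, Finsupp.single_left_inj]
  have : u ∈ H := by
    rw [show u = ∑ i, u i • Pi.single i (1 : ℤ) by
      ext j; simp [Finset.sum_apply, Pi.single_apply]]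
    exact AddSubgroup.sum_mem _ fun i _ => AddSubgroup.zsmul_mem _ (hH i) _
  exact this

theorem one_le_order_expand_one_sub_character (u : Fin n → ℤ) :
    1 ≤ (expand n (1 - character u)).order := by
  rw [MvPowerSeries.one_le_order_iff_constCoeff_eq_zero, map_sub, map_sub, map_one, map_one,
    (constantCoeff_expand_character_and_coeff_single u).1, sub_self]

theorem homogeneousPart_expand_one_sub_character (u : Fin n → ℤ) :
    homogeneousPart 1 (expand n (1 - character u)) = -linearForm u := by
  ext e
  rw [coeff_homogeneousPart, ← linearForm_neg]
  by_cases he : e.degree = 1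
  · rw [if_pos he]
    obtain ⟨i, rfl⟩ : ∃ i, e = Finsupp.single i 1 := by
      obtain ⟨i, hi⟩ := Finsupp.ne_iff.mp (show e ≠ 0 by rintro rfl; simp at he)
      have hle : Finsupp.single i 1 ≤ e := by
        rw [Finsupp.single_le_iff]
        exact Nat.one_le_iff_ne_zero.mpr hi
      obtain ⟨d, rfl⟩ := exists_add_of_le hle
      rw [map_add, Finsupp.degree_single] at he
      have : d = 0 := (Finsupp.degree_eq_zero_iff d).mp (by omega)
      exact ⟨i, by simp [this]⟩
    rw [coeff_linearForm_single, map_sub, map_sub, map_one,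
      (constantCoeff_expand_character_and_coeff_single u).2]
    simp [MvPowerSeries.coeff_one]
  · rw [if_neg he]
    by_contra h
    have := linearForm_isHomogeneous (-u) (Ne.symm h)
    change Finsupp.weight (fun _ => 1) e = 1 at this
    rw [← Finsupp.degree_eq_weight_one] at this
    exact he this

theorem toNat_order_expand_one_sub_character {u : Fin n → ℤ} (hu : u ≠ 0) :
    (expand n (1 - character u)).order.toNat = 1 := by
  have h1 := one_le_order_expand_one_sub_character u
  rcases eq_or_lt_of_le h1 with h | h
  · rw [← h]; rfl
  · have := homogeneousPart_expand_one_sub_character u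
    rw [homogeneousPart_eq_zero (by exact_mod_cast h)] at this
    exact absurd (neg_eq_zero.mp this.symm) (linearForm_ne_zero hu)

theorem leadingForm_expand_one_sub_character {u : Fin n → ℤ} (hu : u ≠ 0) :
    leadingForm (expand n (1 - character u)) = -linearForm u := by
  rw [leadingForm_eq_homogeneousPart, toNat_order_expand_one_sub_character hu,
    homogeneousPart_expand_one_sub_character]

/-! ### Polynomials in the local parameters and principal parts -/

/-- The embedding of polynomials in the local parameters `y_i = x^{e_i^*} - 1` into Laurent
polynomials. -/
noncomputable def ofLocalParameters (n : ℕ) : MvPolynomial (Fin n) ℤ →ₐ[ℤ] Laurent n :=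
  MvPolynomial.aeval fun i => character (Pi.single i 1) - 1

theorem expand_ofLocalParameters (p : MvPolynomial (Fin n) ℤ) :
    expand n (ofLocalParameters n p) = p := by
  have : (expand n).comp (ofLocalParameters n) =
      MvPolynomial.coeToMvPowerSeries.algHom ℤ := by
    apply MvPolynomial.algHom_ext
    intro i
    simp [ofLocalParameters, expand_character_single]
  simpa using DFunLike.congr_fun this p

theorem character_mem_range {u : Fin n → ℤ} (hu : 0 ≤ u) :
    character u ∈ (ofLocalParameters n).range := by
  refine ⟨∏ i, (1 + MvPolynomial.X i) ^ (u i).toNat, ?_⟩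
  have hsum : u = ∑ i, (u i).toNat • Pi.single i (1 : ℤ) := by
    ext j
    simpa [Finset.sum_apply, Pi.single_apply] using hu j
  have hpow : ∀ (k : ℕ) (v : Fin n → ℤ), character (k • v) = character v ^ k := fun k v => by
    induction k with
    | zero => simp [character_zero]
    | succ k ih => rw [succ_nsmul, character_add, ih, pow_succ]
  have hprod : ∀ (s : Finset (Fin n)) (f : Fin n → Fin n → ℤ),
      character (∑ i ∈ s, f i) = ∏ i ∈ s, character (f i) := fun s f => by
    induction s using Finset.induction_on with
    | empty => simp [character_zero]
    | insert a s ha ih => rw [Finset.sum_insert ha, Finset.prod_insert ha, character_add, ih]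
  conv_rhs => rw [hsum, hprod]
  simp only [hpow]
  simp [ofLocalParameters]

/-- A monomial clears the negative exponents, and `x^u` with `u ≥ 0` is a product of powers of `1 +
y_i`. Statements on Laurent polynomials near the identity thereby reduce to polynomials in `y_i`. -/
theorem exists_character_mul_eq (g : Laurent n) :
    ∃ (c : Fin n → ℤ) (p : MvPolynomial (Fin n) ℤ),
      character c * g = ofLocalParameters n p := by
  suffices h : ∃ N : ℕ, ∀ k ≥ N,
      character (fun _ => (k : ℤ)) * g ∈ (ofLocalParameters n).range by
    obtain ⟨N, hN⟩ := h
    obtain ⟨p, hp⟩ := hN N le_rfl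
    exact ⟨_, p, hp.symm⟩
  have hg : g = ∑ u ∈ g.coeff.support, g.coeff u • character u := by
    have := AddMonoidAlgebra.sum_coeff_single g
    rw [Finsupp.sum] at this
    conv_lhs => rw [← this]
    simp [character]
  rw [hg]
  obtain ⟨N, hN⟩ := Finset.exists_le ((g.coeff.support ×ˢ Finset.univ).image
    fun p : (Fin n → ℤ) × Fin n => (-p.1 p.2).toNat)
  refine ⟨N, fun k hk => ?_⟩
  rw [Finset.mul_sum]
  refine Subalgebra.sum_mem _ fun u hu => ?_
  rw [mul_smul_comm, ← character_add]
  refine Subalgebra.smul_mem _ (character_mem_range fun i => ?_) _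
  have := hN _ (Finset.mem_image.mpr ⟨(u, i), Finset.mem_product.mpr ⟨hu, Finset.mem_univ i⟩, rfl⟩)
  simp only [Pi.zero_apply, Pi.add_apply]
  dsimp only at this
  omega

theorem isUnit_character (c : Fin n → ℤ) : IsUnit (character c) :=
  IsUnit.of_mul_eq_one (character (-c)) (by rw [← character_add, add_neg_cancel, character_zero])

theorem expand_injective : Function.Injective (expand n) := by
  rw [injective_iff_map_eq_zero]
  intro g hg
  obtain ⟨c, p, h⟩ := exists_character_mul_eq g
  have h1 := congrArg (expand n) h
  rw [map_mul, hg, mul_zero, expand_ofLocalParameters] at h1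
  have h2 : p = 0 := MvPolynomial.coe_injective _ _ (by rw [← h1, MvPolynomial.coe_zero])
  rw [h2, map_zero] at h
  exact (isUnit_character c).mul_right_eq_zero.mp h

theorem expand_ne_zero {g : Laurent n} (hg : g ≠ 0) : expand n g ≠ 0 := fun h =>
  hg (expand_injective (h.trans (map_zero _).symm))

/-- Leading forms are multiplicative, and those of nonzero Laurent polynomials do not vanish since
`expand` is injective. So cross-multiplied fractions have the same quotient of leading forms. -/
theorem principalPart_mk' (g : Laurent n) (h : nonZeroDivisors (Laurent n)) :
    principalPart (IsLocalization.mk' (FractionRing (Laurent n)) g h) =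
      algebraMap (MvPolynomial (Fin n) ℤ) (RatFun n) (leadingForm (expand n g)) /
        algebraMap (MvPolynomial (Fin n) ℤ) (RatFun n) (leadingForm (expand n h)) := by
  set F := IsLocalization.mk' (FractionRing (Laurent n)) g h
  set s := IsLocalization.sec (nonZeroDivisors (Laurent n)) F with hs
  have hmk : IsLocalization.mk' (FractionRing (Laurent n)) s.1 s.2 = F :=
    IsLocalization.mk'_sec _ _
  have heq : (h : Laurent n) * s.1 = s.2 * g := by
    have := IsLocalization.mk'_eq_iff_eq (S := FractionRing (Laurent n)) |>.mp hmk
    exact IsFractionRing.injective (Laurent n) (FractionRing (Laurent n)) this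
  have hne : ∀ t : nonZeroDivisors (Laurent n),
      algebraMap (MvPolynomial (Fin n) ℤ) (RatFun n) (leadingForm (expand n t)) ≠ 0 := fun t => by
    rw [Ne, FaithfulSMul.algebraMap_eq_zero_iff]
    exact leadingForm_ne_zero (expand_ne_zero (nonZeroDivisors.ne_zero t.2))
  rw [principalPart, div_eq_div_iff (hne _) (hne _), ← map_mul, ← map_mul, ← leadingForm_mul,
    ← leadingForm_mul, ← map_mul, ← map_mul, mul_comm, heq, mul_comm]

theorem principalPart_hilb {σ : PointedCone ℝ (Fin n → ℝ)} {g h : Laurent n} (hh : h ≠ 0)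
    (H : MulSeriesEq (dualLatticePoints σ) h g) :
    principalPart (hilb σ) =
      algebraMap (MvPolynomial (Fin n) ℤ) (RatFun n) (leadingForm (expand n g)) /
        algebraMap (MvPolynomial (Fin n) ℤ) (RatFun n) (leadingForm (expand n h)) := by
  have hex : ∃ F, IsGeneratingFunction (dualLatticePoints σ) F :=
    ⟨_, g, ⟨h, mem_nonZeroDivisors_of_ne_zero hh⟩, H, rfl⟩
  obtain ⟨g', h', H', hF⟩ := hex.choose_spec
  have : hilb σ = IsLocalization.mk' (FractionRing (Laurent n)) g
      ⟨h, mem_nonZeroDivisors_of_ne_zero hh⟩ := by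
    rw [hilb, dif_pos hex, hF, IsLocalization.mk'_eq_iff_eq]
    congr 1
    exact H'.mul_comm H
  rw [this, principalPart_mk']

/-! ### The pairing, and values of Laurent polynomials on one-parameter subgroups -/

theorem pairing_add_left (a b : Fin n → ℤ) (v : Fin n → ℝ) :
    pairing (a + b) v = pairing a v + pairing b v := by
  simp [pairing, add_mul, Finset.sum_add_distrib]

theorem pairing_sub_left (a b : Fin n → ℤ) (v : Fin n → ℝ) :
    pairing (a - b) v = pairing a v - pairing b v := by
  simp [pairing, sub_mul, Finset.sum_sub_distrib]

theorem pairing_zero_left (v : Fin n → ℝ) : pairing (0 : Fin n → ℤ) v = 0 := by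
  simp [pairing]

theorem pairing_smul_left (c : ℤ) (a : Fin n → ℤ) (v : Fin n → ℝ) :
    pairing (c • a) v = c * pairing a v := by
  simp [pairing, Finset.mul_sum, mul_assoc]

theorem pairing_neg_left (a : Fin n → ℤ) (v : Fin n → ℝ) :
    pairing (-a) v = -pairing a v := by
  simp [pairing]

theorem pairing_add_right (a : Fin n → ℤ) (v w : Fin n → ℝ) :
    pairing a (v + w) = pairing a v + pairing a w := by
  simp [pairing, mul_add, Finset.sum_add_distrib]

theorem pairing_smul_right (a : Fin n → ℤ) (c : ℝ) (v : Fin n → ℝ) :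
    pairing a (c • v) = c * pairing a v := by
  simp [pairing, Finset.mul_sum, mul_left_comm]

theorem pairing_sum_right {ι : Type*} (a : Fin n → ℤ) (s : Finset ι) (f : ι → Fin n → ℝ) :
    pairing a (∑ j ∈ s, f j) = ∑ j ∈ s, pairing a (f j) := by
  simp only [pairing, Finset.sum_apply, Finset.mul_sum]
  exact Finset.sum_comm

theorem pairing_intCast (a v : Fin n → ℤ) : pairing a (fun i => (v i : ℝ)) = (a ⬝ᵥ v : ℤ) := by
  simp [pairing, dotProduct]

/-- The value of a Laurent polynomial at the point `exp(t v)` of the torus. -/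
noncomputable def evalExp (v : Fin n → ℝ) (t : ℝ) : Laurent n →ₐ[ℤ] ℝ :=
  AddMonoidAlgebra.lift ℤ ℝ (Fin n → ℤ)
    { toFun := fun u => Real.exp (t * pairing (Multiplicative.toAdd u) v)
      map_one' := by simp [pairing_zero_left]
      map_mul' := fun a b => by
        rw [toAdd_mul, pairing_add_left, mul_add, Real.exp_add] }

theorem evalExp_apply (v : Fin n → ℝ) (t : ℝ) (g : Laurent n) :
    evalExp v t g = ∑ u ∈ g.coeff.support, (g.coeff u : ℝ) * Real.exp (t * pairing u v) := by
  rw [evalExp, AddMonoidAlgebra.lift_apply, Finsupp.sum]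
  simp

theorem evalExp_character (v : Fin n → ℝ) (t : ℝ) (u : Fin n → ℤ) :
    evalExp v t (character u) = Real.exp (t * pairing u v) := by
  rw [evalExp, character, AddMonoidAlgebra.lift_single]
  exact one_smul ℤ _

theorem evalExp_ofLocalParameters (v : Fin n → ℝ) (t : ℝ) (p : MvPolynomial (Fin n) ℤ) :
    evalExp v t (ofLocalParameters n p) =
      MvPolynomial.aeval (fun i => Real.exp (t * v i) - 1) p := by
  have : (evalExp v t).comp (ofLocalParameters n) =
      MvPolynomial.aeval (fun i => Real.exp (t * v i) - 1) := by
    apply MvPolynomial.algHom_ext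
    intro i
    simp [ofLocalParameters, evalExp_character, pairing, Pi.single_apply]
  exact DFunLike.congr_fun this p

open Filter Topology in
-- Since `y t` is `t v` to first order, a monomial of degree `d` contributes `t ^ d` times its value
-- at `v`. Terms of degree less than `D` are absent, and those of larger degree tend to `0` after
-- division by `t ^ D`.
theorem tendsto_aeval_div_pow {D : ℕ} (p : MvPolynomial (Fin n) ℤ)
    (hD : (D : ℕ∞) ≤ (p : MvPowerSeries (Fin n) ℤ).order) (v : Fin n → ℝ) (y : ℝ → Fin n → ℝ)
    (hy : ∀ i, Tendsto (fun t => y t i / t) (𝓝[≠] 0) (𝓝 (v i))) :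
    Tendsto (fun t => MvPolynomial.aeval (y t) p / t ^ D) (𝓝[≠] 0)
      (𝓝 (MvPolynomial.aeval v (homogeneousPart D (p : MvPowerSeries (Fin n) ℤ)))) := by
  have hterm : ∀ d ∈ p.support, Tendsto
      (fun t => (((MvPolynomial.coeff d p : ℤ) : ℝ) * ∏ i, y t i ^ d i) / t ^ D) (𝓝[≠] 0)
      (𝓝 (if d.degree = D then ((MvPolynomial.coeff d p : ℤ) : ℝ) * ∏ i, v i ^ d i else 0)) := by
    intro d hd
    have hdeg : D ≤ d.degree := by
      by_contra h
      apply MvPolynomial.mem_support_iff.mp hd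
      rw [← MvPolynomial.coeff_coe]
      exact MvPowerSeries.coeff_of_lt_order (lt_of_lt_of_le (by exact_mod_cast not_le.mp h) hD)
    have hprod : Tendsto (fun t => ∏ i, (y t i / t) ^ d i) (𝓝[≠] 0) (𝓝 (∏ i, v i ^ d i)) :=
      tendsto_finsetProd _ fun i _ => (hy i).pow _
    have hpow : Tendsto (fun t : ℝ => t ^ (d.degree - D)) (𝓝[≠] 0)
        (𝓝 ((0 : ℝ) ^ (d.degree - D))) :=
      (tendsto_id.mono_left nhdsWithin_le_nhds).pow _
    have := (hpow.mul hprod).const_mul ((MvPolynomial.coeff d p : ℤ) : ℝ)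
    refine (this.congr' ?_).trans ?_
    · filter_upwards [self_mem_nhdsWithin] with t ht
      have ht : t ≠ 0 := ht
      have h1 : ∏ i, (y t i / t) ^ d i = (∏ i, y t i ^ d i) / t ^ d.degree := by
        simp_rw [div_pow]
        rw [Finset.prod_div_distrib, Finset.prod_pow_eq_pow_sum, Finsupp.degree_eq_sum]
      have h2 : t ^ d.degree = t ^ (d.degree - D) * t ^ D := by
        rw [← pow_add, Nat.sub_add_cancel hdeg]
      rw [h1, h2]
      field_simp
    · split_ifs with h
      · simp [h]
      · rw [zero_pow (by omega)]
        simp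
  have hsum := tendsto_finsetSum p.support hterm
  convert! hsum using 2
  · rename_i t
    rw [MvPolynomial.aeval_def, MvPolynomial.eval₂_eq', Finset.sum_div]
    simp
  · rw [MvPolynomial.aeval_def, MvPolynomial.eval₂_eq']
    rw [← Finset.sum_filter]
    refine Finset.sum_congr ?_ ?_
    · ext d
      simp [MvPolynomial.mem_support_iff, coeff_homogeneousPart, and_comm]
    · intro d hd
      rw [coeff_homogeneousPart, if_pos (Finset.mem_filter.mp hd).2, MvPolynomial.coeff_coe]
      simp

open Filter Topology in
-- This links algebra and analysis: the leading form gives the first coefficient of `g` along `t ↦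
-- exp(t v)`. If it vanishes at `v`, the limit is `0` and does not determine the order; hence the
-- nonvanishing hypotheses of `order_add_eq_order`.
theorem tendsto_evalExp_div_pow (g : Laurent n) (v : Fin n → ℝ) :
    Tendsto (fun t => evalExp v t g / t ^ (expand n g).order.toNat) (𝓝[≠] 0)
      (𝓝 (MvPolynomial.aeval v (leadingForm (expand n g)))) := by
  by_cases hg : g = 0
  · simp [hg, leadingForm_zero]
  obtain ⟨c, p, hp⟩ := exists_character_mul_eq g
  have hy : ∀ i, Tendsto (fun t => (Real.exp (t * v i) - 1) / t) (𝓝[≠] 0) (𝓝 (v i)) := by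
    intro i
    have h : HasDerivAt (fun t => Real.exp (t * v i)) (v i) 0 := by
      have := ((hasDerivAt_id (0 : ℝ)).mul_const (v i)).exp
      simpa using this
    have := h.tendsto_slope_zero
    simpa [div_eq_inv_mul] using this
  have hchar : (expand n (character c)).order = 0 := by
    by_contra h
    have := MvPowerSeries.order_ne_zero_iff_constCoeff_eq_zero.mp h
    rw [(constantCoeff_expand_character_and_coeff_single c).1] at this
    exact one_ne_zero this
  have hchar' : leadingForm (expand n (character c)) = 1 := by
    ext e
    rw [leadingForm_eq_homogeneousPart, hchar, coeff_homogeneousPart, MvPolynomial.coeff_one]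
    by_cases he : e = 0
    · subst he
      simpa using (constantCoeff_expand_character_and_coeff_single c).1
    · rw [if_neg (fun h => he ((Finsupp.degree_eq_zero_iff e).mp (by simpa using h))),
        if_neg (Ne.symm he)]
  have hexp : (p : MvPowerSeries (Fin n) ℤ) = expand n (character c) * expand n g := by
    rw [← map_mul, hp, expand_ofLocalParameters]
  have horder : (p : MvPowerSeries (Fin n) ℤ).order = (expand n g).order := by
    rw [hexp, MvPowerSeries.order_mul, hchar, zero_add]
  have hlead : homogeneousPart (expand n g).order.toNat (p : MvPowerSeries (Fin n) ℤ) =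
      leadingForm (expand n g) := by
    rw [← horder, ← leadingForm_eq_homogeneousPart, hexp, leadingForm_mul, hchar', one_mul]
  have h1 := tendsto_aeval_div_pow (D := (expand n g).order.toNat) p
    (by rw [horder]; exact (coe_toNat_order (expand_ne_zero hg)).le) v _ hy
  rw [hlead] at h1
  have h2 : Tendsto (fun t => Real.exp (-(t * pairing c v))) (𝓝[≠] 0) (𝓝 1) := by
    have : Continuous fun t => Real.exp (-(t * pairing c v)) := by fun_prop
    have := this.tendsto 0
    simp only [zero_mul, neg_zero, Real.exp_zero] at this
    exact this.mono_left nhdsWithin_le_nhds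
  have h3 := h2.mul h1
  rw [one_mul] at h3
  refine h3.congr fun t => ?_
  have : evalExp v t g = Real.exp (-(t * pairing c v)) *
      MvPolynomial.aeval (fun i => Real.exp (t * v i) - 1) p := by
    rw [← evalExp_ofLocalParameters, ← hp, map_mul, evalExp_character, ← mul_assoc, ← Real.exp_add]
    simp
  rw [this, mul_div_assoc]

/-! ### Growth of the series near the identity -/

theorem sum_pow_natAbs_le {r : ℝ} (h0 : 0 ≤ r) (h1 : r < 1) (J : Finset ℤ) :
    ∑ j ∈ J, r ^ j.natAbs ≤ 2 / (1 - r) := by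
  have key : ∀ K : Finset ℤ, Set.InjOn Int.natAbs K → ∑ j ∈ K, r ^ j.natAbs ≤ (1 - r)⁻¹ := by
    intro K hK
    rw [← Finset.sum_image (f := fun k => r ^ k) (g := Int.natAbs) hK,
      ← tsum_geometric_of_lt_one h0 h1]
    exact (summable_geometric_of_lt_one h0 h1).sum_le_tsum _ fun i _ => pow_nonneg h0 i
  rw [← Finset.sum_filter_add_sum_filter_not J (fun j => 0 ≤ j),
    show 2 / (1 - r) = (1 - r)⁻¹ + (1 - r)⁻¹ by ring]
  refine add_le_add (key _ ?_) (key _ ?_)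
  · intro a ha b hb hab
    simp at ha hb
    omega
  · intro a ha b hb hab
    simp at ha hb
    omega

theorem sum_prod_pow_natAbs_le {r : ℝ} (h0 : 0 ≤ r) (h1 : r < 1) (T : Finset (Fin n → ℤ)) :
    ∑ m ∈ T, ∏ i, r ^ (m i).natAbs ≤ (2 / (1 - r)) ^ n := by
  let J : Fin n → Finset ℤ := fun i => T.image fun m => m i
  have hT : T ⊆ Fintype.piFinset J := fun m hm =>
    Fintype.mem_piFinset.mpr fun i => Finset.mem_image.mpr ⟨m, hm, rfl⟩
  calc ∑ m ∈ T, ∏ i, r ^ (m i).natAbs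
      ≤ ∑ m ∈ Fintype.piFinset J, ∏ i, r ^ (m i).natAbs :=
        Finset.sum_le_sum_of_subset_of_nonneg hT fun m _ _ =>
          Finset.prod_nonneg fun i _ => pow_nonneg h0 _
    _ = ∏ i, ∑ j ∈ J i, r ^ j.natAbs := (Finset.prod_univ_sum J fun _ j => r ^ j.natAbs).symm
    _ ≤ ∏ _i : Fin n, 2 / (1 - r) :=
        Finset.prod_le_prod (fun i _ => Finset.sum_nonneg fun j _ => pow_nonneg h0 _)
          fun i _ => sum_pow_natAbs_le h0 h1 (J i)
    _ = (2 / (1 - r)) ^ n := by simp [div_pow]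

/-- The real number `v` is positive on `S`, with linear growth. -/
def IsCoercive (S : Set (Fin n → ℤ)) (v : Fin n → ℝ) : Prop :=
  ∃ c > 0, ∀ m ∈ S, c * ∑ i, |(m i : ℝ)| ≤ pairing m v

/-- The terms of the series `∑_{m ∈ S} x^m` at the point `exp(t v)` of the torus. -/
noncomputable def expTerm (S : Set (Fin n → ℤ)) (v : Fin n → ℝ) (t : ℝ) (m : Fin n → ℤ) : ℝ :=
  S.indicator (fun m => Real.exp (t * pairing m v)) m

theorem expTerm_nonneg (S : Set (Fin n → ℤ)) (v : Fin n → ℝ) (t : ℝ) (m : Fin n → ℤ) :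
    0 ≤ expTerm S v t m :=
  Set.indicator_nonneg (fun _ _ => (Real.exp_pos _).le) _

/-- Coercivity bounds the sum by a product of `n` two-sided geometric series of ratio `r = exp(-s
c)`, each at most `2 / (1 - r)`, which is `O(1 / s)`. -/
theorem IsCoercive.exists_sum_le {S : Set (Fin n → ℤ)} {v : Fin n → ℝ} (hv : IsCoercive S v) :
    ∃ C : ℝ, ∀ s : ℝ, 0 < s → s ≤ 1 → ∀ T : Finset (Fin n → ℤ),
      ∑ m ∈ T, expTerm S v (-s) m ≤ C / s ^ n := by
  obtain ⟨c, hc, hcS⟩ := hv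
  refine ⟨(2 * (1 + c) / c) ^ n, fun s hs hs1 T => ?_⟩
  set r := Real.exp (-(s * c)) with hr
  have hr0 : 0 ≤ r := (Real.exp_pos _).le
  have hr1 : r < 1 := by rw [hr, Real.exp_lt_one_iff]; nlinarith
  have hterm : ∀ m, expTerm S v (-s) m ≤ ∏ i, r ^ (m i).natAbs := by
    intro m
    rw [expTerm]
    by_cases hm : m ∈ S
    · rw [Set.indicator_of_mem hm, Finset.prod_pow_eq_pow_sum, hr, ← Real.exp_nat_mul,
        Real.exp_le_exp]
      have := hcS m hm
      push_cast [Nat.cast_natAbs]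
      nlinarith
    · rw [Set.indicator_of_notMem hm]
      exact Finset.prod_nonneg fun i _ => pow_nonneg hr0 _
  refine (Finset.sum_le_sum fun m _ => hterm m).trans
    ((sum_prod_pow_natAbs_le hr0 hr1 T).trans ?_)
  rw [← div_pow]
  have hsc : 0 < s * c := mul_pos hs hc
  have h2 : r ≤ 1 / (1 + s * c) := by
    rw [hr, Real.exp_neg, ← one_div]
    apply one_div_le_one_div_of_le (by positivity)
    have := Real.add_one_le_exp (s * c)
    linarith
  have h3 : s * c / (1 + c) ≤ 1 - r := by
    have : 1 - 1 / (1 + s * c) = s * c / (1 + s * c) := by field_simp; ring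
    have h4 : s * c / (1 + c) ≤ s * c / (1 + s * c) := by
      apply div_le_div_of_nonneg_left hsc.le (by positivity)
      nlinarith
    linarith
  refine pow_le_pow_left₀ (div_nonneg zero_le_two (by linarith)) ?_ n
  have h5 : 0 < s * c / (1 + c) := by positivity
  calc 2 / (1 - r) ≤ 2 / (s * c / (1 + c)) := by
        apply div_le_div_of_nonneg_left zero_le_two h5 h3
    _ = 2 * (1 + c) / c / s := by field_simp

theorem IsCoercive.summable {S : Set (Fin n → ℤ)} {v : Fin n → ℝ} (hv : IsCoercive S v) {s : ℝ}
    (hs : 0 < s) (hs1 : s ≤ 1) : Summable (expTerm S v (-s)) := by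
  obtain ⟨C, hC⟩ := hv.exists_sum_le
  exact summable_of_sum_le (fun m => expTerm_nonneg S v _ m) (hC s hs hs1)

theorem IsCoercive.exists_tsum_le {S : Set (Fin n → ℤ)} {v : Fin n → ℝ} (hv : IsCoercive S v) :
    ∃ C : ℝ, ∀ s : ℝ, 0 < s → s ≤ 1 → (∑' m, expTerm S v (-s) m) * s ^ n ≤ C := by
  obtain ⟨C, hC⟩ := hv.exists_sum_le
  refine ⟨C, fun s hs hs1 => ?_⟩
  rw [← le_div_iff₀ (by positivity)]
  exact (hv.summable hs hs1).tsum_le_of_sum_le (hC s hs hs1)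

theorem IsCoercive.evalExp_mul_tsum {S : Set (Fin n → ℤ)} {v : Fin n → ℝ} (hv : IsCoercive S v)
    {g h : Laurent n} (H : MulSeriesEq S h g) {s : ℝ} (hs : 0 < s) (hs1 : s ≤ 1) :
    evalExp v (-s) h * ∑' m, expTerm S v (-s) m = evalExp v (-s) g := by
  have hsum := (hv.summable hs hs1).hasSum
  have h1 : ∀ u ∈ h.coeff.support, HasSum
      (fun w => (h.coeff u : ℝ) * Real.exp (-s * pairing u v) * expTerm S v (-s) (w - u))
      ((h.coeff u : ℝ) * Real.exp (-s * pairing u v) * ∑' m, expTerm S v (-s) m) := fun u _ =>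
    (((Equiv.subRight u).hasSum_iff).mpr hsum).mul_left _
  have h2 := hasSum_sum h1
  have h3 : HasSum (fun w => (g.coeff w : ℝ) * Real.exp (-s * pairing w v))
      (evalExp v (-s) g) := by
    rw [evalExp_apply]
    apply hasSum_sum_of_ne_finset_zero
    intro w hw
    rw [Finsupp.notMem_support_iff.mp hw]
    simp
  rw [evalExp_apply, Finset.sum_mul]
  refine h2.unique ?_
  convert! h3 using 2 with w
  rw [← H w, Int.cast_sum, Finset.sum_mul]
  refine Finset.sum_congr rfl fun u _ => ?_
  rw [expTerm, Set.indicator_apply]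
  split_ifs with hw
  · rw [mul_assoc, ← Real.exp_add, pairing_sub_left]
    congr 2
    ring
  · simp

/-- The dual monoid contains a translated box with at least `s^(-n)` lattice points at distance `O(1
/ s)` from the origin, on which the terms of the series stay above a positive constant. -/
theorem exists_le_tsum_expTerm (G : Finset (Fin n → ℤ)) {m₀ : Fin n → ℤ}
    (hm₀ : ∀ w ∈ G, w ≠ 0 → 0 < m₀ ⬝ᵥ w) {v : Fin n → ℝ} (hv : IsCoercive (latticeDual G) v) :
    ∃ c > 0, ∀ s : ℝ, 0 < s → s ≤ 1 →
      c ≤ (∑' m, expTerm (latticeDual G : Set (Fin n → ℤ)) v (-s) m) * s ^ n := by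
  obtain ⟨C, hC⟩ := Finset.exists_le (G.image fun w => ∑ i, |w i|)
  set A : ℝ := |(C : ℝ) * pairing m₀ v| + ∑ i, |v i| with hA
  have hA0 : 0 ≤ A := add_nonneg (abs_nonneg _) (Finset.sum_nonneg fun i _ => abs_nonneg _)
  refine ⟨Real.exp (-(2 * A)), Real.exp_pos _, fun s hs hs1 => ?_⟩
  set L : ℕ := ⌈1 / s⌉₊ with hL
  -- A point of the box `[0, L)^n` pairs with `w` to at least `-L ∑ |w i| ≥ -C L`. The shift by `C L
  -- m₀` makes up for this, as `m₀ ⬝ᵥ w ≥ 1` for nonzero `w ∈ G`.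
  let pt : (Fin n → ℕ) → (Fin n → ℤ) := fun a => (C * L) • m₀ + fun i => (a i : ℤ)
  have hpt : Function.Injective pt := fun a b hab => by
    ext i
    have := congrFun (add_left_cancel hab) i
    exact_mod_cast this
  let A' := Fintype.piFinset fun _ : Fin n => Finset.range L
  have hlow : ∀ a ∈ A', Real.exp (-(2 * A)) ≤ expTerm (latticeDual G) v (-s) (pt a) := by
    intro a ha
    have haL : ∀ i, a i < L := fun i => Finset.mem_range.mp (Fintype.mem_piFinset.mp ha i)
    have hmem : pt a ∈ latticeDual G := by
      intro w hw
      by_cases hw0 : w = 0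
      · simp [hw0]
      have h1 := hm₀ w hw hw0
      have h2 := hC _ (Finset.mem_image_of_mem _ hw)
      have h3 : -(L * ∑ i, |w i|) ≤ (fun i => (a i : ℤ)) ⬝ᵥ w := by
        rw [dotProduct, Finset.mul_sum, ← Finset.sum_neg_distrib]
        refine Finset.sum_le_sum fun i _ => ?_
        have h4 := neg_abs_le (w i)
        have h5 := abs_nonneg (w i)
        have h6 : (a i : ℤ) ≤ L := by exact_mod_cast (haL i).le
        nlinarith [Int.natCast_nonneg (a i)]
      have h0 : 0 ≤ ∑ i, |w i| := Finset.sum_nonneg fun i _ => abs_nonneg _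
      have hC0 : 0 ≤ C := h0.trans h2
      rw [add_dotProduct, smul_dotProduct, smul_eq_mul]
      have h7 : (L : ℤ) * ∑ i, |w i| ≤ C * L := by
        rw [mul_comm]
        exact mul_le_mul_of_nonneg_right h2 (Int.natCast_nonneg L)
      have h8 : 0 ≤ C * (L : ℤ) := mul_nonneg hC0 (Int.natCast_nonneg L)
      nlinarith
    rw [expTerm, Set.indicator_of_mem (show pt a ∈ (latticeDual G : Set _) from hmem),
      Real.exp_le_exp]
    have h1 : pairing (pt a) v ≤ L * A := by
      rw [pairing_add_left, pairing_smul_left, hA, mul_add]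
      refine add_le_add ?_ ?_
      · push_cast
        have := le_abs_self ((C : ℝ) * pairing m₀ v)
        nlinarith [Nat.cast_nonneg (α := ℝ) L]
      · rw [pairing, Finset.mul_sum]
        refine Finset.sum_le_sum fun i _ => ?_
        have h4 := le_abs_self (v i)
        have h5 := abs_nonneg (v i)
        have h6 : (a i : ℝ) ≤ L := by exact_mod_cast (haL i).le
        have h7 : (0 : ℝ) ≤ a i := Nat.cast_nonneg _
        push_cast
        nlinarith
    have h2 : s * L ≤ 2 := by
      have := Nat.ceil_lt_add_one (show 0 ≤ 1 / s by positivity)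
      rw [← hL] at this
      calc s * L ≤ s * (1 / s + 1) := by gcongr
        _ = 1 + s := by field_simp
        _ ≤ 2 := by linarith
    nlinarith
  have hsum : (L : ℝ) ^ n * Real.exp (-(2 * A)) ≤
      ∑' m, expTerm (latticeDual G : Set (Fin n → ℤ)) v (-s) m := by
    calc (L : ℝ) ^ n * Real.exp (-(2 * A)) = ∑ _a ∈ A', Real.exp (-(2 * A)) := by
          simp [A', Fintype.card_piFinset]
      _ ≤ ∑ a ∈ A', expTerm (latticeDual G) v (-s) (pt a) := Finset.sum_le_sum hlow
      _ = ∑ m ∈ A'.image pt, expTerm (latticeDual G) v (-s) m :=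
          (Finset.sum_image fun a _ b _ hab => hpt hab).symm
      _ ≤ _ := (hv.summable hs hs1).sum_le_tsum _ fun m _ => expTerm_nonneg _ _ _ _
  have hLs : 1 ≤ L * s := by
    have := Nat.le_ceil (1 / s)
    rw [div_le_iff₀ hs] at this
    exact this
  calc Real.exp (-(2 * A)) ≤ (L * s) ^ n * Real.exp (-(2 * A)) :=
        le_mul_of_one_le_left (Real.exp_pos _).le (one_le_pow₀ hLs)
    _ = (L : ℝ) ^ n * Real.exp (-(2 * A)) * s ^ n := by rw [mul_pow]; ring
    _ ≤ _ := by gcongr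

open Filter Topology in
-- In the identity `h(exp(-s v)) Z(s) = g(exp(-s v))`, the outer factors are of exact orders `s ^ b`
-- and `s ^ a`, and `Z(s) s ^ n` stays between positive constants. Either inequality between `a + n`
-- and `b` would give a positive limit bounded by `0`.
theorem order_add_eq_order (G : Finset (Fin n → ℤ)) {m₀ : Fin n → ℤ}
    (hm₀ : ∀ w ∈ G, w ≠ 0 → 0 < m₀ ⬝ᵥ w) {v : Fin n → ℝ} (hv : IsCoercive (latticeDual G) v)
    {g h : Laurent n} (H : MulSeriesEq (latticeDual G) h g)
    (hh : MvPolynomial.aeval v (leadingForm (expand n h)) ≠ 0)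
    (hg : g ≠ 0 → MvPolynomial.aeval v (leadingForm (expand n g)) ≠ 0) :
    g ≠ 0 ∧ (expand n g).order.toNat + n = (expand n h).order.toNat := by
  obtain ⟨C, hC⟩ := hv.exists_tsum_le
  obtain ⟨c, hc, hcC⟩ := exists_le_tsum_expTerm G hm₀ hv
  set Z : ℝ → ℝ := fun s => ∑' m, expTerm (latticeDual G : Set (Fin n → ℤ)) v (-s) m with hZ
  have hneg : Tendsto (fun s : ℝ => -s) (𝓝[>] 0) (𝓝[≠] 0) := by
    have : Tendsto (fun s : ℝ => -s) (𝓝[>] 0) (𝓝[<] 0) := by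
      simpa using tendsto_neg_nhdsGT (a := (0 : ℝ))
    exact this.mono_right (nhdsWithin_mono _ fun x hx => ne_of_lt hx)
  have hsmall : ∀ᶠ s : ℝ in 𝓝[>] 0, 0 < s ∧ s ≤ 1 := by
    filter_upwards [Ioc_mem_nhdsGT (show (0 : ℝ) < 1 by norm_num)] with s hs using hs
  have htend : ∀ q : Laurent n, Tendsto
      (fun s => |evalExp v (-s) q| / s ^ (expand n q).order.toNat) (𝓝[>] 0)
      (𝓝 |MvPolynomial.aeval v (leadingForm (expand n q))|) := by
    intro q
    refine (((tendsto_evalExp_div_pow q v).comp hneg).abs).congr' ?_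
    filter_upwards [hsmall] with s hs
    rw [Function.comp_apply, abs_div, abs_pow, abs_neg, abs_of_pos hs.1]
  have hmul : ∀ᶠ s : ℝ in 𝓝[>] 0, |evalExp v (-s) h| * Z s = |evalExp v (-s) g| := by
    filter_upwards [hsmall] with s hs
    rw [← hv.evalExp_mul_tsum H hs.1 hs.2, abs_mul,
      abs_of_nonneg (tsum_nonneg fun m => expTerm_nonneg _ v (-s) m)]
  have hη : 0 < |MvPolynomial.aeval v (leadingForm (expand n h))| := abs_pos.mpr hh
  have hhpos : ∀ᶠ s : ℝ in 𝓝[>] 0, 0 < |evalExp v (-s) h| := by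
    filter_upwards [(htend h).eventually (lt_mem_nhds hη), hsmall] with s hs hs1
    by_contra hcon
    have : |evalExp v (-s) h| = 0 := le_antisymm (not_lt.mp hcon) (abs_nonneg _)
    rw [this, zero_div] at hs
    exact lt_irrefl _ hs
  have hg0 : g ≠ 0 := by
    rintro rfl
    obtain ⟨s, hs1, hs2, hs3⟩ := (hmul.and (hhpos.and hsmall)).exists
    have h1 := hcC s hs3.1 hs3.2
    rw [map_zero, abs_zero] at hs1
    have : Z s = 0 := (mul_eq_zero.mp hs1).resolve_left hs2.ne'
    change c ≤ Z s * s ^ n at h1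
    rw [this, zero_mul] at h1
    exact absurd h1 (not_le.mpr hc)
  refine ⟨hg0, ?_⟩
  set a := (expand n g).order.toNat with ha
  set b := (expand n h).order.toNat with hb
  set γ := |MvPolynomial.aeval v (leadingForm (expand n g))| with hγdef
  set η := |MvPolynomial.aeval v (leadingForm (expand n h))| with hηdef
  have hγ : 0 < γ := abs_pos.mpr (hg hg0)
  have hpow0 : ∀ k : ℕ, k ≠ 0 → Tendsto (fun s : ℝ => s ^ k) (𝓝[>] 0) (𝓝 0) := fun k hk => by
    have := ((tendsto_id (α := ℝ) (x := 𝓝 0)).pow k).mono_left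
      (nhdsWithin_le_nhds (s := Set.Ioi 0))
    simpa [hk] using this
  rcases lt_trichotomy (a + n) b with hlt | heq | hgt
  · exfalso
    obtain ⟨k, hk⟩ := Nat.exists_eq_add_of_lt hlt
    have h1 : Tendsto (fun s => |evalExp v (-s) h| / s ^ b * C * s ^ (k + 1)) (𝓝[>] 0) (𝓝 0) := by
      simpa using ((htend h).mul_const C).mul (hpow0 (k + 1) (by omega))
    have h2 : ∀ᶠ s in 𝓝[>] 0, |evalExp v (-s) g| / s ^ a ≤
        |evalExp v (-s) h| / s ^ b * C * s ^ (k + 1) := by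
      filter_upwards [hmul, hsmall] with s hs hs1
      have hs0 := hs1.1
      calc |evalExp v (-s) g| / s ^ a
          = |evalExp v (-s) h| / s ^ b * (Z s * s ^ n) * s ^ (k + 1) := by
            rw [← hs, hk]
            field_simp
            ring
        _ ≤ _ := by
            have := hC s hs1.1 hs1.2
            gcongr
    exact absurd (le_of_tendsto_of_tendsto (htend g) h1 h2) (not_le.mpr hγ)
  · exact heq
  · exfalso
    obtain ⟨k, hk⟩ := Nat.exists_eq_add_of_lt hgt
    have h1 : Tendsto (fun s => |evalExp v (-s) g| / s ^ a * s ^ (k + 1)) (𝓝[>] 0) (𝓝 0) := by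
      simpa using (htend g).mul (hpow0 (k + 1) (by omega))
    have h2 : ∀ᶠ s in 𝓝[>] 0, |evalExp v (-s) h| / s ^ b * c ≤
        |evalExp v (-s) g| / s ^ a * s ^ (k + 1) := by
      filter_upwards [hmul, hsmall] with s hs hs1
      have hs0 := hs1.1
      calc |evalExp v (-s) h| / s ^ b * c ≤ |evalExp v (-s) h| / s ^ b * (Z s * s ^ n) := by
            have := hcC s hs1.1 hs1.2
            gcongr
        _ = |evalExp v (-s) g| / s ^ a * s ^ (k + 1) := by
            rw [← hs]
            have : s ^ a * s ^ n = s ^ b * s ^ (k + 1) := by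
              rw [← pow_add, ← pow_add, hk, add_assoc]
            field_simp
            linear_combination (|evalExp v (-s) h| * Z s) * this
    exact absurd (le_of_tendsto_of_tendsto ((htend h).mul_const c) h1 h2)
      (not_le.mpr (mul_pos hη hc))

/-! ### Interior points of cones -/

/-- The point `p` can be moved a little in every direction within the cone `σ`. -/
def IsAbsorbing (σ : PointedCone ℝ (Fin n → ℝ)) (p : Fin n → ℝ) : Prop :=
  ∀ q : Fin n → ℝ, ∃ ε : ℝ, 0 < ε ∧ p + ε • q ∈ σ

open Filter Topology in
-- Nonnegativity of `m` at `p ± ε e_i` says that `ε |m i| ≤ ⟨m, p⟩`.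
theorem IsAbsorbing.isCoercive {σ : PointedCone ℝ (Fin n → ℝ)} {p : Fin n → ℝ}
    (hp : IsAbsorbing σ p) : IsCoercive (dualLatticePoints σ) p := by
  have h1 : ∀ i, ∃ ε > 0, ∀ m ∈ dualLatticePoints σ, ε * |(m i : ℝ)| ≤ pairing m p := by
    intro i
    obtain ⟨ε, hε, hmem⟩ := hp (Pi.single i 1)
    obtain ⟨ε', hε', hmem'⟩ := hp (-Pi.single i 1)
    have hpair : ∀ m : Fin n → ℤ, pairing m (Pi.single i 1) = m i := fun m => by
      simp [pairing, Pi.single_apply]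
    refine ⟨min ε ε', lt_min hε hε', fun m hm => ?_⟩
    have h2 := hm _ hmem
    have h3 := hm _ hmem'
    rw [pairing_add_right, pairing_smul_right, hpair] at h2
    rw [pairing_add_right, smul_neg, ← neg_smul, pairing_smul_right, hpair] at h3
    rcases abs_cases (m i : ℝ) with ⟨h, h'⟩ | ⟨h, h'⟩ <;> rw [h]
    · have := min_le_right ε ε'
      nlinarith
    · have := min_le_left ε ε'
      nlinarith
  choose ε hε hεm using h1
  have h2 : ∀ᶠ c : ℝ in 𝓝[>] 0, ∀ i, c ≤ ε i := by
    rw [eventually_all]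
    intro i
    filter_upwards [Ioc_mem_nhdsGT (hε i)] with c hc using hc.2
  obtain ⟨c, hc, hc0⟩ := (h2.and self_mem_nhdsWithin).exists
  have hc0 : 0 < c := hc0
  -- Summing over the coordinates costs a factor `n`; `n + 1` also covers `n = 0`.
  refine ⟨c / (n + 1), by positivity, fun m hm => ?_⟩
  have h3 : ∑ i, c * |(m i : ℝ)| ≤ ∑ _i : Fin n, pairing m p :=
    Finset.sum_le_sum fun i _ =>
      (mul_le_mul_of_nonneg_right (hc i) (abs_nonneg _)).trans (hεm i m hm)
  rw [← Finset.mul_sum] at h3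
  simp at h3
  have h4 : 0 ≤ pairing m p := by
    obtain ⟨δ, -, hδ⟩ := hp 0
    simpa using hm _ hδ
  rw [div_mul_eq_mul_div, div_le_iff₀ (by positivity)]
  linarith

theorem mem_of_isAbsorbing {σ : PointedCone ℝ (Fin n → ℝ)} {p : Fin n → ℝ}
    (hp : IsAbsorbing σ p) : p ∈ σ := by
  obtain ⟨δ, -, hδ⟩ := hp 0
  simpa using hδ

theorem add_smul_mem_of_le {σ : PointedCone ℝ (Fin n → ℝ)} {p q : Fin n → ℝ} (hp : p ∈ σ) {δ ε : ℝ}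
    (hq : p + δ • q ∈ σ) (hε : 0 ≤ ε) (hεδ : ε ≤ δ) : p + ε • q ∈ σ := by
  rcases eq_or_lt_of_le (hε.trans hεδ) with h | h
  · have : ε = 0 := by linarith
    simpa [this] using hp
  have h1 : (1 - ε / δ) • p + (ε / δ) • (p + δ • q) ∈ σ :=
    σ.add_mem (σ.smul_mem (by rw [sub_nonneg, div_le_one h]; exact hεδ) hp)
      (σ.smul_mem (by positivity) hq)
  convert! h1 using 1
  rw [smul_add, smul_smul, div_mul_cancel₀ _ h.ne', sub_smul, one_smul]
  abel

theorem exists_aeval_ne_zero {F : MvPolynomial (Fin n) ℤ} (hF : F ≠ 0) :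
    ∃ z : Fin n → ℝ, MvPolynomial.aeval z F ≠ 0 := by
  by_contra! hcon
  apply hF
  apply MvPolynomial.map_injective (Int.castRingHom ℝ) Int.cast_injective
  rw [map_zero]
  apply MvPolynomial.funext
  intro z
  rw [MvPolynomial.eval_map, map_zero, ← hcon z]
  rfl

/-- The restriction of a polynomial to the line through `p` in the direction `q`. -/
noncomputable def restrictLine (p q : Fin n → ℝ) (F : MvPolynomial (Fin n) ℤ) : Polynomial ℝ :=
  MvPolynomial.aeval (fun i => Polynomial.C (p i) + Polynomial.X * Polynomial.C (q i)) F

theorem eval_restrictLine (p q : Fin n → ℝ) (F : MvPolynomial (Fin n) ℤ) (t : ℝ) :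
    (restrictLine p q F).eval t = MvPolynomial.aeval (p + t • q) F := by
  have : ((Polynomial.aeval t).restrictScalars ℤ).comp
      (MvPolynomial.aeval fun i => Polynomial.C (p i) + Polynomial.X * Polynomial.C (q i)) =
      MvPolynomial.aeval (p + t • q) := by
    apply MvPolynomial.algHom_ext
    intro i
    simp
    ring
  simpa [restrictLine, Polynomial.coe_aeval_eq_eval] using DFunLike.congr_fun this F

/-- On the line from `p` to a point where `F ≠ 0`, `F` has finitely many zeros, so it is nonzero at
some point close to `p`. -/
theorem IsAbsorbing.exists_isCoercive_aeval_ne_zero {σ : PointedCone ℝ (Fin n → ℝ)}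
    {p : Fin n → ℝ} (hp : IsAbsorbing σ p) {F : MvPolynomial (Fin n) ℤ} (hF : F ≠ 0) :
    ∃ v, IsCoercive (dualLatticePoints σ) v ∧ MvPolynomial.aeval v F ≠ 0 := by
  obtain ⟨z, hz⟩ := exists_aeval_ne_zero hF
  set q := z - p with hq
  obtain ⟨δ, hδ, hmem⟩ := hp q
  obtain ⟨c, hc, hcm⟩ := hp.isCoercive
  have hne : restrictLine p q F ≠ 0 := by
    intro h
    apply hz
    have := eval_restrictLine p q F 1
    rw [h, Polynomial.eval_zero, one_smul, hq, add_sub_cancel] at this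
    exact this.symm
  obtain ⟨t, ht, htr⟩ := ((Set.Ioo_infinite (show (0 : ℝ) < δ / 2 by positivity)).sdiff
    (restrictLine p q F).roots.toFinset.finite_toSet).nonempty
  -- As `2 t ≤ δ`, the point `p + 2 t q` is still in `σ`, and `p + t q` is its midpoint with `p`.
  -- Half of the coercivity of `p` survives.
  refine ⟨p + t • q, ⟨c / 2, by positivity, fun m hm => ?_⟩, ?_⟩
  · have h1 := hm _ (add_smul_mem_of_le (mem_of_isAbsorbing hp) hmem
      (show 0 ≤ 2 * t by linarith [ht.1]) (show 2 * t ≤ δ by linarith [ht.2]))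
    have h2 := hcm m hm
    rw [pairing_add_right, pairing_smul_right] at h1 ⊢
    linarith
  · intro h0
    apply htr
    rw [← eval_restrictLine] at h0
    simpa [hne] using h0

/-! ### Cones generated by lattice points -/

/-- A lattice point as a vector in `N_ℝ`. -/
def toReal (w : Fin n → ℤ) : Fin n → ℝ := fun i => (w i : ℝ)

/-- The cone generated by a finite set of lattice points. -/
noncomputable def latticeCone (G : Finset (Fin n → ℤ)) : PointedCone ℝ (Fin n → ℝ) :=
  PointedCone.hull ℝ (toReal '' (G : Set (Fin n → ℤ)))

theorem pairing_toReal (a v : Fin n → ℤ) : pairing a (toReal v) = (a ⬝ᵥ v : ℤ) :=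
  pairing_intCast a v

theorem toReal_mem_latticeCone {G : Finset (Fin n → ℤ)} {w : Fin n → ℤ} (hw : w ∈ G) :
    toReal w ∈ latticeCone G :=
  PointedCone.subset_hull ⟨w, hw, rfl⟩

theorem mem_latticeCone_iff {G : Finset (Fin n → ℤ)} {x : Fin n → ℝ} :
    x ∈ latticeCone G ↔
      ∃ c : (Fin n → ℤ) → ℝ, (∀ w, 0 ≤ c w) ∧ x = ∑ w ∈ G, c w • toReal w := by
  constructor
  · intro hx
    refine Submodule.span_induction (p := fun x _ => ∃ c : (Fin n → ℤ) → ℝ, (∀ w, 0 ≤ c w) ∧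
      x = ∑ w ∈ G, c w • toReal w) ?_ ?_ ?_ ?_ hx
    · rintro _ ⟨w, hw, rfl⟩
      refine ⟨Pi.single w 1, fun w' => ?_, ?_⟩
      · by_cases h : w' = w
        · subst h; simp
        · simp [h]
      · rw [Finset.sum_eq_single w]
        · simp
        · intro b _ hb
          simp [hb]
        · intro h
          exact absurd hw h
    · exact ⟨0, fun _ => le_rfl, by simp⟩
    · rintro x y _ _ ⟨c, hc, rfl⟩ ⟨d, hd, rfl⟩
      exact ⟨c + d, fun w => add_nonneg (hc w) (hd w), by
        simp [add_smul, Finset.sum_add_distrib]⟩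
    · rintro a x _ ⟨c, hc, rfl⟩
      refine ⟨fun w => a * c w, fun w => mul_nonneg a.2 (hc w), ?_⟩
      rw [Finset.smul_sum]
      refine Finset.sum_congr rfl fun w _ => ?_
      rw [mul_smul]
      rfl
  · rintro ⟨c, hc, rfl⟩
    exact sum_mem fun w hw => (latticeCone G).smul_mem (hc w) (toReal_mem_latticeCone hw)

theorem dualLatticePoints_latticeCone (G : Finset (Fin n → ℤ)) :
    dualLatticePoints (latticeCone G) = latticeDual G := by
  ext u
  constructor
  · intro hu w hw
    have := hu _ (toReal_mem_latticeCone hw)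
    rw [pairing_toReal] at this
    exact_mod_cast this
  · intro hu x hx
    obtain ⟨c, hc, rfl⟩ := mem_latticeCone_iff.mp hx
    rw [pairing_sum_right]
    refine Finset.sum_nonneg fun w hw => ?_
    rw [pairing_smul_right, pairing_toReal]
    exact mul_nonneg (hc w) (by exact_mod_cast hu w hw)

open Filter Topology in
/-- Moving the sum of the generators of a cone within their linear span. -/
theorem exists_sum_add_smul_mem (G : Finset (Fin n → ℤ)) (c : (Fin n → ℤ) → ℝ) :
    ∃ ε : ℝ, 0 < ε ∧ ∑ w ∈ G, toReal w + ε • ∑ w ∈ G, c w • toReal w ∈ latticeCone G := by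
  have h : ∀ᶠ ε : ℝ in 𝓝[>] 0, ∀ w ∈ G, 0 ≤ 1 + ε * c w := by
    refine (eventually_all_finset G).mpr fun w _ => ?_
    have : Tendsto (fun ε : ℝ => 1 + ε * c w) (𝓝[>] 0) (𝓝 1) := by
      have hc : Continuous fun ε : ℝ => 1 + ε * c w := by fun_prop
      have := hc.tendsto 0
      simp only [zero_mul, add_zero] at this
      exact this.mono_left nhdsWithin_le_nhds
    exact (this.eventually (lt_mem_nhds one_pos)).mono fun _ h => h.le
  obtain ⟨ε, hε, hε0⟩ := (h.and self_mem_nhdsWithin).exists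
  refine ⟨ε, hε0, ?_⟩
  rw [Finset.smul_sum, ← Finset.sum_add_distrib]
  refine sum_mem fun w hw => ?_
  rw [smul_smul]
  nth_rewrite 1 [← one_smul ℝ (toReal w)]
  rw [← add_smul]
  exact (latticeCone G).smul_mem (hε w hw) (toReal_mem_latticeCone hw)

/-- The convex hull of the nonzero generators is compact and, by strong convexity, misses the
origin. A strictly separating functional stays positive on the generators after a small rational
perturbation, and its denominators can then be cleared. -/
theorem exists_pos_functional {G : Finset (Fin n → ℤ)}
    (hG : (latticeCone G : ConvexCone ℝ (Fin n → ℝ)).Salient) :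
    ∃ m₀ : Fin n → ℤ, ∀ w ∈ G, w ≠ 0 → 0 < m₀ ⬝ᵥ w := by
  set K : Set (Fin n → ℝ) := convexHull ℝ (toReal '' ((G.filter fun w => w ≠ 0 : Finset _) : Set _))
    with hK
  have hcompact : IsCompact K := ((Finset.finite_toSet _).image _).isCompact_convexHull (𝕜 := ℝ)
  have hconv : Convex ℝ ({x | x ∈ latticeCone G ∧ x ≠ 0} : Set (Fin n → ℝ)) := by
    intro x hx y hy a b ha hb hab
    refine ⟨(latticeCone G).add_mem ((latticeCone G).smul_mem ha hx.1)
      ((latticeCone G).smul_mem hb hy.1), fun h0 => ?_⟩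
    rcases eq_or_lt_of_le ha with ha0 | ha0
    · have hb1 : b = 1 := by linarith
      simp [← ha0, hb1] at h0
      exact hy.2 h0
    · apply hG x hx.1 hx.2
      have : -x = (b / a) • y := by
        have h1 : a • x = -(b • y) := eq_neg_of_add_eq_zero_left h0
        rw [div_eq_inv_mul, mul_smul, ← neg_eq_iff_eq_neg.mpr h1, smul_neg, smul_smul,
          inv_mul_cancel₀ ha0.ne', one_smul]
      rw [this]
      exact (latticeCone G).smul_mem (by positivity) hy.1
  have h0 : (0 : Fin n → ℝ) ∉ K := by
    intro h
    have hsub : K ⊆ {x | x ∈ latticeCone G ∧ x ≠ 0} := by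
      apply convexHull_min _ hconv
      rintro _ ⟨w, hw, rfl⟩
      obtain ⟨hw, hw0⟩ := Finset.mem_filter.mp hw
      refine ⟨toReal_mem_latticeCone hw, fun h => hw0 ?_⟩
      ext i
      have : (w i : ℝ) = 0 := congrFun h i
      exact_mod_cast this
    exact (hsub h).2 rfl
  obtain ⟨f, s, hs, hf⟩ := geometric_hahn_banach_point_closed (convex_convexHull ℝ _)
    hcompact.isClosed h0
  rw [map_zero] at hs
  have hfpos : ∀ w ∈ G, w ≠ 0 → 0 < f (toReal w) := fun w hw hw0 =>
    hs.trans (hf _ (subset_convexHull ℝ _ ⟨w, Finset.mem_filter.mpr ⟨hw, hw0⟩, rfl⟩))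
  set a : Fin n → ℝ := fun i => f (Pi.single i 1) with ha
  have hfa : ∀ w : Fin n → ℤ, f (toReal w) = ∑ i, a i * w i := by
    intro w
    have : toReal w = ∑ i, (w i : ℝ) • (Pi.single i 1 : Fin n → ℝ) := by
      ext j
      simp [toReal, Finset.sum_apply, Pi.single_apply]
    rw [this, map_sum]
    refine Finset.sum_congr rfl fun i _ => ?_
    rw [map_smul, smul_eq_mul, mul_comm]
  have hopen : IsOpen {b : Fin n → ℝ | ∀ w ∈ G.filter (· ≠ 0), 0 < ∑ i, b i * (w i : ℝ)} := by
    simp only [Set.ofPred_forall]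
    refine isOpen_biInter_finset fun w _ => isOpen_lt continuous_const (by fun_prop)
  have hdense : DenseRange (fun r : Fin n → ℚ => fun i => (r i : ℝ)) :=
    DenseRange.piMap fun _ => Rat.denseRange_cast
  obtain ⟨r, hr⟩ := hdense.exists_mem_open hopen ⟨a, fun w hw => by
    obtain ⟨hw, hw0⟩ := Finset.mem_filter.mp hw
    rw [← hfa]
    exact hfpos w hw hw0⟩
  set N : ℕ := ∏ i, (r i).den with hN
  have hNpos : 0 < N := Finset.prod_pos fun i _ => (r i).den_pos
  have hint : ∀ i, ∃ z : ℤ, (z : ℚ) = N * r i := by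
    intro i
    refine ⟨(r i).num * ∏ j ∈ Finset.univ.erase i, ((r j).den : ℤ), ?_⟩
    rw [hN, ← Finset.mul_prod_erase _ _ (Finset.mem_univ i)]
    push_cast
    have := Rat.den_mul_eq_num (r i)
    linear_combination (-(∏ j ∈ Finset.univ.erase i, ((r j).den : ℚ))) * this
  choose m₀ hm₀ using hint
  refine ⟨m₀, fun w hw hw0 => ?_⟩
  have h1 := hr w (Finset.mem_filter.mpr ⟨hw, hw0⟩)
  have h2 : ((m₀ ⬝ᵥ w : ℤ) : ℝ) = N * ∑ i, (r i : ℝ) * w i := by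
    rw [dotProduct, Int.cast_sum, Finset.mul_sum]
    refine Finset.sum_congr rfl fun i _ => ?_
    have : (m₀ i : ℝ) = N * r i := by exact_mod_cast congrArg (Rat.cast : ℚ → ℝ) (hm₀ i)
    push_cast
    rw [this, mul_assoc]
  have h3 : (0 : ℝ) < (m₀ ⬝ᵥ w : ℤ) := by
    rw [h2]
    exact mul_pos (by exact_mod_cast hNpos) h1
  exact_mod_cast h3

/-- Below a level of the positive functional `m₀`, the coefficients of the nonzero generators are
bounded, so this part of the cone lies in the image of a compact box. -/
theorem isClosed_latticeCone {G : Finset (Fin n → ℤ)}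
    (hG : (latticeCone G : ConvexCone ℝ (Fin n → ℝ)).Salient) :
    IsClosed (latticeCone G : Set (Fin n → ℝ)) := by
  obtain ⟨m₀, hm₀⟩ := exists_pos_functional hG
  have hcont : Continuous fun x : Fin n → ℝ => pairing m₀ x := by
    unfold pairing
    fun_prop
  have hbox : ∀ R : ℝ, IsCompact ((fun c : (G → ℝ) => ∑ w : G, c w • toReal w.1) ''
      Set.Icc 0 (fun _ => R)) := fun R =>
    isCompact_Icc.image (by fun_prop)
  refine isClosed_of_closure_subset fun x hx => ?_
  set R := pairing m₀ x + 1
  have hopen : IsOpen {y : Fin n → ℝ | pairing m₀ y < R} := isOpen_lt hcont continuous_const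
  have hx' : x ∈ closure ({y | pairing m₀ y < R} ∩ (latticeCone G : Set (Fin n → ℝ))) :=
    hopen.inter_closure ⟨lt_add_one (pairing m₀ x), hx⟩
  have hsub : ({y | pairing m₀ y < R} ∩ (latticeCone G : Set (Fin n → ℝ))) ⊆
      (fun c : (G → ℝ) => ∑ w : G, c w • toReal w.1) '' Set.Icc 0 (fun _ => R) := by
    rintro y ⟨hyR, hy⟩
    obtain ⟨c, hc, rfl⟩ := mem_latticeCone_iff.mp hy
    have hyR : pairing m₀ (∑ w ∈ G, c w • toReal w) < R := hyR
    rw [pairing_sum_right] at hyR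
    have hnn : ∀ w ∈ G, 0 ≤ pairing m₀ (c w • toReal w) := fun w hw => by
      rw [pairing_smul_right, pairing_toReal]
      by_cases hw0 : w = 0
      · simp [hw0]
      · exact mul_nonneg (hc w) (by exact_mod_cast (hm₀ w hw hw0).le)
    have hR0 : 0 ≤ R := (Finset.sum_nonneg hnn).trans hyR.le
    -- The functional `m₀` does not control the coefficient of the zero vector, which is reset to
    -- `0`.
    refine ⟨fun w => if w.1 = 0 then 0 else c w, ⟨fun w => ?_, fun w => ?_⟩, ?_⟩
    · dsimp only
      split_ifs
      · exact le_rfl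
      · exact hc w
    · dsimp only
      split_ifs with h
      · exact hR0
      · have h1 := (Finset.single_le_sum hnn w.2).trans hyR.le
        rw [pairing_smul_right, pairing_toReal] at h1
        have h2 : (1 : ℝ) ≤ (m₀ ⬝ᵥ w.1 : ℤ) := by exact_mod_cast hm₀ w w.2 h
        have h3 := hc w
        nlinarith
    · dsimp only
      rw [← Finset.sum_coe_sort G fun w => c w • toReal w]
      refine Finset.sum_congr rfl fun w _ => ?_
      split_ifs with h
      · have : toReal w.1 = 0 := by ext i; simp [toReal, h]
        rw [this, smul_zero, smul_zero]
      · rfl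
  have hx'' := closure_minimal hsub (hbox R).isClosed hx'
  obtain ⟨c, hc, rfl⟩ := hx''
  exact sum_mem fun w _ => (latticeCone G).smul_mem (hc.1 w) (toReal_mem_latticeCone w.2)

/-! ### Maximal cones of a complete fan -/

namespace Fan

variable {Δ : Fan n}

theorem exists_generators {σ : PointedCone ℝ (Fin n → ℝ)} (hσ : σ ∈ Δ.cones) :
    ∃ G : Finset (Fin n → ℤ), σ = latticeCone G :=
  Δ.rational σ hσ

theorem isClosed_cone {σ : PointedCone ℝ (Fin n → ℝ)} (hσ : σ ∈ Δ.cones) :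
    IsClosed (σ : Set (Fin n → ℝ)) := by
  obtain ⟨G, rfl⟩ := exists_generators hσ
  exact isClosed_latticeCone (Δ.salient _ hσ)

theorem mem_cones_of_mem_maxCones {σ : PointedCone ℝ (Fin n → ℝ)} (hσ : σ ∈ Δ.maxCones) :
    σ ∈ Δ.cones := (Finset.mem_filter.mp hσ).1

theorem eq_of_le_of_mem_maxCones {σ τ : PointedCone ℝ (Fin n → ℝ)} (hσ : σ ∈ Δ.maxCones)
    (hτ : τ ∈ Δ.cones) (h : σ ≤ τ) : τ = σ := (Finset.mem_filter.mp hσ).2 τ hτ h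

theorem exists_le_maxCone {σ : PointedCone ℝ (Fin n → ℝ)} (hσ : σ ∈ Δ.cones) :
    ∃ τ ∈ Δ.maxCones, σ ≤ τ := by
  obtain ⟨τ, hστ, hτ⟩ := Δ.cones.exists_le_maximal hσ
  exact ⟨τ, Finset.mem_filter.mpr ⟨hτ.1, fun ρ hρ h => le_antisymm (hτ.2 hρ h) h⟩, hστ⟩

open Filter Topology in
-- Finitely many cones cover the ray from `p` in the direction `q`, so one of them contains `p + ε
-- q` for arbitrarily small `ε > 0`. It contains `p` because it is closed.
theorem IsComplete.exists_maxCone (hΔ : Δ.IsComplete) (p q : Fin n → ℝ) :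
    ∃ σ ∈ Δ.maxCones, p ∈ σ ∧ ∃ ε : ℝ, 0 < ε ∧ p + ε • q ∈ σ := by
  have hcover : ∀ x : Fin n → ℝ, ∃ σ ∈ Δ.cones, x ∈ σ := fun x => by
    have : x ∈ Δ.support := by rw [hΔ]; trivial
    exact this
  have h1 : ∃ᶠ ε : ℝ in 𝓝[>] 0, ∃ σ ∈ Δ.cones, p + ε • q ∈ σ :=
    (Eventually.of_forall fun ε => hcover (p + ε • q)).frequently
  have h2 : ∃ σ ∈ Δ.cones, ∃ᶠ ε : ℝ in 𝓝[>] 0, p + ε • q ∈ σ := by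
    by_contra! hcon
    have : ∀ᶠ ε : ℝ in 𝓝[>] 0, ∀ σ ∈ Δ.cones, p + ε • q ∉ σ :=
      (eventually_all_finset Δ.cones).mpr fun σ hσ => hcon σ hσ
    exact h1 (this.mono fun ε h ⟨σ, hσ, hmem⟩ => h σ hσ hmem)
  obtain ⟨σ, hσ, hfreq⟩ := h2
  obtain ⟨τ, hτ, hστ⟩ := exists_le_maxCone hσ
  refine ⟨τ, hτ, hστ ?_, ?_⟩
  · have htend : Tendsto (fun ε : ℝ => p + ε • q) (𝓝[>] 0) (𝓝 p) := by
      have hc : Continuous fun ε : ℝ => p + ε • q := by fun_prop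
      have := hc.tendsto 0
      simp only [zero_smul, add_zero] at this
      exact this.mono_left nhdsWithin_le_nhds
    exact (isClosed_cone hσ).mem_of_frequently_of_tendsto hfreq htend
  · obtain ⟨ε, h, hε⟩ := (hfreq.and_eventually self_mem_nhdsWithin).exists
    exact ⟨ε, hε, hστ h⟩

/-- Maximal cones are full-dimensional. Let `p` be the sum of the generators of `σ`, and `τ` a
maximal cone containing `p` and `p + ε q`. The face `σ ⊓ τ` of `σ` contains `p`, hence every
generator, so `σ ≤ τ` and the two are equal. -/
theorem IsComplete.exists_isAbsorbing (hΔ : Δ.IsComplete) {σ : PointedCone ℝ (Fin n → ℝ)}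
    (hσ : σ ∈ Δ.maxCones) : ∃ p, IsAbsorbing σ p := by
  obtain ⟨G, hG⟩ := exists_generators (mem_cones_of_mem_maxCones hσ)
  refine ⟨∑ w ∈ G, toReal w, fun q => ?_⟩
  obtain ⟨τ, hτ, hp, ε, hε, hmem⟩ := hΔ.exists_maxCone (∑ w ∈ G, toReal w) q
  have hface := (Δ.inf_isFaceOf σ (mem_cones_of_mem_maxCones hσ) τ
    (mem_cones_of_mem_maxCones hτ)).1
  have hle : σ ≤ τ := by
    rw [hG]
    refine Submodule.span_le.mpr ?_
    rintro _ ⟨w, hw, rfl⟩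
    have hmemσ : ∀ w' ∈ G, toReal w' ∈ σ := fun w' hw' => hG ▸ toReal_mem_latticeCone hw'
    have h2 := hface.mem_of_add_mem_left (x := toReal w) (y := ∑ w' ∈ G.erase w, toReal w')
      (hmemσ w hw) (sum_mem fun w' hw' => hmemσ w' (Finset.mem_of_mem_erase hw'))
      (by rw [Finset.add_sum_erase _ _ hw]; exact ⟨sum_mem hmemσ, hp⟩)
    exact h2.2
  rw [eq_of_le_of_mem_maxCones hσ (mem_cones_of_mem_maxCones hτ) hle] at hmem
  exact ⟨ε, hε, hmem⟩

end Fan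

/-! ### Walls and adjacent cones -/

/-- The intersection of `σ` with the hyperplane `u = 0` spans this hyperplane. -/
def IsWall (u : Fin n → ℤ) (σ : PointedCone ℝ (Fin n → ℝ)) : Prop :=
  ∀ w : Fin n → ℤ, (∀ x ∈ σ, pairing u x = 0 → pairing w x = 0) → ∃ c : ℤ, w = c • u

theorem IsWall.neg {u : Fin n → ℤ} {σ : PointedCone ℝ (Fin n → ℝ)} (h : IsWall u σ) :
    IsWall (-u) σ := fun w hw => by
  obtain ⟨c, hc⟩ := h w fun x hx hux => hw x hx (by rw [pairing_neg_left, hux, neg_zero])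
  exact ⟨-c, by simpa using hc⟩

/-- The cones `σ` and `σ'` lie on the positive and on the negative side of the hyperplane `u = 0`,
and meet it in the same cone. -/
structure AreAdjacent (u : Fin n → ℤ) (σ σ' : PointedCone ℝ (Fin n → ℝ)) : Prop where
  left : u ∈ dualLatticePoints σ
  right : -u ∈ dualLatticePoints σ'
  mem_iff : ∀ x, pairing u x = 0 → (x ∈ σ ↔ x ∈ σ')

theorem AreAdjacent.symm {u : Fin n → ℤ} {σ σ' : PointedCone ℝ (Fin n → ℝ)}
    (h : AreAdjacent u σ σ') : AreAdjacent (-u) σ' σ where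
  left := h.right
  right := by rw [neg_neg]; exact h.left
  mem_iff x hx := (h.mem_iff x (by rwa [pairing_neg_left, neg_eq_zero] at hx)).symm

theorem AreAdjacent.isWall {u : Fin n → ℤ} {σ σ' : PointedCone ℝ (Fin n → ℝ)}
    (h : AreAdjacent u σ σ') (hσ : IsWall u σ) : IsWall u σ' := fun w hw =>
  hσ w fun x hx hux => hw x ((h.mem_iff x hux).mp hx) hux

theorem pairing_eq_zero_of_latticeCone {G : Finset (Fin n → ℤ)} {u w : Fin n → ℤ}
    (hu : u ∈ latticeDual G) (hw : ∀ v ∈ G, u ⬝ᵥ v = 0 → w ⬝ᵥ v = 0) {x : Fin n → ℝ}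
    (hx : x ∈ latticeCone G) (hux : pairing u x = 0) : pairing w x = 0 := by
  obtain ⟨c, hc, rfl⟩ := mem_latticeCone_iff.mp hx
  rw [pairing_sum_right] at hux ⊢
  have h1 := (Finset.sum_eq_zero_iff_of_nonneg (fun v hv => by
    rw [pairing_smul_right, pairing_toReal]
    exact mul_nonneg (hc v) (by exact_mod_cast hu v hv))).mp hux
  refine Finset.sum_eq_zero fun v hv => ?_
  have h2 := h1 v hv
  rw [pairing_smul_right, pairing_toReal, mul_eq_zero] at h2 ⊢
  exact h2.imp_right fun h => by exact_mod_cast hw v hv (by exact_mod_cast h)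

/-- The hypothesis concerns integral functionals only, so duality is applied over `ℚ`: a rational
functional that separates the vector from the span becomes, after clearing denominators, a multiple
of `u`, and this vanishes on the vector. -/
theorem single_sub_single_mem_span {G : Finset (Fin n → ℤ)} {u : Fin n → ℤ}
    (hG : ∀ w : Fin n → ℤ, (∀ v ∈ G, w ⬝ᵥ v = 0) → ∃ c : ℤ, w = c • u) (i j : Fin n) :
    (u i • Pi.single j 1 - u j • Pi.single i 1 : Fin n → ℚ) ∈
      Submodule.span ℚ ((fun w : Fin n → ℤ => fun k => (w k : ℚ)) '' (G : Set (Fin n → ℤ))) := by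
  by_contra hcon
  obtain ⟨f, hf, hker⟩ := Submodule.exists_le_ker_of_notMem hcon
  set a : Fin n → ℚ := fun k => f (Pi.single k 1) with ha
  have hfa : ∀ x : Fin n → ℚ, f x = ∑ k, a k * x k := by
    intro x
    have : x = ∑ k, x k • (Pi.single k 1 : Fin n → ℚ) := by
      ext l
      simp [Finset.sum_apply, Pi.single_apply]
    conv_lhs => rw [this, map_sum]
    refine Finset.sum_congr rfl fun k _ => ?_
    rw [map_smul, smul_eq_mul, mul_comm]
  obtain ⟨N, hN⟩ := IsLocalization.exist_integer_multiples_of_finite (nonZeroDivisors ℤ) a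
  choose w hw using hN
  have hw : ∀ k, (w k : ℚ) = (N : ℤ) * a k := fun k => by simpa [Algebra.smul_def] using hw k
  have hN0 : ((N : ℤ) : ℚ) ≠ 0 := by exact_mod_cast nonZeroDivisors.ne_zero N.2
  obtain ⟨c, hc⟩ := hG w fun v hv => by
    have h1 : f (fun k => (v k : ℚ)) = 0 :=
      LinearMap.mem_ker.mp (hker (Submodule.subset_span ⟨v, hv, rfl⟩))
    rw [hfa] at h1
    have h2 : ((w ⬝ᵥ v : ℤ) : ℚ) = (N : ℤ) * ∑ k, a k * v k := by
      rw [dotProduct, Int.cast_sum, Finset.mul_sum]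
      refine Finset.sum_congr rfl fun k _ => ?_
      rw [Int.cast_mul, hw, mul_assoc]
    rw [h1, mul_zero] at h2
    exact_mod_cast h2
  apply hf
  have h3 : (N : ℤ) * f (u i • Pi.single j 1 - u j • Pi.single i 1) = (0 : ℚ) := by
    rw [map_sub, map_zsmul, map_zsmul, zsmul_eq_mul, zsmul_eq_mul]
    change _ * ((u i : ℚ) * a j - (u j : ℚ) * a i) = 0
    have h4 := hw i
    have h5 := hw j
    rw [hc] at h4 h5
    simp only [Pi.smul_apply, smul_eq_mul, Int.cast_mul] at h4 h5
    linear_combination (u j : ℚ) * h4 - (u i : ℚ) * h5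
  exact (mul_eq_zero.mp h3).resolve_left hN0

theorem mem_span_of_pairing_eq_zero {G : Finset (Fin n → ℤ)} {u : Fin n → ℤ} (hu : u ≠ 0)
    (hG : ∀ w : Fin n → ℤ, (∀ v ∈ G, w ⬝ᵥ v = 0) → ∃ c : ℤ, w = c • u) {y : Fin n → ℝ}
    (hy : pairing u y = 0) : y ∈ Submodule.span ℝ (toReal '' (G : Set (Fin n → ℤ))) := by
  obtain ⟨i, hi⟩ := Function.ne_iff.mp hu
  have hi' : (u i : ℝ) ≠ 0 := by exact_mod_cast hi
  let φ : (Fin n → ℚ) →ₗ[ℚ] (Fin n → ℝ) :=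
    { toFun := fun x k => (x k : ℝ)
      map_add' := fun x z => by ext; simp
      map_smul' := fun r x => by ext; simp [Rat.smul_def] }
  have hφ : Submodule.span ℚ ((fun w : Fin n → ℤ => fun k => (w k : ℚ)) ''
      (G : Set (Fin n → ℤ))) ≤
      ((Submodule.span ℝ (toReal '' (G : Set (Fin n → ℤ)))).restrictScalars ℚ).comap φ := by
    refine Submodule.span_le.mpr ?_
    rintro _ ⟨v, hv, rfl⟩
    refine Submodule.subset_span ⟨v, hv, ?_⟩
    ext k
    simp [toReal, φ]
  -- The rational vectors `u_i e_j - u_j e_i` span the real hyperplane `u = 0`.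
  have hsum : y = ∑ j, (y j / u i) • φ (u i • Pi.single j 1 - u j • Pi.single i 1) := by
    ext l
    have h0 : ∑ j, (u j : ℝ) * y j = 0 := hy
    have h1 : ∀ j, φ (u i • Pi.single j 1 - u j • Pi.single i 1) l =
        (u i : ℝ) * (if l = j then 1 else 0) - (u j : ℝ) * (if l = i then 1 else 0) := fun j => by
      simp only [φ, LinearMap.coe_mk, AddHom.coe_mk, Pi.sub_apply, Pi.smul_apply, Pi.single_apply]
      split_ifs <;> simp
    simp only [Finset.sum_apply, Pi.smul_apply, h1, smul_eq_mul, mul_sub, Finset.sum_sub_distrib]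
    have h2 : ∑ j, y j / u i * ((u j : ℝ) * (if l = i then 1 else 0)) = 0 := by
      calc _ = ∑ j, ((u j : ℝ) * y j) * ((if l = i then 1 else 0) / u i) :=
            Finset.sum_congr rfl fun j _ => by ring
        _ = 0 := by rw [← Finset.sum_mul, h0, zero_mul]
    rw [h2, sub_zero, Finset.sum_eq_single l]
    · simp [hi']
    · intro j _ hj
      simp [hj.symm]
    · simp
  rw [hsum]
  exact Submodule.sum_mem _ fun j _ => Submodule.smul_mem _ _ (hφ (single_sub_single_mem_span hG i j))

/-- The point is the sum of the generators in the wall, which span the hyperplane `u = 0`; a small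
displacement in the hyperplane keeps their coefficients nonnegative. -/
theorem exists_mem_relative_interior {G : Finset (Fin n → ℤ)} {u : Fin n → ℤ} (hu0 : u ≠ 0)
    (hwall : IsWall u (latticeCone G)) (hu : u ∈ latticeDual G) :
    ∃ p ∈ latticeCone G, pairing u p = 0 ∧
      ∀ y, pairing u y = 0 → ∃ ε : ℝ, 0 < ε ∧ p + ε • y ∈ latticeCone G := by
  set G₀ := G.filter fun v => u ⬝ᵥ v = 0 with hG₀
  have hle : latticeCone G₀ ≤ latticeCone G :=
    Submodule.span_mono (Set.image_mono (Finset.coe_subset.mpr (Finset.filter_subset _ _)))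
  refine ⟨∑ w ∈ G₀, toReal w, hle (sum_mem fun w hw => toReal_mem_latticeCone hw), ?_, ?_⟩
  · rw [pairing_sum_right]
    refine Finset.sum_eq_zero fun w hw => ?_
    rw [pairing_toReal, (Finset.mem_filter.mp hw).2, Int.cast_zero]
  · intro y hy
    have hspan := mem_span_of_pairing_eq_zero (G := G₀) hu0 (fun w hw => hwall w fun x hx hux =>
      pairing_eq_zero_of_latticeCone hu
        (fun v hv huv => hw v (Finset.mem_filter.mpr ⟨hv, huv⟩)) hx hux) hy
    obtain ⟨c, hc⟩ : ∃ c : (Fin n → ℤ) → ℝ, ∑ w ∈ G₀, c w • toReal w = y := by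
      refine Submodule.span_induction (p := fun y _ =>
        ∃ c : (Fin n → ℤ) → ℝ, ∑ w ∈ G₀, c w • toReal w = y) ?_ ?_ ?_ ?_ hspan
      · rintro _ ⟨w, hw, rfl⟩
        refine ⟨Pi.single w 1, ?_⟩
        rw [Finset.sum_eq_single w]
        · simp
        · intro b _ hb
          simp [hb]
        · exact fun h => absurd hw h
      · exact ⟨0, by simp⟩
      · rintro x y _ _ ⟨c, rfl⟩ ⟨d, rfl⟩
        exact ⟨c + d, by simp [add_smul, Finset.sum_add_distrib]⟩
      · rintro a x _ ⟨c, rfl⟩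
        exact ⟨a • c, by simp [Finset.smul_sum, mul_smul]⟩
    obtain ⟨ε, hε, hmem⟩ := exists_sum_add_smul_mem G₀ c
    rw [hc] at hmem
    exact ⟨ε, hε, hle hmem⟩

theorem pairing_self_pos {u : Fin n → ℤ} (hu : u ≠ 0) : 0 < pairing u (toReal u) := by
  rw [pairing_toReal]
  have h0 : u ⬝ᵥ u ≠ 0 := fun h => hu (dotProduct_self_eq_zero.mp h)
  have h1 : 0 ≤ u ⬝ᵥ u := Finset.sum_nonneg fun i _ => mul_self_nonneg (u i)
  exact_mod_cast lt_of_le_of_ne h1 h0.symm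

theorem IsAbsorbing.pairing_pos {σ : PointedCone ℝ (Fin n → ℝ)} {p : Fin n → ℝ}
    (hp : IsAbsorbing σ p) {u : Fin n → ℤ} (hu : u ∈ dualLatticePoints σ) (hu0 : u ≠ 0) :
    0 < pairing u p := by
  obtain ⟨ε, hε, hmem⟩ := hp (-toReal u)
  have h1 := hu _ hmem
  rw [pairing_add_right, smul_neg, ← neg_smul, pairing_smul_right] at h1
  have := pairing_self_pos hu0
  nlinarith

namespace Fan

variable {Δ : Fan n}

/-- The neighbour is a maximal cone containing both a relatively interior point `p` of the wall and
a point `z = p - ε u` just beyond it. The remaining claims follow by writing `p`, or a multiple of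
it, as a sum in one cone and using that `σ ⊓ σ'` is a face of both. -/
theorem IsComplete.exists_areAdjacent (hΔ : Δ.IsComplete) {σ : PointedCone ℝ (Fin n → ℝ)}
    (hσ : σ ∈ Δ.maxCones) {u : Fin n → ℤ} (hu0 : u ≠ 0) (hu : u ∈ dualLatticePoints σ)
    (hwall : IsWall u σ) : ∃ σ' ∈ Δ.maxCones, AreAdjacent u σ σ' := by
  obtain ⟨G, hG⟩ := exists_generators (mem_cones_of_mem_maxCones hσ)
  obtain ⟨p, hpσ, hup, hp⟩ := exists_mem_relative_interior hu0 (hG ▸ hwall)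
    (by rw [hG, dualLatticePoints_latticeCone] at hu; exact hu)
  rw [← hG] at hpσ hp
  obtain ⟨σ', hσ', hpσ', ε, hε, hmem⟩ := hΔ.exists_maxCone p (-toReal u)
  obtain ⟨hface, hface'⟩ := Δ.inf_isFaceOf σ (mem_cones_of_mem_maxCones hσ) σ'
    (mem_cones_of_mem_maxCones hσ')
  set z := p + ε • (-toReal u) with hz
  have huz : pairing u z < 0 := by
    rw [hz, pairing_add_right, hup, zero_add, smul_neg, ← neg_smul, pairing_smul_right]
    have := pairing_self_pos hu0
    nlinarith
  have hle : ∀ x, pairing u x = 0 → x ∈ σ → x ∈ σ' := by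
    intro x hux hx
    obtain ⟨δ, hδ, hmem⟩ := hp (-x) (by
      rw [← neg_one_smul ℝ x, pairing_smul_right, hux, mul_zero])
    have h1 : δ • x ∈ σ ⊓ σ' := hface.mem_of_add_mem_right hmem (σ.smul_mem hδ.le hx)
      (by rw [smul_neg, neg_add_cancel_right]; exact ⟨hpσ, hpσ'⟩)
    exact (σ'.smul_mem_iff hδ).mp h1.2
  refine ⟨σ', hσ', hu, fun y hy => ?_, fun x hux => ⟨hle x hux, fun hx => ?_⟩⟩
  · rw [pairing_neg_left, neg_nonneg]
    by_contra! hcon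
    -- If `y ∈ σ'` were on the positive side, the segment from `y` to `z` would cross the hyperplane
    -- in the direction of `y'`. Then `p` is a sum of `p - δ y'` and positive multiples of `y` and
    -- `z`, all in `σ'`, so the face `σ ⊓ σ'` contains `z`, which is on the wrong side of `σ`.
    set y' := (-pairing u z) • y + pairing u y • z with hy'
    have huy' : pairing u y' = 0 := by
      rw [hy', pairing_add_right, pairing_smul_right, pairing_smul_right]
      ring
    have huy'' : pairing u (-y') = 0 := by
      rw [← neg_one_smul ℝ y', pairing_smul_right, huy', mul_zero]
    obtain ⟨δ, hδ, hmem'⟩ := hp (-y') huy''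
    have h1 : p + δ • -y' ∈ σ' := hle _ (by
      rw [pairing_add_right, hup, pairing_smul_right, huy'', mul_zero, zero_add]) hmem'
    have h2 : (δ * pairing u y) • z ∈ σ ⊓ σ' := by
      refine hface'.mem_of_add_mem_right
        (x := (p + δ • -y') + (δ * -pairing u z) • y) (σ'.add_mem h1 (σ'.smul_mem ?_ hy))
        (σ'.smul_mem (by positivity) hmem) ?_
      · have : 0 < -pairing u z := by linarith
        positivity
      · have : (p + δ • -y') + (δ * -pairing u z) • y + (δ * pairing u y) • z = p := by
          rw [hy']
          module
        rw [this]
        exact ⟨hpσ, hpσ'⟩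
    have h3 := hu _ ((σ.smul_mem_iff (by positivity)).mp h2.1)
    linarith
  · obtain ⟨δ, hδ, hmem'⟩ := hp (-x) (by
      rw [← neg_one_smul ℝ x, pairing_smul_right, hux, mul_zero])
    have h1 : p + δ • -x ∈ σ' := hle _ (by
      rw [pairing_add_right, hup, smul_neg, ← neg_smul, pairing_smul_right, hux, mul_zero,
        zero_add]) hmem'
    have h2 : δ • x ∈ σ ⊓ σ' := hface'.mem_of_add_mem_right h1 (σ'.smul_mem hδ.le hx)
      (by rw [smul_neg, neg_add_cancel_right]; exact ⟨hpσ, hpσ'⟩)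
    exact (σ.smul_mem_iff hδ).mp h2.1

/-- A cone adjacent to `σ` contains all points just below the relatively interior point `p` of the
wall (`key`). For `y ∈ σ₁`, both `p - ε u` and `(p - ε u) + ε y` are of this kind; the second lies
in the face `σ₁ ⊓ σ₂` of `σ₁`, so `y ∈ σ₂`. -/
theorem IsComplete.le_of_areAdjacent (hΔ : Δ.IsComplete) {σ σ₁ σ₂ : PointedCone ℝ (Fin n → ℝ)}
    (hσ : σ ∈ Δ.maxCones) (hσ₁ : σ₁ ∈ Δ.maxCones) (hσ₂ : σ₂ ∈ Δ.maxCones) {u : Fin n → ℤ}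
    (hu0 : u ≠ 0) (hwall : IsWall u σ) (h₁ : AreAdjacent u σ σ₁) (h₂ : AreAdjacent u σ σ₂) :
    σ₁ ≤ σ₂ := by
  obtain ⟨G, hG⟩ := exists_generators (mem_cones_of_mem_maxCones hσ)
  have hu := h₁.left
  obtain ⟨p, hpσ, hup, hp⟩ := exists_mem_relative_interior hu0 (hG ▸ hwall)
    (by rw [hG, dualLatticePoints_latticeCone] at hu; exact hu)
  rw [← hG] at hpσ hp
  have key : ∀ τ ∈ Δ.maxCones, AreAdjacent u σ τ → ∀ q, 0 < pairing u q →
      ∃ ε : ℝ, 0 < ε ∧ p + ε • (-q) ∈ τ := by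
    intro τ hτ h q hq
    obtain ⟨z, hz⟩ := hΔ.exists_isAbsorbing hτ
    have huz := hz.pairing_pos h.right (neg_ne_zero.mpr hu0)
    rw [pairing_neg_left] at huz
    -- The combination of `q` and the interior point `z` of `τ` that lies on `u = 0` can be
    -- subtracted from `p` inside the wall; adding the multiple of `z` back leaves `p` minus a
    -- multiple of `q`.
    have hu0' : pairing u (-((-pairing u z) • q + pairing u q • z)) = 0 := by
      rw [← neg_one_smul ℝ, pairing_smul_right, pairing_add_right, pairing_smul_right,
        pairing_smul_right]
      ring
    obtain ⟨δ, hδ, hmem⟩ := hp _ hu0'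
    have h1 := (h.mem_iff _ (by
      rw [pairing_add_right, hup, pairing_smul_right, hu0', mul_zero, zero_add])).mp hmem
    refine ⟨δ * -pairing u z, by positivity, ?_⟩
    have h2 := τ.add_mem h1 (τ.smul_mem (show 0 ≤ δ * pairing u q by positivity)
      (mem_of_isAbsorbing hz))
    convert! h2 using 1
    module
  intro y hy
  have huy := h₁.right y hy
  rw [pairing_neg_left] at huy
  have hq := pairing_self_pos hu0
  obtain ⟨ε₁, hε₁, hmem₁⟩ := key σ₁ hσ₁ h₁ (toReal u) hq
  obtain ⟨ε₂, hε₂, hmem₂⟩ := key σ₂ hσ₂ h₂ (toReal u - y) (by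
    rw [sub_eq_add_neg, ← neg_one_smul ℝ y, pairing_add_right, pairing_smul_right]
    linarith)
  set ε := min ε₁ ε₂
  have hε : 0 < ε := lt_min hε₁ hε₂
  have hpσ₁ := (h₁.mem_iff p hup).mp hpσ
  have hpσ₂ := (h₂.mem_iff p hup).mp hpσ
  have hmem₁' := add_smul_mem_of_le hpσ₁ hmem₁ hε.le (min_le_left _ _)
  have hmem₂' := add_smul_mem_of_le hpσ₂ hmem₂ hε.le (min_le_right _ _)
  have hface := (Δ.inf_isFaceOf σ₁ (mem_cones_of_mem_maxCones hσ₁) σ₂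
    (mem_cones_of_mem_maxCones hσ₂)).1
  have heq : p + ε • -(toReal u - y) = (p + ε • -toReal u) + ε • y := by module
  have hyε := σ₁.smul_mem hε.le hy
  have h3 : ε • y ∈ σ₁ ⊓ σ₂ := by
    refine hface.mem_of_add_mem_right hmem₁' hyε ⟨σ₁.add_mem hmem₁' hyε, ?_⟩
    change _ ∈ σ₂
    rw [← heq]
    exact hmem₂'
  exact (σ₂.smul_mem_iff hε).mp h3.2

theorem IsComplete.eq_of_areAdjacent (hΔ : Δ.IsComplete) {σ σ₁ σ₂ : PointedCone ℝ (Fin n → ℝ)}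
    (hσ : σ ∈ Δ.maxCones) (hσ₁ : σ₁ ∈ Δ.maxCones) (hσ₂ : σ₂ ∈ Δ.maxCones) {u : Fin n → ℤ}
    (hu0 : u ≠ 0) (hwall : IsWall u σ) (h₁ : AreAdjacent u σ σ₁) (h₂ : AreAdjacent u σ σ₂) :
    σ₁ = σ₂ :=
  le_antisymm (hΔ.le_of_areAdjacent hσ hσ₁ hσ₂ hu0 hwall h₁ h₂)
    (hΔ.le_of_areAdjacent hσ hσ₂ hσ₁ hu0 hwall h₂ h₁)

end Fan

/-! ### Poles along hyperplanes -/

/-- The rational functions without a pole along the divisor of the prime `ℓ`. -/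
def regularAlong {ℓ : MvPolynomial (Fin n) ℤ} (hℓ : Prime ℓ) : AddSubgroup (RatFun n) where
  carrier := {x | ∃ a b : MvPolynomial (Fin n) ℤ, ¬ ℓ ∣ b ∧
    x * algebraMap _ (RatFun n) b = algebraMap _ (RatFun n) a}
  zero_mem' := ⟨0, 1, fun h => hℓ.not_isUnit (isUnit_of_dvd_one h), by simp⟩
  add_mem' := by
    rintro x y ⟨a, b, hb, hx⟩ ⟨c, d, hd, hy⟩
    refine ⟨a * d + c * b, b * d, fun h => (hℓ.dvd_or_dvd h).elim hb hd, ?_⟩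
    rw [map_mul, map_add, map_mul, map_mul, ← hx, ← hy]
    ring
  neg_mem' := by
    rintro x ⟨a, b, hb, hx⟩
    exact ⟨-a, b, hb, by rw [map_neg, ← hx, neg_mul]⟩

theorem mem_regularAlong {ℓ : MvPolynomial (Fin n) ℤ} (hℓ : Prime ℓ) {x : RatFun n} :
    x ∈ regularAlong hℓ ↔ ∃ a b : MvPolynomial (Fin n) ℤ, ¬ ℓ ∣ b ∧
      x * algebraMap _ (RatFun n) b = algebraMap _ (RatFun n) a := Iff.rfl

theorem mul_algebraMap_mem_regularAlong {ℓ : MvPolynomial (Fin n) ℤ} (hℓ : Prime ℓ) {x : RatFun n}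
    (hx : x ∈ regularAlong hℓ) (r : MvPolynomial (Fin n) ℤ) :
    x * algebraMap _ (RatFun n) r ∈ regularAlong hℓ := by
  obtain ⟨a, b, hb, h⟩ := hx
  exact ⟨a * r, b, hb, by rw [map_mul, ← h]; ring⟩

theorem regularAlong_linearForm_neg {u : Fin n → ℤ} (hu : IsPrimitiveVector u) :
    regularAlong (linearForm_prime hu.neg) = regularAlong (linearForm_prime hu) := by
  ext x
  simp only [mem_regularAlong, linearForm_neg, neg_dvd]

theorem algebraMap_ne_zero {p : MvPolynomial (Fin n) ℤ} (hp : p ≠ 0) :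
    algebraMap _ (RatFun n) p ≠ 0 := by
  rwa [Ne, FaithfulSMul.algebraMap_eq_zero_iff]

/-- A fraction whose denominator is a product of primes, without poles along any of these primes,
is a polynomial. -/
theorem exists_algebraMap_eq_of_regularAlong {x : RatFun n}
    (hreg : ∀ (u : Fin n → ℤ) (hu : IsPrimitiveVector u), x ∈ regularAlong (linearForm_prime hu))
    (s : List (Fin n → ℤ)) (hs : ∀ u ∈ s, IsPrimitiveVector u) (a : MvPolynomial (Fin n) ℤ)
    (ha : x * algebraMap (MvPolynomial (Fin n) ℤ) (RatFun n) (s.map linearForm).prod =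
      algebraMap _ (RatFun n) a) :
    ∃ p : MvPolynomial (Fin n) ℤ, x = algebraMap _ (RatFun n) p := by
  induction s generalizing a with
  | nil => exact ⟨a, by simpa using ha⟩
  | cons u s ih =>
    have hu := hs u (by simp)
    obtain ⟨c, d, hd, hx⟩ := hreg u hu
    have hinj := FaithfulSMul.algebraMap_injective (MvPolynomial (Fin n) ℤ) (RatFun n)
    rw [List.map_cons, List.prod_cons] at ha
    have h1 : a * d = linearForm u * ((s.map linearForm).prod * c) := by
      apply hinj
      rw [map_mul, map_mul, map_mul, ← ha, ← hx, map_mul]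
      ring
    have h2 := (linearForm_prime hu).dvd_or_dvd (Dvd.intro _ h1.symm)
    obtain ⟨a', rfl⟩ := h2.resolve_right hd
    refine ih (fun v hv => hs v (List.mem_cons_of_mem _ hv)) a' ?_
    apply mul_left_cancel₀ (algebraMap_ne_zero (linearForm_ne_zero hu.ne_zero))
    rw [← map_mul, ← ha, map_mul]
    ring

/-! ### Homogeneous fractions -/

/-- A quotient of homogeneous polynomials whose degrees differ by `d`. -/
def IsHomogeneousFraction (d : ℤ) (x : RatFun n) : Prop :=
  ∃ (a b : MvPolynomial (Fin n) ℤ) (i j : ℕ), a.IsHomogeneous i ∧ b.IsHomogeneous j ∧ b ≠ 0 ∧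
    (i : ℤ) = j + d ∧ x * algebraMap _ (RatFun n) b = algebraMap _ (RatFun n) a

/-- A negative degree requires a nonzero denominator of positive degree, which exists only if there
is a variable. -/
theorem IsHomogeneousFraction.zero {d : ℤ} (hd : n = 0 → 0 ≤ d) :
    IsHomogeneousFraction d (0 : RatFun n) := by
  rcases le_total 0 d with h | h
  · exact ⟨0, 1, d.toNat, 0, MvPolynomial.isHomogeneous_zero _ _ _,
      MvPolynomial.isHomogeneous_one _ _, one_ne_zero, by omega, by simp⟩
  by_cases hn : n = 0
  · exact ⟨0, 1, d.toNat, 0, MvPolynomial.isHomogeneous_zero _ _ _,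
      MvPolynomial.isHomogeneous_one _ _, one_ne_zero, by have := hd hn; omega, by simp⟩
  · let i : Fin n := ⟨0, Nat.pos_of_ne_zero hn⟩
    refine ⟨0, MvPolynomial.X i ^ (-d).toNat, d.toNat, (-d).toNat,
      MvPolynomial.isHomogeneous_zero _ _ _, ?_, pow_ne_zero _ (MvPolynomial.X_ne_zero i), by omega,
      by simp⟩
    simpa using (MvPolynomial.isHomogeneous_X ℤ i).pow (-d).toNat

theorem IsHomogeneousFraction.add {d : ℤ} {x y : RatFun n} (hx : IsHomogeneousFraction d x)
    (hy : IsHomogeneousFraction d y) : IsHomogeneousFraction d (x + y) := by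
  obtain ⟨a, b, i, j, ha, hb, hb0, hij, hx⟩ := hx
  obtain ⟨a', b', i', j', ha', hb', hb0', hij', hy⟩ := hy
  refine ⟨a * b' + a' * b, b * b', i + j', j + j', (ha.mul hb').add ?_, hb.mul hb',
    mul_ne_zero hb0 hb0', by push_cast; omega, ?_⟩
  · rw [show i + j' = i' + j by omega]
    exact ha'.mul hb
  · rw [map_mul, map_add, map_mul, map_mul, ← hx, ← hy]
    ring

theorem IsHomogeneousFraction.sum {ι : Type*} (s : Finset ι) {d : ℤ} (hd : n = 0 → 0 ≤ d)
    {x : ι → RatFun n}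
    (hx : ∀ i ∈ s, IsHomogeneousFraction d (x i)) : IsHomogeneousFraction d (∑ i ∈ s, x i) := by
  induction s using Finset.induction_on with
  | empty => exact IsHomogeneousFraction.zero hd
  | insert i s hi ih =>
    rw [Finset.sum_insert hi]
    exact (hx i (Finset.mem_insert_self _ _)).add
      (ih fun j hj => hx j (Finset.mem_insert_of_mem hj))

open MvPolynomial in
attribute [local instance] MvPolynomial.gradedAlgebra in
-- From `p b = a`, the component of `p` of degree `e.degree` times `b` is a component of `a`, which
-- is zero in every degree but `i`.
theorem IsHomogeneousFraction.degree_eq {d : ℤ} {p : MvPolynomial (Fin n) ℤ}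
    (hp : IsHomogeneousFraction d (algebraMap _ (RatFun n) p)) {e : Fin n →₀ ℕ}
    (he : e ∈ p.support) : (e.degree : ℤ) = d := by
  obtain ⟨a, b, i, j, ha, hb, hb0, hij, h⟩ := hp
  rw [← map_mul] at h
  have h : p * b = a := FaithfulSMul.algebraMap_injective (MvPolynomial (Fin n) ℤ) (RatFun n) h
  by_contra hcon
  have h1 := DirectSum.coe_decompose_mul_add_of_right_mem (homogeneousSubmodule (Fin n) ℤ)
    (i := e.degree) (a := p) (b := b) (j := j) hb
  rw [h, DirectSum.decompose_of_mem_ne _ (show a ∈ homogeneousSubmodule (Fin n) ℤ i from ha)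
    (by omega)] at h1
  have h2 : homogeneousComponent e.degree p = 0 := by
    rw [← decomposition.decompose'_apply]
    exact (mul_eq_zero.mp h1.symm).resolve_right hb0
  have h3 := congrArg (coeff e) h2
  rw [coeff_homogeneousComponent, if_pos rfl, coeff_zero] at h3
  exact mem_support_iff.mp he h3

/-! ### Leading forms of the denominators -/

theorem IsPrimitiveVector.eq_or_eq_neg {u w : Fin n → ℤ} (hu : u ≠ 0) (hw : IsPrimitiveVector w)
    (h : linearForm u ∣ linearForm w) : w = u ∨ w = -u := by
  obtain ⟨c, rfl⟩ := eq_smul_of_linearForm_dvd hu h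
  rcases Int.isUnit_iff.mp (hw c fun i => ⟨u i, rfl⟩) with rfl | rfl
  · simp
  · simp

theorem leadingForm_one : leadingForm (1 : MvPowerSeries (Fin n) ℤ) = 1 := by
  have h : leadingForm (1 : MvPowerSeries (Fin n) ℤ) ≠ 0 := leadingForm_ne_zero one_ne_zero
  have h1 := leadingForm_mul (1 : MvPowerSeries (Fin n) ℤ) 1
  rw [mul_one] at h1
  exact (mul_eq_left₀ h).mp h1.symm

theorem leadingForm_expand_prod (W : Finset (Fin n → ℤ)) (hW : ∀ w ∈ W, w ≠ 0) :
    leadingForm (expand n (∏ w ∈ W, (1 - character w))) = ∏ w ∈ W, -linearForm w := by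
  induction W using Finset.induction_on with
  | empty => simp [leadingForm_one]
  | insert w W hw ih =>
    rw [Finset.prod_insert hw, Finset.prod_insert hw, map_mul, leadingForm_mul,
      leadingForm_expand_one_sub_character (hW w (Finset.mem_insert_self _ _)),
      ih fun v hv => hW v (Finset.mem_insert_of_mem hv)]

theorem one_sub_character_ne_zero {u : Fin n → ℤ} (hu : u ≠ 0) :
    (1 - character u : Laurent n) ≠ 0 := fun h => by
  have := leadingForm_expand_one_sub_character hu
  rw [h, map_zero, leadingForm_zero] at this
  exact linearForm_ne_zero hu (neg_eq_zero.mp this.symm)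

theorem not_dvd_leadingForm_prod {u : Fin n → ℤ} (hu : IsPrimitiveVector u)
    (W : Finset (Fin n → ℤ)) (hW : ∀ w ∈ W, IsPrimitiveVector w) (huW : u ∉ W) (huW' : -u ∉ W) :
    ¬ linearForm u ∣ leadingForm (expand n (∏ w ∈ W, (1 - character w))) := by
  rw [leadingForm_expand_prod W fun w hw => (hW w hw).ne_zero,
    (linearForm_prime hu).dvd_finsetProd_iff]
  rintro ⟨w, hw, h⟩
  rcases (hW w hw).eq_or_eq_neg hu.ne_zero (dvd_neg.mp h) with rfl | rfl
  · exact huW hw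
  · exact huW' hw

/-! ### Polynomials vanishing on a hyperplane -/

theorem aeval_smul_of_isHomogeneous {A : Type*} [CommRing A] [Algebra ℤ A] {k : ℕ}
    {p : MvPolynomial (Fin n) ℤ}
    (hp : p.IsHomogeneous k) (c : A) (x : Fin n → A) :
    MvPolynomial.aeval (fun i => c * x i) p = c ^ k * MvPolynomial.aeval x p := by
  rw [MvPolynomial.aeval_def, MvPolynomial.aeval_def, MvPolynomial.eval₂_eq', MvPolynomial.eval₂_eq',
    Finset.mul_sum]
  refine Finset.sum_congr rfl fun d hd => ?_
  have hdeg : ∑ i, d i = k := by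
    have h := hp (MvPolynomial.mem_support_iff.mp hd)
    change Finsupp.weight (fun _ => 1) d = k at h
    rwa [← Finsupp.degree_eq_weight_one, Finsupp.degree_eq_sum] at h
  simp_rw [mul_pow]
  rw [Finset.prod_mul_distrib, Finset.prod_pow_eq_pow_sum, hdeg]
  ring

/-- A homogeneous polynomial vanishing on the hyperplane `u = 0` is divisible by the primitive
linear form `u`. -/
theorem linearForm_dvd_of_aeval_eq_zero {u : Fin n → ℤ} (hu : IsPrimitiveVector u) {k : ℕ}
    {p : MvPolynomial (Fin n) ℤ} (hp : p.IsHomogeneous k)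
    (h : ∀ z : Fin n → ℝ, pairing u z = 0 → MvPolynomial.aeval z p = 0) : linearForm u ∣ p := by
  obtain ⟨i, hi⟩ := Function.ne_iff.mp hu.ne_zero
  have hi : u i ≠ 0 := hi
  -- The substitution `θ` takes its values in the hyperplane `u = 0`, so `p(θ) = 0`. Modulo
  -- `linearForm u` it is multiplication by the constant `u i`, so `u i ^ k * p` is divisible by
  -- `linearForm u`.
  let θ : Fin n → MvPolynomial (Fin n) ℤ := fun j =>
    MvPolynomial.C (u i) * MvPolynomial.X j - if j = i then linearForm u else 0
  have h0 : MvPolynomial.aeval θ p = 0 := by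
    by_contra hne
    obtain ⟨y, hy⟩ := exists_aeval_ne_zero hne
    apply hy
    have hcomp : MvPolynomial.aeval y (MvPolynomial.aeval θ p) =
        MvPolynomial.aeval (fun j => MvPolynomial.aeval y (θ j)) p := by
      have : (MvPolynomial.aeval y).comp (MvPolynomial.aeval θ) =
          MvPolynomial.aeval (R := ℤ) (fun j => MvPolynomial.aeval y (θ j)) := by
        apply MvPolynomial.algHom_ext
        intro j
        simp
      exact DFunLike.congr_fun this p
    rw [hcomp]
    apply h
    have hl := aeval_linearForm u y
    have hθ : ∀ j, MvPolynomial.aeval y (θ j) =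
        (u i : ℝ) * y j - if j = i then ∑ l, (u l : ℝ) * y l else 0 := by
      intro j
      simp only [θ, map_sub, map_mul, MvPolynomial.aeval_X, MvPolynomial.aeval_C]
      split_ifs
      · rw [hl]; simp
      · simp
    simp only [pairing, hθ, mul_sub, Finset.sum_sub_distrib, mul_ite, mul_zero,
      Finset.sum_ite_eq', Finset.mem_univ, if_true, Finset.mul_sum]
    rw [sub_eq_zero]
    exact Finset.sum_congr rfl fun j _ => by ring
  let I := Ideal.span {linearForm u}
  have h1 : Ideal.Quotient.mk I (MvPolynomial.C (u i) ^ k * p) = 0 := by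
    have hmk : ∀ q : MvPolynomial (Fin n) ℤ, Ideal.Quotient.mk I q =
        MvPolynomial.aeval (fun j => Ideal.Quotient.mk I (MvPolynomial.X j)) q := fun q => by
      have : ((Ideal.Quotient.mkₐ ℤ I) : _ →ₐ[ℤ] _) =
          MvPolynomial.aeval (fun j => Ideal.Quotient.mk I (MvPolynomial.X j)) := by
        apply MvPolynomial.algHom_ext
        intro j
        simp
      exact DFunLike.congr_fun this q
    have h2 : Ideal.Quotient.mk I (MvPolynomial.aeval θ p) =
        MvPolynomial.aeval (fun j => Ideal.Quotient.mk I (θ j)) p := by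
      have : ((Ideal.Quotient.mkₐ ℤ I) : _ →ₐ[ℤ] _).comp (MvPolynomial.aeval θ) =
          MvPolynomial.aeval (fun j => Ideal.Quotient.mk I (θ j)) := by
        apply MvPolynomial.algHom_ext
        intro j
        simp
      exact DFunLike.congr_fun this p
    have h3 : ∀ j, Ideal.Quotient.mk I (θ j) =
        Ideal.Quotient.mk I (MvPolynomial.C (u i)) * Ideal.Quotient.mk I (MvPolynomial.X j) := by
      intro j
      have h4 : Ideal.Quotient.mk I (linearForm u) = 0 :=
        Ideal.Quotient.eq_zero_iff_mem.mpr (Ideal.subset_span rfl)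
      simp only [θ, map_sub, map_mul]
      split_ifs
      · rw [h4, sub_zero]
      · rw [map_zero, sub_zero]
    rw [h0, map_zero] at h2
    simp only [h3] at h2
    rw [aeval_smul_of_isHomogeneous hp, ← hmk] at h2
    rw [map_mul, map_pow]
    exact h2.symm
  rw [Ideal.Quotient.eq_zero_iff_mem, Ideal.mem_span_singleton] at h1
  -- A linear form cannot divide a nonzero constant, for degree reasons.
  refine ((linearForm_prime hu).dvd_or_dvd h1).resolve_left fun h2 => ?_
  have h3 := (linearForm_prime hu).dvd_of_dvd_pow h2
  obtain ⟨q, hq⟩ := h3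
  have hC : (MvPolynomial.C (u i) : MvPolynomial (Fin n) ℤ) ≠ 0 := by simpa using hi
  have hq0 : q ≠ 0 := by
    rintro rfl
    rw [mul_zero] at hq
    exact hC hq
  have hdeg := congrArg MvPolynomial.totalDegree hq
  rw [MvPolynomial.totalDegree_mul_of_isDomain (linearForm_ne_zero hu.ne_zero) hq0,
    (linearForm_isHomogeneous u).totalDegree (linearForm_ne_zero hu.ne_zero),
    MvPolynomial.totalDegree_C] at hdeg
  omega

theorem IsAbsorbing.eq_zero_of_neg_mem {σ : PointedCone ℝ (Fin n → ℝ)} {p : Fin n → ℝ}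
    (hp : IsAbsorbing σ p) {u : Fin n → ℤ} (hu : u ∈ dualLatticePoints σ)
    (hu' : -u ∈ dualLatticePoints σ) : u = 0 := by
  by_contra h0
  have h1 := hp.pairing_pos hu h0
  have h2 := hp.pairing_pos hu' (neg_ne_zero.mpr h0)
  rw [pairing_neg_left] at h2
  linarith

/-! ### Poles and degree of the equivariant multiplicity -/

/-- A full-dimensional strongly convex rational polyhedral cone, with a set of generators. -/
structure IsFullCone (G : Finset (Fin n → ℤ)) (σ : PointedCone ℝ (Fin n → ℝ)) : Prop where
  eq_latticeCone : σ = latticeCone G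
  salient : (σ : ConvexCone ℝ (Fin n → ℝ)).Salient
  exists_isAbsorbing : ∃ p, IsAbsorbing σ p

namespace IsFullCone

variable {G : Finset (Fin n → ℤ)} {σ : PointedCone ℝ (Fin n → ℝ)}

theorem dualLatticePoints_eq (hσ : IsFullCone G σ) : dualLatticePoints σ = latticeDual G := by
  rw [hσ.eq_latticeCone, dualLatticePoints_latticeCone]

theorem neg_notMem (hσ : IsFullCone G σ) {u : Fin n → ℤ} (hu0 : u ≠ 0)
    (hu : u ∈ dualLatticePoints σ) : -u ∉ dualLatticePoints σ := fun h => by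
  obtain ⟨p, hp⟩ := hσ.exists_isAbsorbing
  exact hu0 (hp.eq_zero_of_neg_mem hu h)

theorem exists_dotProduct_pos (hσ : IsFullCone G σ) {u : Fin n → ℤ} (hu0 : u ≠ 0)
    (hu : u ∈ latticeDual G) : ∃ v ∈ G, 0 < u ⬝ᵥ v := by
  by_contra! hcon
  rw [← SetLike.mem_coe, ← hσ.dualLatticePoints_eq] at hu
  refine hσ.neg_notMem hu0 hu ?_
  rw [hσ.dualLatticePoints_eq]
  intro v hv
  rw [neg_dotProduct]
  linarith [hcon v hv]

/-- The growth estimate is applied at an interior point chosen off the zeros of both leading forms.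
-/
theorem order_add (hσ : IsFullCone G σ) {g h : Laurent n} (hh : h ≠ 0)
    (H : MulSeriesEq (latticeDual G) h g) :
    g ≠ 0 ∧ (expand n g).order.toNat + n = (expand n h).order.toNat := by
  obtain ⟨p, hp⟩ := hσ.exists_isAbsorbing
  have hsal := hσ.salient
  rw [hσ.eq_latticeCone] at hsal
  obtain ⟨m₀, hm₀⟩ := exists_pos_functional hsal
  have hlh := leadingForm_ne_zero (expand_ne_zero hh)
  by_cases hg : g = 0
  · obtain ⟨v, hv, hne⟩ := hp.exists_isCoercive_aeval_ne_zero hlh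
    rw [hσ.dualLatticePoints_eq] at hv
    exact order_add_eq_order G hm₀ hv H hne (absurd hg)
  · obtain ⟨v, hv, hne⟩ := hp.exists_isCoercive_aeval_ne_zero
      (mul_ne_zero hlh (leadingForm_ne_zero (expand_ne_zero hg)))
    rw [hσ.dualLatticePoints_eq] at hv
    rw [map_mul] at hne
    exact order_add_eq_order G hm₀ hv H (left_ne_zero_of_mul hne)
      fun _ => right_ne_zero_of_mul hne

theorem equivMult_eq (hσ : IsFullCone G σ) {g h : Laurent n} (hh : h ≠ 0)
    (H : MulSeriesEq (latticeDual G) h g) :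
    equivMult σ = (-1) ^ n * (algebraMap (MvPolynomial (Fin n) ℤ) (RatFun n)
      (leadingForm (expand n g)) / algebraMap (MvPolynomial (Fin n) ℤ) (RatFun n)
        (leadingForm (expand n h))) := by
  rw [equivMult, principalPart_hilb hh (hσ.dualLatticePoints_eq ▸ H)]

theorem equivMult_mul (hσ : IsFullCone G σ) {g h : Laurent n} (hh : h ≠ 0)
    (H : MulSeriesEq (latticeDual G) h g) :
    equivMult σ * algebraMap (MvPolynomial (Fin n) ℤ) (RatFun n) (leadingForm (expand n h)) =
      algebraMap (MvPolynomial (Fin n) ℤ) (RatFun n) ((-1) ^ n * leadingForm (expand n g)) := by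
  have := algebraMap_ne_zero (leadingForm_ne_zero (expand_ne_zero hh))
  rw [hσ.equivMult_eq hh H, mul_assoc, div_mul_cancel₀ _ this]
  simp

theorem exists_generators (hσ : IsFullCone G σ) :
    ∃ W : Finset (Fin n → ℤ), AddSubmonoid.closure (W : Set (Fin n → ℤ)) = latticeDual G ∧
      ∀ w ∈ W, IsPrimitiveVector w := by
  refine exists_primitive_generators G fun u hu => ?_
  obtain ⟨p, hp⟩ := hσ.exists_isAbsorbing
  refine hp.eq_zero_of_neg_mem ?_ ?_ <;> rw [hσ.dualLatticePoints_eq] <;> intro v hv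
  · exact (hu v hv).ge
  · rw [neg_dotProduct, hu v hv, neg_zero]

theorem exists_series (hσ : IsFullCone G σ) :
    ∃ (W : Finset (Fin n → ℤ)) (g : Laurent n), (∀ w ∈ W, IsPrimitiveVector w) ∧
      (∀ w ∈ W, w ∈ latticeDual G) ∧ MulSeriesEq (latticeDual G) (∏ w ∈ W, (1 - character w)) g := by
  obtain ⟨W, hW, hprim⟩ := hσ.exists_generators
  obtain ⟨g, hg⟩ := exists_laurent_of_finite_support (finite_support_seriesAction_prod G W hW)
  exact ⟨W, g, hprim, fun w hw => hW ▸ AddSubmonoid.subset_closure (Finset.mem_coe.mpr hw),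
    (mulSeriesEq_iff _ _ _).mpr hg.symm⟩

theorem prod_one_sub_character_ne_zero {W : Finset (Fin n → ℤ)}
    (hW : ∀ w ∈ W, IsPrimitiveVector w) : (∏ w ∈ W, (1 - character w) : Laurent n) ≠ 0 :=
  Finset.prod_ne_zero_iff.mpr fun w hw => one_sub_character_ne_zero (hW w hw).ne_zero

/-- Distinct primitive generators are not proportional, since `-u` is not in the dual of a
full-dimensional cone. So `1 - x^u` is the only factor contributing a pole along `u = 0`; it is put
in by hand if `u` is not a generator. -/
theorem exists_series_of_mem (hσ : IsFullCone G σ) {u : Fin n → ℤ} (hu : IsPrimitiveVector u)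
    (huσ : u ∈ dualLatticePoints σ) :
    ∃ g h : Laurent n, h ≠ 0 ∧ ¬ linearForm u ∣ leadingForm (expand n h) ∧
      MulSeriesEq (latticeDual G) ((1 - character u) * h) g := by
  obtain ⟨W, g, hprim, hWG, H⟩ := hσ.exists_series
  have hprim' : ∀ w ∈ W.erase u, IsPrimitiveVector w := fun w hw =>
    hprim w (Finset.mem_of_mem_erase hw)
  have hnot : -u ∉ W.erase u := fun h => hσ.neg_notMem hu.ne_zero huσ (by
    rw [hσ.dualLatticePoints_eq]
    exact hWG _ (Finset.mem_of_mem_erase h))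
  have hdvd := not_dvd_leadingForm_prod hu (W.erase u) hprim' (Finset.notMem_erase u W) hnot
  by_cases huW : u ∈ W
  · refine ⟨g, _, prod_one_sub_character_ne_zero hprim', hdvd, ?_⟩
    rwa [Finset.mul_prod_erase W (fun w => (1 - character w : Laurent n)) huW]
  · refine ⟨(1 - character u) * g, _, prod_one_sub_character_ne_zero hprim', hdvd, ?_⟩
    rw [Finset.erase_eq_of_notMem huW]
    exact H.mul_left _

theorem mem_regularAlong_of_not_dvd (hσ : IsFullCone G σ) {u : Fin n → ℤ}
    (hu : IsPrimitiveVector u) {g h : Laurent n} (hh : h ≠ 0)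
    (H : MulSeriesEq (latticeDual G) h g) (hdvd : ¬ linearForm u ∣ leadingForm (expand n h)) :
    equivMult σ ∈ regularAlong (linearForm_prime hu) :=
  ⟨_, _, hdvd, hσ.equivMult_mul hh H⟩

theorem mem_regularAlong_of_mem_of_not_isWall (hσ : IsFullCone G σ) {u : Fin n → ℤ}
    (hu : IsPrimitiveVector u) (huσ : u ∈ dualLatticePoints σ) (hwall : ¬ IsWall u σ) :
    equivMult σ ∈ regularAlong (linearForm_prime hu) := by
  obtain ⟨g, h, hh, hdvd, H⟩ := hσ.exists_series_of_mem hu huσ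
  rw [IsWall] at hwall
  push Not at hwall
  obtain ⟨w, hw, hne⟩ := hwall
  rw [hσ.dualLatticePoints_eq] at huσ
  obtain ⟨q, hq⟩ := exists_mulSeriesEq_of_two_directions G (w := w) huσ
    (hσ.exists_dotProduct_pos hu.ne_zero huσ) (fun v hv huv => by
      have := hw (toReal v) (hσ.eq_latticeCone ▸ toReal_mem_latticeCone hv)
        (by rw [pairing_toReal, huv, Int.cast_zero])
      rw [pairing_toReal] at this
      exact_mod_cast this) H
  have hw0 : w ≠ 0 := by
    rintro rfl
    exact hne 0 (by simp)
  refine hσ.mem_regularAlong_of_not_dvd hu (mul_ne_zero (one_sub_character_ne_zero hw0) hh) hq ?_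
  rw [map_mul, leadingForm_mul, leadingForm_expand_one_sub_character hw0]
  intro hd
  rcases (linearForm_prime hu).dvd_or_dvd hd with h1 | h1
  · obtain ⟨c, hc⟩ := eq_smul_of_linearForm_dvd hu.ne_zero (dvd_neg.mp h1)
    exact hne c hc
  · exact hdvd h1

theorem mem_regularAlong_of_notMem (hσ : IsFullCone G σ) {u : Fin n → ℤ}
    (hu : IsPrimitiveVector u) (h1 : u ∉ dualLatticePoints σ) (h2 : -u ∉ dualLatticePoints σ) :
    equivMult σ ∈ regularAlong (linearForm_prime hu) := by
  obtain ⟨W, g, hprim, hWG, H⟩ := hσ.exists_series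
  rw [hσ.dualLatticePoints_eq] at h1 h2
  exact hσ.mem_regularAlong_of_not_dvd hu (prod_one_sub_character_ne_zero hprim) H
    (not_dvd_leadingForm_prod hu W hprim (fun h => h1 (hWG _ h)) fun h => h2 (hWG _ h))

theorem mem_regularAlong_of_not_isWall (hσ : IsFullCone G σ) {u : Fin n → ℤ}
    (hu : IsPrimitiveVector u)
    (h : ¬ (IsWall u σ ∧ (u ∈ dualLatticePoints σ ∨ -u ∈ dualLatticePoints σ))) :
    equivMult σ ∈ regularAlong (linearForm_prime hu) := by
  by_cases h1 : u ∈ dualLatticePoints σ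
  · exact hσ.mem_regularAlong_of_mem_of_not_isWall hu h1 fun hw => h ⟨hw, Or.inl h1⟩
  by_cases h2 : -u ∈ dualLatticePoints σ
  · rw [← regularAlong_linearForm_neg hu]
    refine hσ.mem_regularAlong_of_mem_of_not_isWall hu.neg h2 fun hw => h ⟨?_, Or.inr h2⟩
    simpa using hw.neg
  · exact hσ.mem_regularAlong_of_notMem hu h1 h2

theorem equivMult_mul_linearForm_mem (hσ : IsFullCone G σ) {u : Fin n → ℤ}
    (hu : IsPrimitiveVector u) (huσ : u ∈ dualLatticePoints σ) :
    equivMult σ * algebraMap _ (RatFun n) (linearForm u) ∈ regularAlong (linearForm_prime hu) := by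
  obtain ⟨g, h, hh, hdvd, H⟩ := hσ.exists_series_of_mem hu huσ
  have h1 := hσ.equivMult_mul (mul_ne_zero (one_sub_character_ne_zero hu.ne_zero) hh) H
  rw [map_mul, leadingForm_mul, leadingForm_expand_one_sub_character hu.ne_zero, map_mul,
    map_neg] at h1
  refine ⟨-((-1) ^ n * leadingForm (expand n g)), _, hdvd, ?_⟩
  rw [map_neg, ← h1]
  ring

/-- This describes the dual of the face `u = 0` without reference to generators, so that it can be
compared for two cones sharing this face. -/
theorem latticeDual_filter_eq (hσ : IsFullCone G σ) {u : Fin n → ℤ} (hu : u ∈ latticeDual G)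
    (m : Fin n → ℤ) : m ∈ latticeDual (G.filter fun v => u ⬝ᵥ v = 0) ↔
      ∀ x ∈ σ, pairing u x = 0 → 0 ≤ pairing m x := by
  constructor
  · intro hm x hx hux
    rw [hσ.eq_latticeCone] at hx
    obtain ⟨c, hc, rfl⟩ := mem_latticeCone_iff.mp hx
    rw [pairing_sum_right] at hux ⊢
    have h1 := (Finset.sum_eq_zero_iff_of_nonneg (fun v hv => by
      rw [pairing_smul_right, pairing_toReal]
      exact mul_nonneg (hc v) (by exact_mod_cast hu v hv))).mp hux
    refine Finset.sum_nonneg fun v hv => ?_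
    have h2 := h1 v hv
    rw [pairing_smul_right, pairing_toReal] at h2 ⊢
    rcases mul_eq_zero.mp h2 with h | h
    · rw [h, zero_mul]
    · exact mul_nonneg (hc v) (by
        exact_mod_cast hm v (Finset.mem_filter.mpr ⟨hv, by exact_mod_cast h⟩))
  · intro h v hv
    obtain ⟨hv, huv⟩ := Finset.mem_filter.mp hv
    have := h (toReal v) (hσ.eq_latticeCone ▸ toReal_mem_latticeCone hv)
      (by rw [pairing_toReal, huv, Int.cast_zero])
    rw [pairing_toReal] at this
    exact_mod_cast this

/-- Leading forms are not additive, but by `order_add` the two terms of `g h' + g' h` have the same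
order `D`. The sum of their leading forms is thus the part of degree `D` of `(1 - x^u) q`, which is
divisible by `linearForm u` even if leading terms cancel. -/
theorem equivMult_add_mem {G' : Finset (Fin n → ℤ)} {σ' : PointedCone ℝ (Fin n → ℝ)}
    (hσ : IsFullCone G σ) (hσ' : IsFullCone G' σ') {u : Fin n → ℤ} (hu : IsPrimitiveVector u)
    (hadj : AreAdjacent u σ σ') :
    equivMult σ + equivMult σ' ∈ regularAlong (linearForm_prime hu) := by
  obtain ⟨g, h, hh, hdvd, H⟩ := hσ.exists_series_of_mem hu hadj.left
  obtain ⟨g₁, h', hh', hdvd', H₁⟩ := hσ'.exists_series_of_mem hu.neg hadj.right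
  rw [linearForm_neg, neg_dvd] at hdvd'
  -- The denominator factor `1 - x^(-u)` of the second cone becomes `1 - x^u` after multiplication
  -- by a unit.
  have H' := H₁.mul_left (-character u)
  rw [← mul_assoc, ← one_sub_character_eq_neg] at H'
  generalize -character u * g₁ = g' at H'
  have huG : u ∈ latticeDual G := by
    have := hadj.left
    rwa [hσ.dualLatticePoints_eq] at this
  have huG' : -u ∈ latticeDual G' := by
    have := hadj.right
    rwa [hσ'.dualLatticePoints_eq] at this
  have hu0 := hu.ne_zero
  obtain ⟨q, hq⟩ := exists_dvd_of_adjacent G G' huG huG' (hσ.exists_dotProduct_pos hu0 huG)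
    (hσ'.exists_dotProduct_pos (neg_ne_zero.mpr hu0) huG') (by
      ext m
      rw [hσ.latticeDual_filter_eq huG, hσ'.latticeDual_filter_eq huG']
      simp only [pairing_neg_left, neg_eq_zero]
      exact ⟨fun hm x hx hux => hm x ((hadj.mem_iff x hux).mpr hx) hux,
        fun hm x hx hux => hm x ((hadj.mem_iff x hux).mp hx) hux⟩) H H'
  have hd0 := one_sub_character_ne_zero hu0
  obtain ⟨hg0, hord⟩ := hσ.order_add (mul_ne_zero hd0 hh) H
  obtain ⟨hg0', hord'⟩ := hσ'.order_add (mul_ne_zero hd0 hh') H'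
  rw [map_mul, toNat_order_mul (expand_ne_zero hd0) (expand_ne_zero hh),
    toNat_order_expand_one_sub_character hu0] at hord
  rw [map_mul, toNat_order_mul (expand_ne_zero hd0) (expand_ne_zero hh'),
    toNat_order_expand_one_sub_character hu0] at hord'
  set D := (expand n (g * h')).order.toNat with hD
  have hD' : (expand n (g' * h)).order.toNat = D := by
    rw [hD, map_mul, map_mul, toNat_order_mul (expand_ne_zero hg0') (expand_ne_zero hh),
      toNat_order_mul (expand_ne_zero hg0) (expand_ne_zero hh')]
    omega
  have hle : (D : ℕ∞) ≤ (expand n (g * h')).order :=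
    (coe_toNat_order (expand_ne_zero (mul_ne_zero hg0 hh'))).le
  have hle' : (D : ℕ∞) ≤ (expand n (g' * h)).order := by
    rw [← hD']
    exact (coe_toNat_order (expand_ne_zero (mul_ne_zero hg0' hh))).le
  have hsum : leadingForm (expand n g) * leadingForm (expand n h') +
      leadingForm (expand n g') * leadingForm (expand n h) =
      homogeneousPart D (expand n (1 - character u) * expand n q) := by
    rw [← map_mul, ← hq, map_add, homogeneousPart_add, ← leadingForm_mul, ← leadingForm_mul,
      ← map_mul, ← map_mul, leadingForm_eq_homogeneousPart, leadingForm_eq_homogeneousPart, hD']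
  obtain ⟨r, hr⟩ := leadingForm_dvd_homogeneousPart_mul (D := D)
    (φ := expand n (1 - character u)) (ψ := expand n q) (by
      rw [← map_mul, ← hq, map_add]
      exact (le_min hle hle').trans MvPowerSeries.min_order_le_add)
  rw [hr, leadingForm_expand_one_sub_character hu0] at hsum
  have h1 := hσ.equivMult_mul (mul_ne_zero hd0 hh) H
  have h1' := hσ'.equivMult_mul (mul_ne_zero hd0 hh') H'
  rw [map_mul, leadingForm_mul, leadingForm_expand_one_sub_character hu0] at h1 h1'
  refine ⟨(-1) ^ n * r, leadingForm (expand n h) * leadingForm (expand n h'),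
    fun h => ((linearForm_prime hu).dvd_or_dvd h).elim hdvd hdvd', ?_⟩
  apply mul_left_cancel₀ (algebraMap_ne_zero (neg_ne_zero.mpr (linearForm_ne_zero hu0)))
  have hsum' := congrArg (fun x => algebraMap _ (RatFun n) ((-1) ^ n * x)) hsum
  simp only [map_mul, map_add, map_neg, map_pow, map_one] at hsum' h1 h1' ⊢
  linear_combination hsum' + algebraMap _ (RatFun n) (leadingForm (expand n h')) * h1 +
    algebraMap _ (RatFun n) (leadingForm (expand n h)) * h1'

theorem isHomogeneousFraction_equivMult_mul (hσ : IsFullCone G σ) {k : ℕ}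
    {f : MvPolynomial (Fin n) ℤ} (hf : f.IsHomogeneous k) :
    IsHomogeneousFraction ((k : ℤ) - n) (equivMult σ * algebraMap _ (RatFun n) f) := by
  obtain ⟨W, g, hprim, hWG, H⟩ := hσ.exists_series
  have hh := prod_one_sub_character_ne_zero hprim
  obtain ⟨hg0, hord⟩ := hσ.order_add hh H
  refine ⟨(-1) ^ n * leadingForm (expand n g) * f, _, 0 + (expand n g).order.toNat + k, _,
    (MvPolynomial.IsHomogeneous.mul ?_ (leadingForm_isHomogeneous _)).mul hf,
    leadingForm_isHomogeneous _, leadingForm_ne_zero (expand_ne_zero hh), by push_cast; omega, ?_⟩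
  · simpa using ((MvPolynomial.isHomogeneous_one (Fin n) ℤ).neg).pow n
  · rw [map_mul, ← hσ.equivMult_mul hh H]
    ring

theorem exists_denominator (hσ : IsFullCone G σ) :
    ∃ (s : List (Fin n → ℤ)) (a : MvPolynomial (Fin n) ℤ), (∀ u ∈ s, IsPrimitiveVector u) ∧
      equivMult σ * algebraMap (MvPolynomial (Fin n) ℤ) (RatFun n) (s.map linearForm).prod =
        algebraMap _ (RatFun n) a := by
  obtain ⟨W, g, hprim, hWG, H⟩ := hσ.exists_series
  have h1 := hσ.equivMult_mul (prod_one_sub_character_ne_zero hprim) H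
  rw [leadingForm_expand_prod W fun w hw => (hprim w hw).ne_zero, Finset.prod_neg] at h1
  refine ⟨W.toList, (-1) ^ W.card * ((-1) ^ n * leadingForm (expand n g)), by simpa using hprim, ?_⟩
  rw [Finset.prod_map_toList, map_mul, ← h1, map_mul]
  have : (algebraMap (MvPolynomial (Fin n) ℤ) (RatFun n) ((-1) ^ W.card)) *
      algebraMap (MvPolynomial (Fin n) ℤ) (RatFun n) ((-1) ^ W.card) = 1 := by
    rw [← map_mul, ← mul_pow]
    simp
  linear_combination (-(equivMult σ * algebraMap (MvPolynomial (Fin n) ℤ) (RatFun n)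
    (∏ w ∈ W, linearForm w))) * this

end IsFullCone

theorem Fan.IsComplete.exists_isFullCone {Δ : Fan n} (hΔ : Δ.IsComplete)
    {σ : PointedCone ℝ (Fin n → ℝ)} (hσ : σ ∈ Δ.maxCones) : ∃ G, IsFullCone G σ := by
  have hσ' := Fan.mem_cones_of_mem_maxCones hσ
  obtain ⟨G, hG⟩ := Fan.exists_generators hσ'
  exact ⟨G, hG, Δ.salient σ hσ', hΔ.exists_isAbsorbing hσ⟩

/-! ### Cancellation of the poles in the sum -/

namespace PiecewisePolynomial

variable {Δ : Fan n} {k : ℕ}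

theorem aeval_restr_eq (hΔ : Δ.IsComplete) (f : PiecewisePolynomial Δ k) (σ σ' : Δ.maxCones)
    {x : Fin n → ℝ} (hx : x ∈ (σ : PointedCone ℝ (Fin n → ℝ)))
    (hx' : x ∈ (σ' : PointedCone ℝ (Fin n → ℝ))) :
    MvPolynomial.aeval x (f.restr σ) = MvPolynomial.aeval x (f.restr σ') := by
  have hmem : x ∈ Δ.support := by rw [hΔ]; trivial
  rw [← f.toFun_eq σ ⟨x, hmem⟩ hx, f.toFun_eq σ' ⟨x, hmem⟩ hx']

/-- The two polynomials agree on the wall. On the line from a relatively interior point of the wall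
to any point of the hyperplane `u = 0`, their difference has infinitely many zeros, so it vanishes
on the whole hyperplane. -/
theorem linearForm_dvd_restr_sub (hΔ : Δ.IsComplete) (f : PiecewisePolynomial Δ k)
    (σ σ' : Δ.maxCones) {u : Fin n → ℤ} (hu : IsPrimitiveVector u)
    (hwall : IsWall u (σ : PointedCone ℝ (Fin n → ℝ)))
    (hadj : AreAdjacent u (σ : PointedCone ℝ (Fin n → ℝ)) σ') :
    linearForm u ∣ f.restr σ - f.restr σ' := by
  refine linearForm_dvd_of_aeval_eq_zero hu
    ((f.restr_homogeneous σ).sub (f.restr_homogeneous σ')) fun z hz => ?_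
  obtain ⟨G, hG⟩ := hΔ.exists_isFullCone σ.2
  obtain ⟨p, hpσ, hup, hp⟩ := exists_mem_relative_interior hu.ne_zero (hG.eq_latticeCone ▸ hwall)
    (by have := hadj.left; rwa [hG.dualLatticePoints_eq] at this)
  rw [← hG.eq_latticeCone] at hpσ hp
  have huq : pairing u (z - p) = 0 := by
    rw [sub_eq_add_neg, ← neg_one_smul ℝ p, pairing_add_right, pairing_smul_right, hup, hz]
    ring
  obtain ⟨δ, hδ, hmem⟩ := hp (z - p) huq
  have hzero : restrictLine p (z - p) (f.restr σ - f.restr σ') = 0 := by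
    refine Polynomial.eq_zero_of_infinite_isRoot _ ((Set.Ioo_infinite hδ).mono fun t ht => ?_)
    have h1 := add_smul_mem_of_le hpσ hmem ht.1.le ht.2.le
    have h2 := (hadj.mem_iff _ (by
      rw [pairing_add_right, hup, pairing_smul_right, huq, mul_zero, zero_add])).mp h1
    change Polynomial.eval t _ = 0
    rw [eval_restrictLine, map_sub, f.aeval_restr_eq hΔ σ σ' h1 h2, sub_self]
  have h1 := eval_restrictLine p (z - p) (f.restr σ - f.restr σ') 1
  rw [hzero, Polynomial.eval_zero, one_smul, add_sub_cancel] at h1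
  exact h1.symm

/-- The contributions of two adjacent cones to the sum `∑_σ e_σ f_σ` have opposite polar parts
along the wall between them. -/
theorem add_mem_regularAlong (hΔ : Δ.IsComplete) (f : PiecewisePolynomial Δ k)
    (σ σ' : Δ.maxCones) {u : Fin n → ℤ} (hu : IsPrimitiveVector u)
    (hwall : IsWall u (σ : PointedCone ℝ (Fin n → ℝ)))
    (hadj : AreAdjacent u (σ : PointedCone ℝ (Fin n → ℝ)) σ') :
    equivMult (σ : PointedCone ℝ (Fin n → ℝ)) * algebraMap _ (RatFun n) (f.restr σ) +
      equivMult (σ' : PointedCone ℝ (Fin n → ℝ)) * algebraMap _ (RatFun n) (f.restr σ') ∈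
      regularAlong (linearForm_prime hu) := by
  obtain ⟨G, hG⟩ := hΔ.exists_isFullCone σ.2
  obtain ⟨G', hG'⟩ := hΔ.exists_isFullCone σ'.2
  obtain ⟨r, hr⟩ := f.linearForm_dvd_restr_sub hΔ σ σ' hu hwall hadj
  -- With `f_σ - f_σ' = u r`, the sum is `(e_σ + e_σ') f_σ' + (e_σ u) r`, and both terms are
  -- regular.
  have h1 := mul_algebraMap_mem_regularAlong _ (hG.equivMult_add_mem hG' hu hadj) (f.restr σ')
  have h2 := mul_algebraMap_mem_regularAlong _ (hG.equivMult_mul_linearForm_mem hu hadj.left) r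
  convert! (regularAlong (linearForm_prime hu)).add_mem h1 h2 using 1
  rw [mul_assoc, ← map_mul, ← hr, map_sub]
  ring

/-- The cones having a wall on the hyperplane `u = 0` come in adjacent pairs. -/
theorem exists_unique_partner (hΔ : Δ.IsComplete) {u : Fin n → ℤ} (hu : IsPrimitiveVector u)
    (σ : Δ.maxCones) (hwall : IsWall u (σ : PointedCone ℝ (Fin n → ℝ)))
    (hσ : u ∈ dualLatticePoints (σ : PointedCone ℝ (Fin n → ℝ))) :
    ∃ σ' : Δ.maxCones, AreAdjacent u (σ : PointedCone ℝ (Fin n → ℝ)) σ' ∧ σ' ≠ σ ∧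
      ∀ τ : Δ.maxCones, AreAdjacent u (σ' : PointedCone ℝ (Fin n → ℝ)) τ ∨
        AreAdjacent (-u) (σ' : PointedCone ℝ (Fin n → ℝ)) τ → τ = σ := by
  obtain ⟨σ', hσ', hadj⟩ := hΔ.exists_areAdjacent σ.2 hu.ne_zero hσ hwall
  obtain ⟨G, hG⟩ := hΔ.exists_isFullCone σ.2
  obtain ⟨G', hG'⟩ := hΔ.exists_isFullCone hσ'
  refine ⟨⟨σ', hσ'⟩, hadj, ?_, ?_⟩
  · rintro rfl
    exact hG.neg_notMem hu.ne_zero hσ hadj.right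
  · rintro τ (h | h)
    -- Since `-u` is nonnegative on `σ'`, adjacency from the positive side is impossible; the other
    -- case is uniqueness of the neighbour across the wall.
    · exact absurd hadj.right (hG'.neg_notMem hu.ne_zero h.left)
    · exact Subtype.ext (hΔ.eq_of_areAdjacent hσ' τ.2 σ.2 (neg_ne_zero.mpr hu.ne_zero)
        (hadj.isWall hwall).neg h hadj.symm)

theorem exists_partner (hΔ : Δ.IsComplete) {u : Fin n → ℤ} (hu : IsPrimitiveVector u)
    (σ : Δ.maxCones) (hwall : IsWall u (σ : PointedCone ℝ (Fin n → ℝ)))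
    (hσ : u ∈ dualLatticePoints (σ : PointedCone ℝ (Fin n → ℝ)) ∨
      -u ∈ dualLatticePoints (σ : PointedCone ℝ (Fin n → ℝ))) :
    ∃ σ' : Δ.maxCones, (AreAdjacent u (σ : PointedCone ℝ (Fin n → ℝ)) σ' ∨
        AreAdjacent (-u) (σ : PointedCone ℝ (Fin n → ℝ)) σ') ∧ σ' ≠ σ ∧
      ∀ τ : Δ.maxCones, AreAdjacent u (σ' : PointedCone ℝ (Fin n → ℝ)) τ ∨
        AreAdjacent (-u) (σ' : PointedCone ℝ (Fin n → ℝ)) τ → τ = σ := by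
  rcases hσ with h | h
  · obtain ⟨σ', h1, h2, h3⟩ := exists_unique_partner hΔ hu σ hwall h
    exact ⟨σ', Or.inl h1, h2, h3⟩
  · obtain ⟨σ', h1, h2, h3⟩ := exists_unique_partner hΔ hu.neg σ hwall.neg h
    refine ⟨σ', Or.inr h1, h2, fun τ hτ => h3 τ ?_⟩
    rw [neg_neg]
    exact hτ.symm

/-- Modulo functions regular along `u = 0`, only cones with a wall on this hyperplane contribute.
Passing to the neighbour across the wall is an involution without fixed points on these cones, and
paired contributions cancel. -/
theorem pushforward_mem_regularAlong (hΔ : Δ.IsComplete) (f : PiecewisePolynomial Δ k)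
    {u : Fin n → ℤ} (hu : IsPrimitiveVector u) :
    pushforward Δ f ∈ regularAlong (linearForm_prime hu) := by
  set O := regularAlong (linearForm_prime hu)
  let t : Δ.maxCones → RatFun n := fun σ =>
    equivMult (σ : PointedCone ℝ (Fin n → ℝ)) * algebraMap _ (RatFun n) (f.restr σ)
  let bad : Finset Δ.maxCones := Finset.univ.filter fun σ =>
    IsWall u (σ : PointedCone ℝ (Fin n → ℝ)) ∧
      (u ∈ dualLatticePoints (σ : PointedCone ℝ (Fin n → ℝ)) ∨
        -u ∈ dualLatticePoints (σ : PointedCone ℝ (Fin n → ℝ)))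
  have hbad : ∀ σ, σ ∈ bad ↔ IsWall u (σ : PointedCone ℝ (Fin n → ℝ)) ∧
      (u ∈ dualLatticePoints (σ : PointedCone ℝ (Fin n → ℝ)) ∨
        -u ∈ dualLatticePoints (σ : PointedCone ℝ (Fin n → ℝ))) := fun σ => by simp [bad]
  have hgood : ∑ σ ∈ Finset.univ.filter (fun σ => σ ∉ bad), t σ ∈ O := by
    refine sum_mem fun σ hσ => ?_
    obtain ⟨G, hG⟩ := hΔ.exists_isFullCone σ.2
    refine mul_algebraMap_mem_regularAlong _ (hG.mem_regularAlong_of_not_isWall hu fun h => ?_) _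
    exact (Finset.mem_filter.mp hσ).2 ((hbad σ).mpr h)
  have hpair : ∀ σ ∈ bad, ∃ σ' : Δ.maxCones, (AreAdjacent u (σ : PointedCone ℝ (Fin n → ℝ)) σ' ∨
        AreAdjacent (-u) (σ : PointedCone ℝ (Fin n → ℝ)) σ') ∧ σ' ≠ σ ∧
      ∀ τ : Δ.maxCones, AreAdjacent u (σ' : PointedCone ℝ (Fin n → ℝ)) τ ∨
        AreAdjacent (-u) (σ' : PointedCone ℝ (Fin n → ℝ)) τ → τ = σ := fun σ hσ =>
    exists_partner hΔ hu σ ((hbad σ).mp hσ).1 ((hbad σ).mp hσ).2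
  choose partner hadj hne huniq using hpair
  have hmem : ∀ σ (hσ : σ ∈ bad), partner σ hσ ∈ bad := by
    intro σ hσ
    obtain ⟨hwall, -⟩ := (hbad σ).mp hσ
    rw [hbad]
    rcases hadj σ hσ with h | h
    · exact ⟨h.isWall hwall, Or.inr h.right⟩
    · refine ⟨?_, Or.inl ?_⟩
      · simpa using (h.isWall hwall.neg).neg
      · simpa using h.right
  have hsum : ∑ σ ∈ bad, (QuotientAddGroup.mk (t σ) : RatFun n ⧸ O) = 0 := by
    refine Finset.sum_involution partner (fun σ hσ => ?_) (fun σ hσ _ => hne σ hσ) hmem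
      fun σ hσ => huniq σ hσ _ (hadj _ (hmem σ hσ))
    rw [← QuotientAddGroup.mk_add, QuotientAddGroup.eq_zero_iff]
    obtain ⟨hwall, -⟩ := (hbad σ).mp hσ
    rcases hadj σ hσ with h | h
    · exact f.add_mem_regularAlong hΔ σ _ hu hwall h
    · have := f.add_mem_regularAlong hΔ σ _ hu.neg hwall.neg h
      rwa [regularAlong_linearForm_neg hu] at this
  have hbadsum : ∑ σ ∈ bad, t σ ∈ O := by
    rw [← QuotientAddGroup.eq_zero_iff, ← hsum]
    exact map_sum (QuotientAddGroup.mk' O) t bad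
  have : pushforward Δ f = ∑ σ ∈ bad, t σ + ∑ σ ∈ Finset.univ.filter (fun σ => σ ∉ bad), t σ := by
    rw [pushforward, ← Finset.sum_filter_add_sum_filter_not Finset.univ (fun σ => σ ∈ bad)]
    congr 1
    refine Finset.sum_congr ?_ fun _ _ => rfl
    ext σ
    simp
  rw [this]
  exact O.add_mem hbadsum hgood

theorem exists_denominator_pushforward (hΔ : Δ.IsComplete) (f : PiecewisePolynomial Δ k) :
    ∃ (s : List (Fin n → ℤ)) (a : MvPolynomial (Fin n) ℤ), (∀ u ∈ s, IsPrimitiveVector u) ∧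
      pushforward Δ f * algebraMap (MvPolynomial (Fin n) ℤ) (RatFun n) (s.map linearForm).prod =
        algebraMap _ (RatFun n) a := by
  rw [pushforward]
  generalize (Finset.univ : Finset Δ.maxCones) = T
  induction T using Finset.induction_on with
  | empty => exact ⟨[], 0, by simp, by simp⟩
  | insert σ T hσ ih =>
    obtain ⟨s, a, hs, hsa⟩ := ih
    obtain ⟨G, hG⟩ := hΔ.exists_isFullCone σ.2
    obtain ⟨s', a', hs', hsa'⟩ := hG.exists_denominator
    refine ⟨s' ++ s, a' * f.restr σ * (s.map linearForm).prod + a * (s'.map linearForm).prod,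
      fun u hu => (List.mem_append.mp hu).elim (hs' u) (hs u), ?_⟩
    rw [Finset.sum_insert hσ, List.map_append, List.prod_append]
    simp only [map_mul, map_add]
    rw [← hsa, ← hsa']
    ring

theorem isHomogeneousFraction_pushforward (hΔ : Δ.IsComplete) (f : PiecewisePolynomial Δ k) :
    IsHomogeneousFraction ((k : ℤ) - n) (pushforward Δ f) :=
  IsHomogeneousFraction.sum _ (fun hn => by omega) fun σ _ => by
    obtain ⟨G, hG⟩ := hΔ.exists_isFullCone σ.2
    exact hG.isHomogeneousFraction_equivMult_mul (f.restr_homogeneous σ)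

end PiecewisePolynomial

end ToricFan

theorem proposition1p1 (n k : ℕ) (Δ : ToricFan.Fan n) (hΔ : Δ.IsComplete)
    (f : ToricFan.PiecewisePolynomial Δ k) :
    (∃ p : MvPolynomial (Fin n) ℤ,
      (∀ d ∈ p.support, (d.degree : ℤ) = (k : ℤ) - (n : ℤ)) ∧
      ToricFan.pushforward Δ f = algebraMap (MvPolynomial (Fin n) ℤ) (ToricFan.RatFun n) p) ∧
    (k < n → ToricFan.pushforward Δ f = 0) ∧
    (k = n → ∃ c : ℤ, ToricFan.pushforward Δ f = (c : ToricFan.RatFun n)) := by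
  obtain ⟨s, a, hs, hsa⟩ := f.exists_denominator_pushforward hΔ
  obtain ⟨p, hp⟩ := ToricFan.exists_algebraMap_eq_of_regularAlong
    (fun u hu => f.pushforward_mem_regularAlong hΔ hu) s hs a hsa
  have hdeg : ∀ d ∈ p.support, (d.degree : ℤ) = (k : ℤ) - (n : ℤ) := fun d hd =>
    (hp ▸ f.isHomogeneousFraction_pushforward hΔ).degree_eq hd
  -- A polynomial whose monomials all have degree `k - n` is zero if this is negative, and equals
  -- its constant coefficient if this is `0`.
  refine ⟨⟨p, hdeg, hp⟩, fun hkn => ?_, fun hkn => ⟨MvPolynomial.coeff 0 p, ?_⟩⟩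
  · have : p = 0 := by
      rw [← MvPolynomial.support_eq_empty, Finset.eq_empty_iff_forall_notMem]
      intro d hd
      have := hdeg d hd
      omega
    rw [hp, this, map_zero]
  · have : p = MvPolynomial.C (MvPolynomial.coeff 0 p) := by
      ext d
      rw [MvPolynomial.coeff_C]
      split_ifs with h
      · rw [h]
      · by_contra hne
        have := hdeg d (MvPolynomial.mem_support_iff.mpr hne)
        exact h ((Finsupp.degree_eq_zero_iff d).mp (by omega)).symm
    rw [hp]
    conv_lhs => rw [this]
    simp
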